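/- Consider the cubic–quintic nonlinear Schrödinger equation on $\mathbb{R}$, $$ i\psi_t = \psi_{xx} - \psi + 4|\psi|^2\psi - 3|\psi|^4\psi, \qquad (1) $$ and the energy space $$ \mathcal{E} = \{\psi \in H^1_{\rm loc}(\mathbb{R};\mathbb{C}) : \ \psi_x \in L^2(\mathbb{R}),\ \psi(1-|\psi|^2) \in L^2(\mathbb{R})\}, $$ whose elements are identified with their (locally absolutely continuous) continuous representatives, with the Zhidkov norm $\|\psi\|_{X^1} = \|\psi\|_{L^\infty} + \|\psi_x\|_{L^2}$, the distance $$ d_{\mathcal{E}}(\psi,\chi) = \|\psi-\chi\|_{X^1} + \|\psi(1-|\psi|^2) - \chi(1-|\chi|^2)\|_{L^2}, $$ and the energy $E(\psi) = \int_{\mathbb{R}} \left[|\psi_x|^2 + |\psi|^2(1-|\psi|^2)^2\right] dx$. For an interval $I \subset \mathbb{R}$, a solution of (1) on $I$ is a curve $\psi \in C(I,\mathcal{E})$ such that, for every $\varphi \in C_c^\infty(\mathbb{R};\mathbb{C})$ and every $t \in I$, $$ i \frac{d}{dt}\int_{\mathbb{R}} \psi\varphi\, dx = \int_{\mathbb{R}}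 \left[\psi\varphi_{xx} + (-\psi + 4|\psi|^2\psi - 3|\psi|^4\psi)\varphi\right] dx $$ (with the derivative taken within $I$). Then (1) is locally and globally well-posed in $\mathcal{E}$, that is: 1. $\mathcal{E} \subset L^\infty(\mathbb{R})$ (hence $\|\psi\|_{X^1}<\infty$ for all $\psi\in\mathcal{E}$). 2. (Uniqueness) Two solutions of (1) on the same interval $I$ that coincide at some time $t_0 \in I$ coincide on $I$. 3. (Energy conservation) If $\psi$ is a solution of (1) on an interval $I$, then $E(\psi(t))$ does not depend on $t \in I$. 4. (Local well-posedness) For every $M \ge 0$ there is $T = T(M) > 0$ such that every $\psi_0 \in \mathcal{E}$ with $\|\psi_0\|_{X^1} \le M$ is the initial value $\psi(0)=\psi_0$ of a solution of (1) on $[-T,T]$, and the map $\psi_0 \mapsto \psi$ is continuous from $\{\psi_0\in\mathcal{E} : \|\psi_0\|_{X^1} \le M\}$ to $C([-T,T],\mathcal{E})$ with uniform convergence. 5. (Global well-posedness) Every $\psi_0 \in \mathcal{E}$ is the initial value $\psi(0)=\psi_0$ of a solution $\psi \in C(\mathbb{R},\mathcal{E})$ of (1) on $\mathbb{R}$, and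 the map $\psi_0 \mapsto \psi$ is continuous from $\mathcal{E}$ to $C(\mathbb{R},\mathcal{E})$ with locally uniform convergence. -/

import Mathlib

open MeasureTheory Set Filter Topology
open scoped ENNReal NNReal ContDiff

noncomputable section

namespace CubicQuintic

/-- Membership in the energy space
`{ψ ∈ H¹_loc(ℝ) : ψ_x ∈ L²(ℝ), ψ (1 - |ψ|²) ∈ L²(ℝ)}`.
As usual in one dimension, a class in `H¹_loc(ℝ)` is identified with its continuous
representative: this is a locally absolutely continuous function, whose weak derivative is its
almost everywhere defined classical derivative. -/
structure MemEnergy (ψ : ℝ → ℂ) : Prop where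
  absCont : ∀ a b : ℝ, AbsolutelyContinuousOnInterval ψ a b
  deriv_memLp : MemLp (deriv ψ) 2 volume
  potential_memLp : MemLp (fun x => ψ x * (1 - (‖ψ x‖ : ℂ) ^ 2)) 2 volume

theorem MemEnergy.continuous {ψ : ℝ → ℂ} (h : MemEnergy ψ) : Continuous ψ := by
  rw [continuous_iff_continuousAt]
  intro x
  refine (h.absCont (x - 1) (x + 1)).continuousOn.continuousAt ?_
  rw [uIcc_of_le (by linarith)]
  exact Icc_mem_nhds (by linarith) (by linarith)

/-- The energy space. -/
def EnergySpace : Type := {ψ : ℝ → ℂ // MemEnergy ψ}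

namespace EnergySpace

instance : CoeFun EnergySpace (fun _ => ℝ → ℂ) := ⟨Subtype.val⟩

/-- The function `ψ (1 - |ψ|²)`, which is square integrable. -/
def potential (ψ : EnergySpace) (x : ℝ) : ℂ := ψ x * (1 - (‖ψ x‖ : ℂ) ^ 2)

/-- The distance of the energy space: the distance of the Zhidkov space `X¹` plus the `L²`-distance
of the functions `ψ (1 - |ψ|²)`. -/
instance : EDist EnergySpace where
  edist ψ χ :=
    eLpNorm (fun x => ψ x - χ x) ∞ volume
      + eLpNorm (fun x => deriv ψ x - deriv χ x) 2 volume
      + eLpNorm (fun x => ψ.potential x - χ.potential x) 2 volume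

theorem edist_def (ψ χ : EnergySpace) : edist ψ χ =
    eLpNorm (fun x => ψ x - χ x) ∞ volume
      + eLpNorm (fun x => deriv ψ x - deriv χ x) 2 volume
      + eLpNorm (fun x => ψ.potential x - χ.potential x) 2 volume := rfl

theorem eLpNorm_sub_triangle {p : ℝ≥0∞} (hp : 1 ≤ p) {f g h : ℝ → ℂ}
    (hf : AEStronglyMeasurable f volume) (hg : AEStronglyMeasurable g volume)
    (hh : AEStronglyMeasurable h volume) :
    eLpNorm (fun x => f x - h x) p volume
      ≤ eLpNorm (fun x => f x - g x) p volume + eLpNorm (fun x => g x - h x) p volume := by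
  have e : (fun x => f x - h x) = (fun x => f x - g x) + (fun x => g x - h x) := by
    funext x; simp
  rw [e]
  exact eLpNorm_add_le (hf.sub hg) (hg.sub hh) hp

instance : EMetricSpace EnergySpace where
  edist_self ψ := by
    have h0 : ∀ p : ℝ≥0∞, eLpNorm (fun _ : ℝ => (0 : ℂ)) p volume = 0 :=
      fun _ => eLpNorm_zero'
    simp only [edist_def, sub_self, h0, add_zero]
  edist_comm ψ χ := by
    rw [edist_def, edist_def]
    congr 1
    · congr 1
      · exact eLpNorm_sub_comm _ _ _ _
      · exact eLpNorm_sub_comm _ _ _ _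
    · exact eLpNorm_sub_comm _ _ _ _
  edist_triangle ψ χ ξ := by
    rw [edist_def, edist_def, edist_def]
    have h1 := eLpNorm_sub_triangle (p := ∞) le_top ψ.2.continuous.aestronglyMeasurable
      χ.2.continuous.aestronglyMeasurable ξ.2.continuous.aestronglyMeasurable
    have h2 := eLpNorm_sub_triangle (p := 2) one_le_two ψ.2.deriv_memLp.1
      χ.2.deriv_memLp.1 ξ.2.deriv_memLp.1
    have h3 := eLpNorm_sub_triangle (p := 2) one_le_two ψ.2.potential_memLp.1
      χ.2.potential_memLp.1 ξ.2.potential_memLp.1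
    refine (add_le_add (add_le_add h1 h2) h3).trans (le_of_eq ?_)
    simp only [potential]
    abel
  eq_of_edist_eq_zero := by
    intro ψ χ h
    rw [edist_def, add_eq_zero, add_eq_zero] at h
    have h0 := (eLpNorm_eq_zero_iff (f := fun x => ψ x - χ x)
      (ψ.2.continuous.sub χ.2.continuous).aestronglyMeasurable (by simp)).1 h.1.1
    have h1 := Continuous.ae_eq_iff_eq volume (ψ.2.continuous.sub χ.2.continuous)
      (continuous_const (y := (0 : ℂ)))
    have h2 := h1.1 h0
    apply Subtype.ext
    funext x
    exact sub_eq_zero.1 (congrFun h2 x)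

/-- The norm `‖ψ‖_{L^∞} + ‖ψ_x‖_{L²}` of the Zhidkov space `X¹`. -/
def zhidkovNorm (ψ : EnergySpace) : ℝ≥0∞ :=
  eLpNorm ψ ∞ volume + eLpNorm (deriv ψ) 2 volume

/-- The energy `∫ (|ψ_x|² + |ψ|² (1 - |ψ|²)²) dx`. -/
def energy (ψ : EnergySpace) : ℝ :=
  ∫ x, (‖deriv ψ x‖ ^ 2 + ‖ψ x‖ ^ 2 * (1 - ‖ψ x‖ ^ 2) ^ 2)

end EnergySpace

/-- `u` is a solution of `i u_t = u_xx - u + 4 |u|² u - 3 |u|⁴ u` on the time interval `I`: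
a continuous curve in the energy space such that, at every time, the equation holds in the sense of
distributions on `ℝ`. -/
structure IsSolutionOn (I : Set ℝ) (u : ℝ → EnergySpace) : Prop where
  continuousOn : ContinuousOn u I
  equation : ∀ φ : ℝ → ℂ, ContDiff ℝ ∞ φ → HasCompactSupport φ → ∀ t ∈ I,
    HasDerivWithinAt (fun s => Complex.I * ∫ x, u s x * φ x)
      (∫ x, (u t x * deriv (deriv φ) x
        + (-u t x + 4 * (‖u t x‖ : ℂ) ^ 2 * u t x - 3 * (‖u t x‖ : ℂ) ^ 4 * u t x) * φ x)) I t

end CubicQuintic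

end

open CubicQuintic

/-! Elements of the energy space need not lie in `L²`, so the free group does not act on them
directly. What saves the argument is that the dynamics stays in `ψ₀ + H¹`. Write the equation as
`u_t = -i u_xx - i nl(u)`, with group `S(t)`. Formally `S(t)ψ₀ - ψ₀ = ∂⁻¹(S(t) - 1)∂ψ₀`, a bounded
multiplier into `H¹` applied to `∂ψ₀ ∈ L²`. Moreover `nl(ψ) = -ψ(1 - |ψ|²)(1 - 3|ψ|²)` is an `L²`
function times a bounded one; it lies in `H¹` and is Lipschitz in `ψ` on bounded sets
(`exists_F_bound`). Adding an `H¹` function preserves the energy space, again with Lipschitz bounds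
(`exists_distLE_shift`). `H¹` is coded by `L²` through `h ↦ h + h'`, with inverse `x ↦ (J0 x, J1
x)`.

Existence: in the interaction variable `y`, where `u = ψ₀ + (1 + ∂)⁻¹(K(t)∂ψ₀ + S(t)y)`, the
equation is an ODE `y' = S(-t)N(u)` in `L²` with locally Lipschitz right side. Picard–Lindelöf gives
a solution and Lipschitz dependence (`exists_isMild`), and `IsMild.isSolutionOn` recovers the weak
equation.

Uniqueness must cover all weak solutions. Their time increments are shown to lie in `H¹`
(`memLp_of_weak`), so they may be used as test functions. The difference of two solutions that meet
is then in `H¹`; the dispersive term contributes the real part of an imaginary number, and Gronwall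
concludes (`IsSolutionOn.eq_of_eq`).

Energy: the potential part is differentiated by a Taylor expansion whose quadratic remainder is
negligible. For the derivative part, uniqueness identifies any solution near a given time with a
mild one, and there `‖u_x‖ = ‖∂ψ₀ + J1 y‖` with `y` differentiable. The two derivatives cancel,
without regularizing the data.

Globalization: the energy is the sum of the squared norms of `ψ_x` and of the potential, and it also
controls the sup norm (`bddBy_of_energy_le`). The length of the local step thus depends only on a
conserved quantity; local solutions are glued, and their Lipschitz constants multiply. The local
statement is then a restriction of the global flow. -/

noncomputable section

namespace CubicQuintic

/-! ### Primitives of locally integrable functions -/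

/-- `u` is a primitive of the locally integrable function `g`. -/
structure IsPrim (g u : ℝ → ℂ) : Prop where
  locInt : LocallyIntegrable g volume
  sub_eq : ∀ x y : ℝ, u y - u x = ∫ t in x..y, g t

/-- Proved for real and imaginary parts separately, on an interval enlarged so that it contains the
base point `c`, then restricted. -/
theorem absolutelyContinuous_intervalIntegral {g : ℝ → ℂ} (hg : LocallyIntegrable g volume)
    (c a b : ℝ) : AbsolutelyContinuousOnInterval (fun x => ∫ t in c..x, g t) a b := by
  have hi : ∀ x y : ℝ, IntervalIntegrable g volume x y := fun x y =>
    (hg.integrableOn_isCompact isCompact_uIcc).intervalIntegrable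
  have hre : LocallyIntegrable (fun x => (g x).re) volume := fun x => by
    obtain ⟨s, hs, hgs⟩ := hg x
    exact ⟨s, hs, hgs.re⟩
  have him : LocallyIntegrable (fun x => (g x).im) volume := fun x => by
    obtain ⟨s, hs, hgs⟩ := hg x
    exact ⟨s, hs, hgs.im⟩
  have key : ∀ f : ℝ → ℝ, LocallyIntegrable f volume →
      AbsolutelyContinuousOnInterval (fun x => ∫ t in c..x, f t) a b := by
    intro f hf
    have h1 : IntervalIntegrable f volume (min a c) (max b (max a c)) :=
      (hf.integrableOn_isCompact isCompact_uIcc).intervalIntegrable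
    have hle : min a c ≤ max b (max a c) :=
      (min_le_left _ _).trans ((le_max_left _ _).trans (le_max_right _ _))
    have h2 : IntervalIntegrable f volume (min (min a c) b) (max b (max a c)) :=
      (hf.integrableOn_isCompact isCompact_uIcc).intervalIntegrable
    have hle2 : min (min a c) b ≤ max b (max a c) := (min_le_left _ _).trans hle
    refine (h2.absolutelyContinuousOnInterval_intervalIntegral (c := c) ?_).mono ?_
    · rw [uIcc_of_le hle2]
      exact ⟨(min_le_left _ _).trans (min_le_right _ _),
        (le_max_right a c).trans (le_max_right _ _)⟩
    · rw [uIcc_of_le hle2]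
      refine uIcc_subset_Icc ⟨(min_le_left _ _).trans (min_le_left _ _),
        (le_max_left a c).trans (le_max_right _ _)⟩ ⟨min_le_right _ _, le_max_left _ _⟩
  have e : (fun x => ∫ t in c..x, g t)
      = fun x => (∫ t in c..x, (g t).re) • (1 : ℂ) + (∫ t in c..x, (g t).im) • Complex.I := by
    funext x
    apply Complex.ext
    · have := Complex.reCLM.intervalIntegral_comp_comm (hi c x)
      simp only [Complex.reCLM_apply] at this
      simp [this]
    · have := Complex.imCLM.intervalIntegral_comp_comm (hi c x)
      simp only [Complex.imCLM_apply] at this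
      simp [this]
  have hc : ∀ z : ℂ, AbsolutelyContinuousOnInterval (fun _ => z) a b := fun z =>
    (LipschitzWith.const z).lipschitzOnWith.absolutelyContinuousOnInterval
  rw [e]
  exact ((key _ hre).fun_smul (hc 1)).fun_add ((key _ him).fun_smul (hc Complex.I))

theorem ae_differentiableAt_of_absolutelyContinuous {u : ℝ → ℂ}
    (hu : ∀ a b : ℝ, AbsolutelyContinuousOnInterval u a b) : ∀ᵐ x, DifferentiableAt ℝ u x := by
  have h : ∀ᵐ x : ℝ, ∀ n : ℕ, x ∈ uIcc (-(n : ℝ)) n → DifferentiableAt ℝ u x :=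
    ae_all_iff.2 fun n => (hu _ _).boundedVariationOn.ae_differentiableAt_of_mem_uIcc
  filter_upwards [h] with x hx
  obtain ⟨n, hn⟩ := exists_nat_ge |x|
  refine hx n ?_
  rw [uIcc_of_le (by linarith [abs_nonneg x])]
  exact abs_le.1 hn

/-- Subtracting `∫ g` leaves an absolutely continuous function with derivative zero almost
everywhere, hence a constant. -/
theorem IsPrim.of_absolutelyContinuous {g u : ℝ → ℂ}
    (hu : ∀ a b : ℝ, AbsolutelyContinuousOnInterval u a b)
    (hg : LocallyIntegrable g volume) (h : ∀ᵐ x, HasDerivAt u (g x) x) : IsPrim g u := by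
  refine ⟨hg, fun x y => ?_⟩
  have hac : AbsolutelyContinuousOnInterval (fun z => u z - ∫ t in x..z, g t) x y :=
    (hu x y).fun_sub (absolutelyContinuous_intervalIntegral hg x x y)
  obtain ⟨C, hC⟩ := hac.const_of_ae_hasDerivAt_zero (by
    filter_upwards [h, LocallyIntegrable.ae_hasDerivAt_integral hg] with z h1 h2 _
    simpa using! h1.sub (h2 x))
  have h1 := hC x left_mem_uIcc
  have h2 := hC y right_mem_uIcc
  simp only [intervalIntegral.integral_same, sub_zero] at h1
  rw [← h1] at h2
  rw [← h2]; ring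

namespace IsPrim

variable {g k u v : ℝ → ℂ}

theorem eq_add (h : IsPrim g u) (c x : ℝ) : u x = u c + ∫ t in c..x, g t := by
  rw [← h.sub_eq]; ring

theorem absolutelyContinuous (h : IsPrim g u) (a b : ℝ) :
    AbsolutelyContinuousOnInterval u a b := by
  have e : u = fun x => u a + ∫ t in a..x, g t := funext fun x => h.eq_add a x
  rw [e]
  exact (LipschitzWith.const (u a)).lipschitzOnWith.absolutelyContinuousOnInterval.fun_add
    (absolutelyContinuous_intervalIntegral h.locInt a a b)

theorem ae_hasDerivAt (h : IsPrim g u) : ∀ᵐ x, HasDerivAt u (g x) x := by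
  have e : u = fun x => u 0 + ∫ t in (0 : ℝ)..x, g t := funext fun x => h.eq_add 0 x
  filter_upwards [LocallyIntegrable.ae_hasDerivAt_integral h.locInt] with x hx
  rw [e]
  exact (hx 0).const_add _

theorem deriv_ae (h : IsPrim g u) : deriv u =ᵐ[volume] g := by
  filter_upwards [h.ae_hasDerivAt] with x hx using hx.deriv

theorem continuous (h : IsPrim g u) : Continuous u := by
  rw [continuous_iff_continuousAt]
  intro x
  refine (h.absolutelyContinuous (x - 1) (x + 1)).continuousOn.continuousAt ?_
  rw [uIcc_of_le (by linarith)]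
  exact Icc_mem_nhds (by linarith) (by linarith)

theorem intervalIntegrable (h : IsPrim g u) (x y : ℝ) : IntervalIntegrable g volume x y :=
  (h.locInt.integrableOn_isCompact isCompact_uIcc).intervalIntegrable

theorem congr_left (h : IsPrim g u) (hgk : g =ᵐ[volume] k) : IsPrim k u := by
  refine ⟨h.locInt.congr hgk, fun x y => ?_⟩
  rw [h.sub_eq]
  refine intervalIntegral.integral_congr_ae ?_
  filter_upwards [hgk] with t ht _ using ht

theorem add (h : IsPrim g u) (h' : IsPrim k v) :
    IsPrim (fun x => g x + k x) (fun x => u x + v x) := by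
  refine ⟨h.locInt.add h'.locInt, fun x y => ?_⟩
  rw [intervalIntegral.integral_add (h.intervalIntegrable x y) (h'.intervalIntegrable x y),
    ← h.sub_eq, ← h'.sub_eq]
  ring

theorem sub (h : IsPrim g u) (h' : IsPrim k v) :
    IsPrim (fun x => g x - k x) (fun x => u x - v x) := by
  refine ⟨h.locInt.sub h'.locInt, fun x y => ?_⟩
  rw [intervalIntegral.integral_sub (h.intervalIntegrable x y) (h'.intervalIntegrable x y),
    ← h.sub_eq, ← h'.sub_eq]
  ring

theorem mul (h : IsPrim g u) (h' : IsPrim k v) :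
    IsPrim (fun x => g x * v x + u x * k x) (fun x => u x * v x) := by
  refine of_absolutelyContinuous (fun a b => ?_) ?_ ?_
  · exact (h.absolutelyContinuous a b).fun_smul (h'.absolutelyContinuous a b)
  · refine LocallyIntegrable.add ?_ ?_
    · have := h.locInt.locallyIntegrableOn univ
      exact locallyIntegrableOn_univ.1
        (this.mul_continuousOn h'.continuous.continuousOn isOpen_univ.isLocallyClosed)
    · have := h'.locInt.locallyIntegrableOn univ
      exact locallyIntegrableOn_univ.1
        (this.continuousOn_mul h.continuous.continuousOn isOpen_univ.isLocallyClosed)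
  · filter_upwards [h.ae_hasDerivAt, h'.ae_hasDerivAt] with x h1 h2
    exact h1.mul h2

theorem of_contDiff {φ : ℝ → ℂ} (hφ : ContDiff ℝ 1 φ) : IsPrim (deriv φ) φ := by
  refine ⟨(hφ.continuous_deriv le_rfl).locallyIntegrable, fun x y => ?_⟩
  rw [intervalIntegral.integral_deriv_eq_sub (fun t _ => hφ.differentiable one_ne_zero t)
    ((hφ.continuous_deriv le_rfl).intervalIntegrable _ _)]

theorem conj (h : IsPrim g u) :
    IsPrim (fun x => (starRingEnd ℂ) (g x)) (fun x => (starRingEnd ℂ) (u x)) := by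
  refine ⟨fun x => ?_, fun x y => ?_⟩
  · obtain ⟨s, hs, hgs⟩ := h.locInt x
    exact ⟨s, hs, (Complex.conjLIE.toContinuousLinearEquiv.toContinuousLinearMap).integrable_comp
      hgs⟩
  · rw [intervalIntegral.intervalIntegral_conj, ← h.sub_eq, map_sub]

/-- The chain rule for a continuously differentiable outer function. -/
theorem comp (h : IsPrim g u) {P : ℂ → ℂ} (hP : ContDiff ℝ 1 P) :
    IsPrim (fun x => fderiv ℝ P (u x) (g x)) (fun x => P (u x)) := by
  refine of_absolutelyContinuous (fun a b => ?_) ?_ ?_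
  · obtain ⟨C, hC⟩ := (h.absolutelyContinuous a b).exists_bound
    obtain ⟨K, hK⟩ := hP.contDiffOn.exists_lipschitzOnWith one_ne_zero
      (convex_closedBall (0 : ℂ) C) (isCompact_closedBall 0 C)
    have hu := h.absolutelyContinuous a b
    rw [absolutelyContinuousOnInterval_iff] at hu ⊢
    intro ε hε
    obtain ⟨δ, hδ, H⟩ := hu (ε / (K + 1)) (by positivity)
    refine ⟨δ, hδ, fun E hE hEδ => ?_⟩
    calc ∑ i ∈ Finset.range E.1, dist (P (u (E.2 i).1)) (P (u (E.2 i).2))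
        ≤ ∑ i ∈ Finset.range E.1, K * dist (u (E.2 i).1) (u (E.2 i).2) := by
          refine Finset.sum_le_sum fun i hi => hK.dist_le_mul _ ?_ _ ?_
          · simpa using hC _ (hE.1 i hi).1
          · simpa using hC _ (hE.1 i hi).2
      _ = K * ∑ i ∈ Finset.range E.1, dist (u (E.2 i).1) (u (E.2 i).2) := by
          rw [Finset.mul_sum]
      _ ≤ K * (ε / (K + 1)) := by gcongr; exact (H E hE hEδ).le
      _ < ε := by
          rw [mul_div_assoc', div_lt_iff₀ (by positivity)]
          nlinarith
  · have hc : Continuous fun x => fderiv ℝ P (u x) :=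
      (hP.continuous_fderiv one_ne_zero).comp h.continuous
    rw [MeasureTheory.locallyIntegrable_iff]
    intro K hK
    have hgK := h.locInt.integrableOn_isCompact hK
    obtain ⟨C, hC⟩ := hK.exists_bound_of_continuousOn hc.continuousOn
    refine Integrable.mono' (hgK.norm.const_mul C) ?_ ?_
    · exact isBoundedBilinearMap_apply.continuous.comp_aestronglyMeasurable
        (hc.aestronglyMeasurable.prodMk hgK.aestronglyMeasurable)
    · filter_upwards [ae_restrict_mem hK.measurableSet] with x hx
      exact (ContinuousLinearMap.le_opNorm _ _).trans
        (mul_le_mul_of_nonneg_right (hC x hx) (norm_nonneg _))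
  · filter_upwards [h.ae_hasDerivAt] with x hx
    exact ((hP.differentiable one_ne_zero (u x)).hasFDerivAt).comp_hasDerivAt x hx

/-- The integral of the derivative of an integrable function vanishes. -/
theorem integral_eq_zero (h : IsPrim g u) (hg : Integrable g) (hu : Integrable u) :
    ∫ x, g x = 0 := by
  have h1 : Tendsto (fun n : ℝ => ∫ x in (-n)..n, g x) atTop (𝓝 (∫ x, g x)) :=
    intervalIntegral_tendsto_integral hg tendsto_neg_atTop_atBot tendsto_id
  have h2 : Integrable (fun n : ℝ => u n - u (-n)) := hu.sub hu.comp_neg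
  have h3 : (fun n : ℝ => ∫ x in (-n)..n, g x) = fun n => u n - u (-n) := by
    funext n; rw [h.sub_eq]
  rw [h3] at h1
  -- No decay of `u` is assumed: the boundary term `u n - u (-n)` converges and is integrable in
  -- `n`, so its limit can only be zero.
  refine IntegrableAtFilter.eq_zero_of_tendsto (μ := volume) (h2.integrableAtFilter atTop) ?_ h1
  intro s hs
  rw [← top_le_iff]
  obtain ⟨b, hb⟩ := mem_atTop_sets.1 hs
  rw [← Real.volume_Ici (a := b)]
  exact measure_mono fun x hx => hb x hx

/-- Integration by parts on the line. -/
theorem integral_mul_eq_neg (h : IsPrim g u) (h' : IsPrim k v)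
    (h1 : Integrable fun x => g x * v x) (h2 : Integrable fun x => u x * k x)
    (h3 : Integrable fun x => u x * v x) : ∫ x, u x * k x = - ∫ x, g x * v x := by
  have := (h.mul h').integral_eq_zero (h1.add h2) h3
  rw [integral_add h1 h2] at this
  exact eq_neg_of_add_eq_zero_right this

/-- A function is controlled by its mean and by that of its derivative. -/
theorem norm_sub_le (h : IsPrim g u) {x y : ℝ} (hy : y ∈ Icc x (x + 1)) :
    ‖u x - u y‖ ≤ ∫ t in x..(x + 1), ‖g t‖ := by
  rw [← norm_neg, neg_sub, h.sub_eq]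
  refine (intervalIntegral.norm_integral_le_integral_norm hy.1).trans ?_
  exact intervalIntegral.integral_mono_interval le_rfl hy.1 hy.2
    (Eventually.of_forall fun t => norm_nonneg _) (h.intervalIntegrable _ _).norm

theorem norm_sub_integral_le (h : IsPrim g u) (x : ℝ) :
    ‖u x - ∫ y in x..(x + 1), u y‖ ≤ ∫ t in x..(x + 1), ‖g t‖ := by
  have hu : IntervalIntegrable u volume x (x + 1) := h.continuous.intervalIntegrable _ _
  have e : u x - ∫ y in x..(x + 1), u y = ∫ y in x..(x + 1), (u x - u y) := by
    rw [intervalIntegral.integral_sub (by simp) hu]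
    simp
  rw [e]
  have := intervalIntegral.norm_integral_le_of_norm_le_const (a := x) (b := x + 1)
    (f := fun y => u x - u y) (C := ∫ t in x..(x + 1), ‖g t‖) (by
      intro y hy
      rw [uIoc_of_le (by linarith)] at hy
      exact h.norm_sub_le ⟨hy.1.le, hy.2⟩)
  simpa using this

theorem norm_le_integral (h : IsPrim g u) (x : ℝ) :
    ‖u x‖ ≤ (∫ y in x..(x + 1), ‖u y‖) + ∫ t in x..(x + 1), ‖g t‖ := by
  have h1 := h.norm_sub_integral_le x
  have h2 : ‖∫ y in x..(x + 1), u y‖ ≤ ∫ y in x..(x + 1), ‖u y‖ :=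
    intervalIntegral.norm_integral_le_integral_norm (by linarith)
  have h3 : ‖u x‖ ≤ ‖u x - ∫ y in x..(x + 1), u y‖ + ‖∫ y in x..(x + 1), u y‖ :=
    norm_le_norm_sub_add _ _
  linarith

end IsPrim

theorem IsPrim.of_locallyIntegrable {g : ℝ → ℂ} (hg : LocallyIntegrable g volume) (c : ℝ) (z : ℂ) :
    IsPrim g (fun x => z + ∫ t in c..x, g t) := by
  refine ⟨hg, fun x y => ?_⟩
  have hi : ∀ x y : ℝ, IntervalIntegrable g volume x y := fun x y =>
    (hg.integrableOn_isCompact isCompact_uIcc).intervalIntegrable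
  rw [← intervalIntegral.integral_interval_sub_left (hi c y) (hi c x)]
  ring

/-! ### Weak derivatives -/

theorem integrable_mul_of_hasCompactSupport {a φ : ℝ → ℂ} (ha : LocallyIntegrable a volume)
    (hφ : Continuous φ) (hs : HasCompactSupport φ) : Integrable fun x => a x * φ x := by
  have := ha.integrable_smul_right_of_hasCompactSupport hφ hs
  simpa using this

theorem IsPrim.integral_mul_deriv {g u φ : ℝ → ℂ} (h : IsPrim g u) (hφ : ContDiff ℝ 1 φ)
    (hs : HasCompactSupport φ) : ∫ x, u x * deriv φ x = - ∫ x, g x * φ x :=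
  h.integral_mul_eq_neg (IsPrim.of_contDiff hφ)
    (integrable_mul_of_hasCompactSupport h.locInt hφ.continuous hs)
    (integrable_mul_of_hasCompactSupport h.continuous.locallyIntegrable
      (hφ.continuous_deriv le_rfl) hs.deriv)
    (integrable_mul_of_hasCompactSupport h.continuous.locallyIntegrable hφ.continuous hs)

/-- The primitive starting to the left of the support vanishes there, and vanishes to the right of
the support because the total integral is zero. -/
theorem exists_primitive_of_integral_eq_zero {φ : ℝ → ℂ} (hφ : ContDiff ℝ ∞ φ)
    (hs : HasCompactSupport φ) (h0 : ∫ x, φ x = 0) :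
    ∃ θ : ℝ → ℂ, ContDiff ℝ ∞ θ ∧ HasCompactSupport θ ∧ deriv θ = φ := by
  obtain ⟨R, hR⟩ := hs.isCompact.isBounded.subset_closedBall 0
  have hz : ∀ x, R < |x| → φ x = 0 := fun x hx => by
    by_contra hne
    have := hR (subset_tsupport φ hne)
    rw [mem_closedBall_zero_iff, Real.norm_eq_abs] at this
    linarith
  obtain ⟨S, hS, hRS⟩ : ∃ S : ℝ, 0 ≤ S ∧ R < S :=
    ⟨|R| + 1, by positivity, by linarith [le_abs_self R]⟩
  have hd : ∀ x, HasDerivAt (fun x => ∫ t in (-S)..x, φ t) (φ x) x := fun x =>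
    intervalIntegral.integral_hasDerivAt_right (hφ.continuous.intervalIntegrable _ _)
      (hφ.continuous.stronglyMeasurableAtFilter _ _) hφ.continuous.continuousAt
  have hderiv : deriv (fun x => ∫ t in (-S)..x, φ t) = φ := funext fun x => (hd x).deriv
  refine ⟨fun x => ∫ t in (-S)..x, φ t, ?_, ?_, hderiv⟩
  · rw [contDiff_infty_iff_deriv, hderiv]
    exact ⟨fun x => (hd x).differentiableAt, hφ⟩
  · refine HasCompactSupport.intro (isCompact_closedBall (0 : ℝ) S) fun x hx => ?_
    rw [mem_closedBall_zero_iff, Real.norm_eq_abs, not_le] at hx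
    rcases le_total 0 x with hx0 | hx0
    · rw [abs_of_nonneg hx0] at hx
      rw [← h0, intervalIntegral.integral_of_le (by linarith)]
      refine setIntegral_eq_integral_of_forall_compl_eq_zero fun t ht => ?_
      by_contra hne
      have h1 : |t| ≤ R := not_lt.1 fun hlt => hne (hz t hlt)
      exact ht ⟨by linarith [(abs_le.1 h1).1], by linarith [(abs_le.1 h1).2]⟩
    · rw [abs_of_nonpos hx0] at hx
      refine intervalIntegral.integral_zero_ae (Eventually.of_forall fun t ht => hz t ?_)
      rw [uIoc_of_ge (by linarith)] at ht
      rw [abs_of_nonpos (by linarith [ht.2])]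
      linarith [ht.2]

/-- A locally integrable function with vanishing weak derivative is constant. -/
theorem exists_ae_eq_const {a : ℝ → ℂ} (ha : LocallyIntegrable a volume)
    (h : ∀ φ : ℝ → ℂ, ContDiff ℝ ∞ φ → HasCompactSupport φ → ∫ x, a x * deriv φ x = 0) :
    ∃ c : ℂ, a =ᵐ[volume] fun _ => c := by
  obtain ⟨f⟩ : Nonempty (ContDiffBump (0 : ℝ)) := inferInstance
  set ρ : ℝ → ℂ := fun x => (f.normed volume x : ℂ) with hρ
  have hρd : ContDiff ℝ ∞ ρ := Complex.ofRealCLM.contDiff.comp f.contDiff_normed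
  have hρs : HasCompactSupport ρ :=
    f.hasCompactSupport_normed.comp_left (g := fun x : ℝ => (x : ℂ)) Complex.ofReal_zero
  have hρ1 : ∫ x, ρ x = 1 := by
    rw [hρ, integral_complex_ofReal, f.integral_normed, Complex.ofReal_one]
  refine ⟨∫ x, a x * ρ x, ?_⟩
  have hsub : LocallyIntegrable (fun x => a x - ∫ x, a x * ρ x) volume :=
    ha.sub (continuous_const.locallyIntegrable)
  have key := ae_eq_zero_of_integral_contDiff_smul_eq_zero hsub fun g hg hgs => by
    set G : ℝ → ℂ := fun x => (g x : ℂ) with hG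
    have hGd : ContDiff ℝ ∞ G := Complex.ofRealCLM.contDiff.comp hg
    have hGs : HasCompactSupport G :=
      hgs.comp_left (g := fun x : ℝ => (x : ℂ)) Complex.ofReal_zero
    have hGi : Integrable G := hGd.continuous.integrable_of_hasCompactSupport hGs
    have hρi : Integrable ρ := hρd.continuous.integrable_of_hasCompactSupport hρs
    set c := ∫ x, G x with hc
    have hcρs : HasCompactSupport fun x => c * ρ x := hρs.mul_left (f := fun _ => c)
    -- Removing from `G` its integral times the unit-mass bump `ρ` leaves mean zero, hence a
    -- derivative `θ'`. Testing against `θ` gives `∫ a G = (∫ G)(∫ a ρ)`, so the constant is `∫ a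
    -- ρ`.
    obtain ⟨θ, hθ, hθs, hθd⟩ := exists_primitive_of_integral_eq_zero
      (φ := fun x => G x - c * ρ x) (hGd.sub (contDiff_const.mul hρd)) (hGs.sub hcρs) (by
        rw [integral_sub hGi (hρi.const_mul c), integral_const_mul, hρ1, mul_one, sub_self])
    have h1 := h θ hθ hθs
    rw [hθd] at h1
    have i1 := integrable_mul_of_hasCompactSupport ha hGd.continuous hGs
    have i2 := integrable_mul_of_hasCompactSupport ha hρd.continuous hρs
    have e1 : ∀ x, a x * (G x - c * ρ x) = a x * G x - c * (a x * ρ x) := fun x => by ring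
    simp only [e1] at h1
    rw [integral_sub i1 (i2.const_mul c), integral_const_mul] at h1
    have e2 : ∀ x, g x • (a x - ∫ x, a x * ρ x) = a x * G x - (∫ x, a x * ρ x) * G x := by
      intro x
      simp only [hG, Complex.real_smul]
      ring
    simp only [e2]
    rw [integral_sub i1 (hGi.const_mul _), integral_const_mul, ← hc, mul_comm _ c]
    exact h1
  filter_upwards [key] with x hx using sub_eq_zero.1 hx

/-- A locally integrable function with locally integrable weak derivative is almost everywhere
equal to a primitive of it. -/
theorem exists_isPrim_of_weakDeriv {a b : ℝ → ℂ} (ha : LocallyIntegrable a volume)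
    (hb : LocallyIntegrable b volume)
    (h : ∀ φ : ℝ → ℂ, ContDiff ℝ ∞ φ → HasCompactSupport φ →
      ∫ x, a x * deriv φ x = - ∫ x, b x * φ x) :
    ∃ u : ℝ → ℂ, IsPrim b u ∧ a =ᵐ[volume] u := by
  have hB := IsPrim.of_locallyIntegrable hb 0 0
  obtain ⟨c, hc⟩ := exists_ae_eq_const (ha.sub hB.continuous.locallyIntegrable)
    fun φ hφ hs => by
      have hφ1 : ContDiff ℝ 1 φ := hφ.of_le (by exact_mod_cast le_top)
      have i1 := integrable_mul_of_hasCompactSupport ha (hφ1.continuous_deriv le_rfl) hs.deriv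
      have i2 := integrable_mul_of_hasCompactSupport hB.continuous.locallyIntegrable
        (hφ1.continuous_deriv le_rfl) hs.deriv
      simp only [Pi.sub_apply, sub_mul]
      rw [integral_sub i1 i2, h φ hφ hs, hB.integral_mul_deriv hφ1 hs, sub_self]
  refine ⟨fun x => c + ∫ t in (0 : ℝ)..x, b t, IsPrim.of_locallyIntegrable hb 0 c, ?_⟩
  filter_upwards [hc] with x hx
  simp only [Pi.sub_apply, zero_add] at hx
  rw [← hx]; ring

end CubicQuintic

namespace CubicQuintic

open scoped ComplexConjugate FourierTransform SchwartzMap InnerProductSpace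

/-! ### Fourier multipliers on `L²(ℝ)` -/

/-- The Hilbert space `L²(ℝ; ℂ)`. -/
abbrev L2 : Type := Lp ℂ 2 (volume : Measure ℝ)

/-- Bounded measurable symbols. -/
structure BddSymbol (m : ℝ → ℂ) : Prop where
  measurable : Measurable m
  bound : ∃ C, ∀ ξ, ‖m ξ‖ ≤ C

namespace BddSymbol

variable {m n : ℝ → ℂ}

theorem mul (hm : BddSymbol m) (hn : BddSymbol n) : BddSymbol fun ξ => m ξ * n ξ := by
  obtain ⟨C, hC⟩ := hm.bound
  obtain ⟨D, hD⟩ := hn.bound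
  refine ⟨hm.measurable.mul hn.measurable, C * D, fun ξ => ?_⟩
  rw [norm_mul]
  exact mul_le_mul (hC ξ) (hD ξ) (norm_nonneg _) ((norm_nonneg _).trans (hC ξ))

theorem add (hm : BddSymbol m) (hn : BddSymbol n) : BddSymbol fun ξ => m ξ + n ξ := by
  obtain ⟨C, hC⟩ := hm.bound
  obtain ⟨D, hD⟩ := hn.bound
  exact ⟨hm.measurable.add hn.measurable, C + D,
    fun ξ => (norm_add_le _ _).trans (add_le_add (hC ξ) (hD ξ))⟩

theorem sub (hm : BddSymbol m) (hn : BddSymbol n) : BddSymbol fun ξ => m ξ - n ξ := by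
  obtain ⟨C, hC⟩ := hm.bound
  obtain ⟨D, hD⟩ := hn.bound
  exact ⟨hm.measurable.sub hn.measurable, C + D,
    fun ξ => (norm_sub_le _ _).trans (add_le_add (hC ξ) (hD ξ))⟩

theorem const (c : ℂ) : BddSymbol fun _ => c := ⟨measurable_const, ‖c‖, fun _ => le_rfl⟩

theorem star (hm : BddSymbol m) : BddSymbol fun ξ => conj (m ξ) := by
  obtain ⟨C, hC⟩ := hm.bound
  exact ⟨Complex.continuous_conj.measurable.comp hm.measurable, C, fun ξ => by
    rw [RCLike.norm_conj]; exact hC ξ⟩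

theorem memLp_mul (hm : BddSymbol m) (x : L2) : MemLp (fun ξ => m ξ * x ξ) 2 volume := by
  obtain ⟨C, hC⟩ := hm.bound
  exact (Lp.memLp x).of_le_mul (c := C)
    (hm.measurable.aestronglyMeasurable.mul (Lp.memLp x).aestronglyMeasurable)
    (Eventually.of_forall fun ξ => by
      rw [norm_mul]; exact mul_le_mul_of_nonneg_right (hC ξ) (norm_nonneg _))

end BddSymbol

theorem norm_le_of_ae_norm_le {x y : L2} {C : ℝ} (h : ∀ᵐ ξ, ‖x ξ‖ ≤ C * ‖y ξ‖) :
    ‖x‖ ≤ C * ‖y‖ := Lp.norm_le_mul_norm_of_ae_le_mul h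

open Classical in
/-- Multiplication by a bounded symbol. -/
def mulOp (m : ℝ → ℂ) : L2 →L[ℂ] L2 :=
  if hm : BddSymbol m then
    LinearMap.mkContinuous
      { toFun := fun x => (hm.memLp_mul x).toLp
        map_add' := fun x y => by
          apply Lp.ext
          filter_upwards [(hm.memLp_mul (x + y)).coeFn_toLp, (hm.memLp_mul x).coeFn_toLp,
            (hm.memLp_mul y).coeFn_toLp, Lp.coeFn_add x y,
            Lp.coeFn_add (hm.memLp_mul x).toLp (hm.memLp_mul y).toLp] with ξ h1 h2 h3 h4 h5
          rw [h5, h1, Pi.add_apply, h2, h3, h4, Pi.add_apply, mul_add]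
        map_smul' := fun c x => by
          apply Lp.ext
          filter_upwards [(hm.memLp_mul (c • x)).coeFn_toLp, (hm.memLp_mul x).coeFn_toLp,
            Lp.coeFn_smul c x, Lp.coeFn_smul c (hm.memLp_mul x).toLp] with ξ h1 h2 h3 h4
          rw [RingHom.id_apply, h4, h1, Pi.smul_apply, h2, h3, Pi.smul_apply, smul_eq_mul,
            smul_eq_mul]
          ring }
      hm.bound.choose (fun x => norm_le_of_ae_norm_le (by
        filter_upwards [(hm.memLp_mul x).coeFn_toLp] with ξ h1
        simp only [LinearMap.coe_mk, AddHom.coe_mk]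
        rw [h1, norm_mul]
        exact mul_le_mul_of_nonneg_right (hm.bound.choose_spec ξ) (norm_nonneg _)))
  else 0

theorem mulOp_coeFn {m : ℝ → ℂ} (hm : BddSymbol m) (x : L2) :
    mulOp m x =ᵐ[volume] fun ξ => m ξ * x ξ := by
  rw [mulOp, dif_pos hm]
  exact (hm.memLp_mul x).coeFn_toLp

/-- The Fourier transform on `L²`. -/
abbrev FT : L2 ≃ₗᵢ[ℂ] L2 := Lp.fourierTransformₗᵢ ℝ ℂ

/-- The Fourier multiplier with a bounded symbol. -/
def FM (m : ℝ → ℂ) : L2 →L[ℂ] L2 :=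
  (FT.symm.toContinuousLinearEquiv : L2 →L[ℂ] L2) ∘L mulOp m
    ∘L (FT.toContinuousLinearEquiv : L2 →L[ℂ] L2)

theorem FM_apply (m : ℝ → ℂ) (x : L2) : FM m x = FT.symm (mulOp m (FT x)) := rfl

theorem FT_FM (m : ℝ → ℂ) (x : L2) : FT (FM m x) = mulOp m (FT x) := by
  rw [FM_apply, LinearIsometryEquiv.apply_symm_apply]

section symbols

variable {m n : ℝ → ℂ}

theorem FM_FM (hm : BddSymbol m) (hn : BddSymbol n) (x : L2) :
    FM m (FM n x) = FM (fun ξ => m ξ * n ξ) x := by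
  rw [FM_apply, FT_FM, FM_apply]
  congr 1
  apply Lp.ext
  filter_upwards [mulOp_coeFn hm (mulOp n (FT x)), mulOp_coeFn hn (FT x),
    mulOp_coeFn (hm.mul hn) (FT x)] with ξ h1 h2 h3
  rw [h1, h2, h3, mul_assoc]

theorem FM_add (hm : BddSymbol m) (hn : BddSymbol n) (x : L2) :
    FM (fun ξ => m ξ + n ξ) x = FM m x + FM n x := by
  rw [FM_apply, FM_apply, FM_apply, ← map_add]
  congr 1
  apply Lp.ext
  filter_upwards [mulOp_coeFn hm (FT x), mulOp_coeFn hn (FT x),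
    mulOp_coeFn (hm.add hn) (FT x), Lp.coeFn_add (mulOp m (FT x)) (mulOp n (FT x))]
    with ξ h1 h2 h3 h4
  rw [h3, h4, Pi.add_apply, h1, h2, add_mul]

theorem FM_const (c : ℂ) (x : L2) : FM (fun _ => c) x = c • x := by
  have : mulOp (fun _ => c) (FT x) = c • FT x := by
    apply Lp.ext
    filter_upwards [mulOp_coeFn (BddSymbol.const c) (FT x), Lp.coeFn_smul c (FT x)] with ξ h1 h2
    rw [h1, h2, Pi.smul_apply, smul_eq_mul]
  rw [FM_apply, this, ← map_smul, LinearIsometryEquiv.symm_apply_apply]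

theorem FM_const_mul (hm : BddSymbol m) (c : ℂ) (x : L2) :
    FM (fun ξ => c * m ξ) x = c • FM m x := by
  rw [← FM_FM (BddSymbol.const c) hm, FM_const]

theorem FM_sub (hm : BddSymbol m) (hn : BddSymbol n) (x : L2) :
    FM (fun ξ => m ξ - n ξ) x = FM m x - FM n x := by
  have h := FM_add (hm.sub hn) hn x
  simp only [sub_add_cancel] at h
  rw [h, add_sub_cancel_right]

theorem norm_FM_le (hm : BddSymbol m) {C : ℝ} (hC : ∀ ξ, ‖m ξ‖ ≤ C) (x : L2) :
    ‖FM m x‖ ≤ C * ‖x‖ := by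
  rw [FM_apply, LinearIsometryEquiv.norm_map, ← LinearIsometryEquiv.norm_map FT x]
  refine norm_le_of_ae_norm_le ?_
  filter_upwards [mulOp_coeFn hm (FT x)] with ξ h
  rw [h, norm_mul]
  exact mul_le_mul_of_nonneg_right (hC ξ) (norm_nonneg _)

theorem inner_eq_integral {f g : ℝ → ℂ} {x y : L2} (hx : x =ᵐ[volume] f) (hy : y =ᵐ[volume] g) :
    ⟪x, y⟫_ℂ = ∫ t, conj (f t) * g t := by
  rw [L2.inner_def]
  refine integral_congr_ae ?_
  filter_upwards [hx, hy] with t h1 h2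
  rw [h1, h2, RCLike.inner_apply, mul_comm]

theorem inner_FM (hm : BddSymbol m) (x y : L2) :
    ⟪FM m x, y⟫_ℂ = ⟪x, FM (fun ξ => conj (m ξ)) y⟫_ℂ := by
  rw [← LinearIsometryEquiv.inner_map_map FT (FM m x) y,
    ← LinearIsometryEquiv.inner_map_map FT x, FT_FM, FT_FM,
    inner_eq_integral (mulOp_coeFn hm (FT x)) (ae_eq_refl _),
    inner_eq_integral (ae_eq_refl _) (mulOp_coeFn hm.star (FT y))]
  refine integral_congr_ae (Eventually.of_forall fun ξ => ?_)
  simp only [map_mul]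
  ring

theorem norm_sq_eq_integral (x : L2) : ‖x‖ ^ 2 = ∫ t, ‖x t‖ ^ 2 := by
  have h1 := inner_self_eq_norm_sq_to_K (𝕜 := ℂ) x
  rw [inner_eq_integral (ae_eq_refl x) (ae_eq_refl x)] at h1
  have h2 : ∀ t, conj (x t) * x t = ((‖x t‖ ^ 2 : ℝ) : ℂ) := fun t => by
    rw [mul_comm, Complex.mul_conj, Complex.normSq_eq_norm_sq]
  simp only [h2] at h1
  rw [integral_complex_ofReal] at h1
  exact Complex.ofReal_injective (by simpa using h1.symm)

theorem integrable_norm_sq (x : L2) : Integrable fun t => ‖x t‖ ^ 2 :=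
  (Lp.memLp x).integrable_norm_pow two_ne_zero

/-- Plancherel turns the claim into dominated convergence for `|b i - m|² |FT x|²`. -/
theorem tendsto_FM {ι : Type*} {l : Filter ι} [l.IsCountablyGenerated] {b : ι → ℝ → ℂ}
    {C : ℝ} (hb : ∀ᶠ i in l, Measurable (b i) ∧ ∀ ξ, ‖b i ξ‖ ≤ C)
    (hm : BddSymbol m) (h : ∀ ξ, Tendsto (fun i => b i ξ) l (𝓝 (m ξ))) (x : L2) :
    Tendsto (fun i => FM (b i) x) l (𝓝 (FM m x)) := by
  obtain ⟨D, hD⟩ := hm.bound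
  have key : Tendsto (fun i => ∫ ξ, ‖(b i ξ - m ξ) * FT x ξ‖ ^ 2) l (𝓝 (∫ _ : ℝ, (0 : ℝ))) := by
    refine tendsto_integral_filter_of_dominated_convergence
      (fun ξ => (C + D) ^ 2 * ‖FT x ξ‖ ^ 2) ?_ ?_ ?_ ?_
    · filter_upwards [hb] with i hi
      exact ((((hi.1.sub hm.measurable).aestronglyMeasurable.mul
        (Lp.memLp (FT x)).aestronglyMeasurable).norm).pow 2)
    · filter_upwards [hb] with i hi
      refine Eventually.of_forall fun ξ => ?_
      rw [Real.norm_of_nonneg (by positivity), norm_mul, mul_pow]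
      gcongr
      exact (norm_sub_le _ _).trans (add_le_add (hi.2 ξ) (hD ξ))
    · exact (integrable_norm_sq _).const_mul _
    · refine Eventually.of_forall fun ξ => ?_
      have h1 : Tendsto (fun i => ‖(b i ξ - m ξ) * FT x ξ‖ ^ 2) l
          (𝓝 (‖(m ξ - m ξ) * FT x ξ‖ ^ 2)) :=
        ((((h ξ).sub_const _).mul_const _).norm).pow 2
      simpa using h1
  rw [tendsto_iff_norm_sub_tendsto_zero]
  have h2 : (fun i => ‖FM (b i) x - FM m x‖ ^ 2) =ᶠ[l]
      fun i => ∫ ξ, ‖(b i ξ - m ξ) * FT x ξ‖ ^ 2 := by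
    filter_upwards [hb] with i hi
    have hbi : BddSymbol (b i) := ⟨hi.1, C, hi.2⟩
    rw [← FM_sub hbi hm, FM_apply, LinearIsometryEquiv.norm_map, norm_sq_eq_integral]
    refine integral_congr_ae ?_
    filter_upwards [mulOp_coeFn (hbi.sub hm) (FT x)] with ξ hξ
    rw [hξ]
  have h3 : Tendsto (fun i => ‖FM (b i) x - FM m x‖ ^ 2) l (𝓝 0) := by
    simpa using key.congr' h2.symm
  have h4 := h3.sqrt
  simpa [Real.sqrt_sq (norm_nonneg _)] using h4

/-- By the mean value inequality the difference quotients of the symbols are bounded by `C`, so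
`tendsto_FM` applies to them. -/
theorem hasDerivAt_FM {b b' : ℝ → ℝ → ℂ} (hb : ∀ t, BddSymbol (b t))
    {C : ℝ} (hb' : ∀ t, Measurable (b' t)) (hC : ∀ t ξ, ‖b' t ξ‖ ≤ C)
    (h : ∀ t ξ, HasDerivAt (fun s => b s ξ) (b' t ξ) t) (x : L2) (t : ℝ) :
    HasDerivAt (fun s => FM (b s) x) (FM (b' t) x) t := by
  rw [hasDerivAt_iff_tendsto_slope]
  have key : Tendsto (fun s => FM (fun ξ => (((s - t)⁻¹ : ℝ) : ℂ) * (b s ξ - b t ξ)) x) (𝓝[≠] t)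
      (𝓝 (FM (b' t) x)) := by
    refine tendsto_FM (C := C) (Eventually.of_forall fun s => ⟨?_, fun ξ => ?_⟩)
      ⟨hb' t, C, hC t⟩ (fun ξ => ?_) x
    · exact (((hb s).sub (hb t)).measurable).const_mul _
    · have h1 : ‖b s ξ - b t ξ‖ ≤ C * ‖s - t‖ :=
        convex_univ.norm_image_sub_le_of_norm_hasDerivWithin_le (f := fun s => b s ξ)
          (fun r _ => (h r ξ).hasDerivWithinAt) (fun r _ => hC r ξ) (mem_univ t) (mem_univ s)
      have hC0 : 0 ≤ C := (norm_nonneg _).trans (hC t ξ)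
      rw [norm_mul, Complex.norm_real, norm_inv]
      rcases eq_or_ne s t with rfl | hst
      · simpa using hC0
      · rw [inv_mul_le_iff₀ (norm_pos_iff.2 (sub_ne_zero.2 hst)), mul_comm]
        exact h1
    · have := hasDerivAt_iff_tendsto_slope.1 (h t ξ)
      refine this.congr fun s => ?_
      rw [slope_def_module, Complex.real_smul]
  refine key.congr fun s => ?_
  rw [FM_const_mul ((hb s).sub (hb t)), FM_sub (hb s) (hb t), slope_def_module,
    Complex.coe_smul]
  rfl

end symbols

end CubicQuintic

namespace CubicQuintic

open scoped ComplexConjugate FourierTransform SchwartzMap InnerProductSpace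

/-! ### The Sobolev space `H¹(ℝ)`, parametrized by `L²(ℝ)` through `h ↦ h + h'` -/

/-- The symbol of the derivative. -/
def dsym (ξ : ℝ) : ℂ := 2 * Real.pi * Complex.I * ξ

/-- The symbol of `(1 + ∂)⁻¹`. -/
def jsym (ξ : ℝ) : ℂ := (1 + dsym ξ)⁻¹

theorem continuous_dsym : Continuous dsym := by unfold dsym; fun_prop

theorem dsym_re (ξ : ℝ) : (dsym ξ).re = 0 := by simp [dsym]

theorem conj_dsym (ξ : ℝ) : conj (dsym ξ) = - dsym ξ := by
  rw [dsym, map_mul, map_mul, map_mul, Complex.conj_ofReal, Complex.conj_ofReal, Complex.conj_I,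
    Complex.conj_ofNat]
  ring

theorem one_le_norm_one_add_dsym (ξ : ℝ) : 1 ≤ ‖1 + dsym ξ‖ := by
  have h := Complex.abs_re_le_norm (1 + dsym ξ)
  simpa [dsym_re] using h

theorem one_add_dsym_ne_zero (ξ : ℝ) : 1 + dsym ξ ≠ 0 :=
  norm_pos_iff.1 (zero_lt_one.trans_le (one_le_norm_one_add_dsym ξ))

theorem norm_jsym_le (ξ : ℝ) : ‖jsym ξ‖ ≤ 1 := by
  rw [jsym, norm_inv]
  exact inv_le_one_of_one_le₀ (one_le_norm_one_add_dsym ξ)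

theorem bddSymbol_jsym : BddSymbol jsym :=
  ⟨((continuous_const.add continuous_dsym).measurable).inv, 1, norm_jsym_le⟩

theorem dsym_mul_jsym (ξ : ℝ) : dsym ξ * jsym ξ = 1 - jsym ξ := by
  have := one_add_dsym_ne_zero ξ
  rw [jsym]; field_simp; ring

/-- The operator `(1 + ∂)⁻¹`. -/
def J0 : L2 →L[ℂ] L2 := FM jsym

/-- The operator `∂ (1 + ∂)⁻¹`. -/
def J1 : L2 →L[ℂ] L2 := ContinuousLinearMap.id ℂ L2 - J0

theorem J1_apply (x : L2) : J1 x = x - J0 x := rfl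

theorem J1_eq (x : L2) : J1 x = FM (fun ξ => 1 - jsym ξ) x := by
  rw [FM_sub (BddSymbol.const 1) bddSymbol_jsym, FM_const, one_smul]; rfl

theorem norm_J0_le (x : L2) : ‖J0 x‖ ≤ ‖x‖ :=
  (norm_FM_le bddSymbol_jsym norm_jsym_le x).trans_eq (one_mul _)

theorem norm_one_sub_jsym_le (ξ : ℝ) : ‖1 - jsym ξ‖ ≤ 1 := by
  rw [← dsym_mul_jsym, jsym, norm_mul, norm_inv]
  refine mul_inv_le_one_of_le₀ ?_ (norm_nonneg _)
  have h := Complex.abs_im_le_norm (1 + dsym ξ)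
  have h2 : ‖dsym ξ‖ = |(dsym ξ).im| := (Complex.abs_im_eq_norm.2 (dsym_re ξ)).symm
  rw [h2]
  simpa using h

theorem norm_J1_le (x : L2) : ‖J1 x‖ ≤ ‖x‖ := by
  rw [J1_eq]
  simpa using norm_FM_le ((BddSymbol.const 1).sub bddSymbol_jsym) norm_one_sub_jsym_le x

theorem fourier_derivCLM (Φ : 𝓢(ℝ, ℂ)) (ξ : ℝ) :
    𝓕 (SchwartzMap.derivCLM ℂ ℂ Φ) ξ = dsym ξ * 𝓕 Φ ξ := by
  have h := Real.fourier_deriv (f := Φ) Φ.integrable Φ.differentiable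
    (SchwartzMap.derivCLM ℂ ℂ Φ).integrable
  have h2 := congrFun h ξ
  simp only [SchwartzMap.fourier_coe]
  rw [smul_eq_mul] at h2
  exact h2

theorem toLp_eq_FM {m : ℝ → ℂ} (hm : BddSymbol m) {Φ K : 𝓢(ℝ, ℂ)}
    (h : ∀ ξ, 𝓕 Φ ξ = m ξ * 𝓕 K ξ) : Φ.toLp 2 = FM m (K.toLp 2) := by
  have e : ∀ Ψ : 𝓢(ℝ, ℂ), FT (Ψ.toLp 2) = (𝓕 Ψ).toLp 2 := fun Ψ => SchwartzMap.toLp_fourier_eq Ψ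
  apply FT.injective
  rw [FT_FM, e, e]
  apply Lp.ext
  filter_upwards [mulOp_coeFn hm ((𝓕 K).toLp 2), (𝓕 K).coeFn_toLp 2, (𝓕 Φ).coeFn_toLp 2]
    with ξ h1 h2 h3
  rw [h1, h2, h3, h]

/-- With `K = Φ + Φ'`, both `Φ` and `Φ'` are bounded multipliers of `K`, and the identity reduces to
`dsym` being purely imaginary. It says that `J1 x` is the weak derivative of `J0 x`. -/
theorem inner_deriv_J0 (Φ : 𝓢(ℝ, ℂ)) (x : L2) :
    ⟪(SchwartzMap.derivCLM ℂ ℂ Φ).toLp 2, J0 x⟫_ℂ = - ⟪Φ.toLp 2, J1 x⟫_ℂ := by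
  set K := Φ + SchwartzMap.derivCLM ℂ ℂ Φ with hK
  have hF : ∀ ξ, 𝓕 K ξ = (1 + dsym ξ) * 𝓕 Φ ξ := fun ξ => by
    rw [hK, FourierTransform.fourier_add, add_apply, fourier_derivCLM]; ring
  have hs := (BddSymbol.const 1).sub bddSymbol_jsym
  have h1 : Φ.toLp 2 = FM jsym (K.toLp 2) := toLp_eq_FM bddSymbol_jsym fun ξ => by
    rw [hF, jsym, inv_mul_cancel_left₀ (one_add_dsym_ne_zero ξ)]
  have h2 : (SchwartzMap.derivCLM ℂ ℂ Φ).toLp 2 = FM (fun ξ => 1 - jsym ξ) (K.toLp 2) :=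
    toLp_eq_FM hs fun ξ => by
      rw [fourier_derivCLM, hF, ← dsym_mul_jsym, jsym, mul_assoc,
        inv_mul_cancel_left₀ (one_add_dsym_ne_zero ξ)]
  rw [h1, h2, J1_eq, inner_FM hs, inner_FM bddSymbol_jsym, J0, FM_FM hs.star bddSymbol_jsym,
    FM_FM bddSymbol_jsym.star hs, ← inner_neg_right]
  congr 1
  rw [← neg_one_smul ℂ, ← FM_const_mul (bddSymbol_jsym.star.mul hs)]
  congr 2
  funext ξ
  rw [← dsym_mul_jsym, map_mul, conj_dsym]
  ring

/-- The conjugate of a test function, as a Schwartz function. -/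
def testConj (φ : ℝ → ℂ) (hφ : ContDiff ℝ ∞ φ) (hs : HasCompactSupport φ) : 𝓢(ℝ, ℂ) :=
  HasCompactSupport.toSchwartzMap (f := fun x => conj (φ x))
    (hs.comp_left (g := fun z : ℂ => conj z) (map_zero _)) (Complex.conjCLE.contDiff.comp hφ)

theorem testConj_apply {φ : ℝ → ℂ} (hφ : ContDiff ℝ ∞ φ) (hs : HasCompactSupport φ) (x : ℝ) :
    testConj φ hφ hs x = conj (φ x) := rfl

theorem deriv_testConj {φ : ℝ → ℂ} (hφ : ContDiff ℝ ∞ φ) (hs : HasCompactSupport φ) (x : ℝ) :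
    SchwartzMap.derivCLM ℂ ℂ (testConj φ hφ hs) x = conj (deriv φ x) := by
  rw [SchwartzMap.derivCLM_apply]
  have : (testConj φ hφ hs : ℝ → ℂ) = fun x => conj (φ x) := rfl
  rw [this]
  exact ((hφ.differentiable (by simp) x).hasDerivAt.star).deriv

/-- The weak formulation uses the bilinear pairing; conjugating the test function turns it into the
Hermitian inner product. -/
theorem inner_testConj {φ : ℝ → ℂ} (hφ : ContDiff ℝ ∞ φ) (hs : HasCompactSupport φ) {a : L2}
    {f : ℝ → ℂ} (ha : a =ᵐ[volume] f) :
    ⟪(testConj φ hφ hs).toLp 2, a⟫_ℂ = ∫ x, f x * φ x := by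
  rw [inner_eq_integral ((testConj φ hφ hs).coeFn_toLp 2) ha]
  refine integral_congr_ae (Eventually.of_forall fun x => ?_)
  simp only [testConj_apply, Complex.conj_conj]
  ring

theorem inner_deriv_testConj {φ : ℝ → ℂ} (hφ : ContDiff ℝ ∞ φ) (hs : HasCompactSupport φ) {a : L2}
    {f : ℝ → ℂ} (ha : a =ᵐ[volume] f) :
    ⟪(SchwartzMap.derivCLM ℂ ℂ (testConj φ hφ hs)).toLp 2, a⟫_ℂ = ∫ x, f x * deriv φ x := by
  rw [inner_eq_integral ((SchwartzMap.derivCLM ℂ ℂ (testConj φ hφ hs)).coeFn_toLp 2) ha]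
  refine integral_congr_ae (Eventually.of_forall fun x => ?_)
  simp only [deriv_testConj, Complex.conj_conj]
  ring

theorem locallyIntegrable_coeFn (x : L2) : LocallyIntegrable x volume :=
  (Lp.memLp x).locallyIntegrable one_le_two

/-- `a` is an `H¹` function with derivative `b`. -/
def IsH1 (a b : L2) : Prop := ∃ u : ℝ → ℂ, IsPrim b u ∧ a =ᵐ[volume] u

theorem isH1_J (x : L2) : IsH1 (J0 x) (J1 x) :=
  exists_isPrim_of_weakDeriv (locallyIntegrable_coeFn _) (locallyIntegrable_coeFn _)
    fun φ hφ hs => by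
      rw [← inner_deriv_testConj hφ hs (ae_eq_refl _), ← inner_testConj hφ hs (ae_eq_refl _),
        inner_deriv_J0]

namespace IsH1

variable {a b a' b' : L2}

theorem sub (h : IsH1 a b) (h' : IsH1 a' b') : IsH1 (a - a') (b - b') := by
  obtain ⟨u, hu, hau⟩ := h
  obtain ⟨v, hv, hav⟩ := h'
  refine ⟨fun x => u x - v x, (hu.sub hv).congr_left ?_, ?_⟩
  · filter_upwards [Lp.coeFn_sub b b'] with x hx
    rw [hx, Pi.sub_apply]
  · filter_upwards [Lp.coeFn_sub a a', hau, hav] with x hx h1 h2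
    rw [hx, Pi.sub_apply, h1, h2]

/-- Products of `L²` functions are integrable, which is all that integration by parts on the line
requires here. -/
theorem inner_eq_neg (h : IsH1 a b) (h' : IsH1 a' b') : ⟪a, b'⟫_ℂ = - ⟪b, a'⟫_ℂ := by
  obtain ⟨u, hu, hau⟩ := h
  obtain ⟨v, hv, hav⟩ := h'
  rw [inner_eq_integral hau (ae_eq_refl b'), inner_eq_integral (ae_eq_refl b) hav]
  have hau' : (fun x => conj (a x)) =ᵐ[volume] fun x => conj (u x) := by
    filter_upwards [hau] with x hx; rw [hx]
  have hi : ∀ x y : L2, Integrable fun t => conj (x t) * y t := fun x y =>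
    (Lp.memLp x).star.integrable_mul (Lp.memLp y)
  refine hu.conj.integral_mul_eq_neg hv ?_ ?_ ?_
  · refine (hi b a').congr ?_
    filter_upwards [hav] with x hx; rw [hx]
  · refine (hi a b').congr ?_
    filter_upwards [hau] with x hx; rw [hx]
  · refine (hi a a').congr ?_
    filter_upwards [hau, hav] with x h1 h2; rw [h1, h2]

/-- The discrepancy `d = a - J0 (a + b)` satisfies `d' = -d`; skew-symmetry of `∂` then gives `‖d‖²
= -‖d‖²`. Hence every `H¹` function is coded by some `x`. -/
theorem J0_eq (h : IsH1 a b) : J0 (a + b) = a := by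
  have h1 := h.sub (isH1_J (a + b))
  have h2 : b - J1 (a + b) = - (a - J0 (a + b)) := by rw [J1_apply]; abel
  rw [h2] at h1
  have h3 := h1.inner_eq_neg h1
  rw [inner_neg_right, inner_neg_left, neg_neg, neg_eq_self, inner_self_eq_zero] at h3
  exact (sub_eq_zero.1 h3).symm

theorem J1_eq (h : IsH1 a b) : J1 (a + b) = b := by
  rw [J1_apply, h.J0_eq, add_sub_cancel_left]

end IsH1

/-- Nonnegativity of the variance over an interval of length one. -/
theorem sq_integral_norm_le (x : L2) (s : ℝ) :
    (∫ t in s..(s + 1), ‖x t‖) ^ 2 ≤ ∫ t in s..(s + 1), ‖x t‖ ^ 2 := by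
  have hi2 : IntervalIntegrable (fun t => ‖x t‖ ^ 2) volume s (s + 1) :=
    (integrable_norm_sq x).intervalIntegrable
  have hi1 : IntervalIntegrable (fun t => ‖x t‖) volume s (s + 1) :=
    ((locallyIntegrable_coeFn x).integrableOn_isCompact isCompact_uIcc).intervalIntegrable.norm
  set c := ∫ t in s..(s + 1), ‖x t‖ with hc
  have h0 : 0 ≤ ∫ t in s..(s + 1), (‖x t‖ - c) ^ 2 :=
    intervalIntegral.integral_nonneg (by linarith) fun t _ => sq_nonneg _
  have e : ∀ t, (‖x t‖ - c) ^ 2 = ‖x t‖ ^ 2 - 2 * c * ‖x t‖ + c ^ 2 := fun t => by ring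
  simp only [e] at h0
  rw [intervalIntegral.integral_add (hi2.sub (hi1.const_mul _)) (by simp),
    intervalIntegral.integral_sub hi2 (hi1.const_mul _), intervalIntegral.integral_const_mul,
    ← hc] at h0
  simp at h0
  nlinarith

theorem integral_norm_le_norm (x : L2) (s : ℝ) : ∫ t in s..(s + 1), ‖x t‖ ≤ ‖x‖ := by
  have hle : s ≤ s + 1 := by linarith
  have h2 : ∫ t in s..(s + 1), ‖x t‖ ^ 2 ≤ ‖x‖ ^ 2 := by
    rw [norm_sq_eq_integral, intervalIntegral.integral_of_le hle]
    exact setIntegral_le_integral (integrable_norm_sq x)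
      (Eventually.of_forall fun t => by positivity)
  exact le_of_sq_le_sq ((sq_integral_norm_le x s).trans h2) (norm_nonneg _)

/-- The continuous representative of `(1 + ∂)⁻¹ x`. -/
def rep (x : L2) : ℝ → ℂ := (isH1_J x).choose

theorem isPrim_rep (x : L2) : IsPrim (J1 x) (rep x) := (isH1_J x).choose_spec.1

theorem rep_ae (x : L2) : J0 x =ᵐ[volume] rep x := (isH1_J x).choose_spec.2

theorem rep_eq_of_ae {x : L2} {u : ℝ → ℂ} (hu : Continuous u) (h : J0 x =ᵐ[volume] u) :
    rep x = u :=
  (Continuous.ae_eq_iff_eq volume (isPrim_rep x).continuous hu).1 ((rep_ae x).symm.trans h)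

theorem rep_sub (x y : L2) (t : ℝ) : rep (x - y) t = rep x t - rep y t := by
  have := rep_eq_of_ae (x := x - y) (u := fun t => rep x t - rep y t)
    ((isPrim_rep x).continuous.sub (isPrim_rep y).continuous) (by
      rw [map_sub]
      filter_upwards [Lp.coeFn_sub (J0 x) (J0 y), rep_ae x, rep_ae y] with t h1 h2 h3
      rw [h1, Pi.sub_apply, h2, h3])
  rw [this]

theorem rep_zero (t : ℝ) : rep 0 t = 0 := by
  have := rep_sub 0 0 t
  simpa using this

/-- Sobolev embedding by averaging over `[t, t + 1]`; the function and its derivative contribute one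
`‖x‖` each. -/
theorem norm_rep_le (x : L2) (t : ℝ) : ‖rep x t‖ ≤ 2 * ‖x‖ := by
  refine ((isPrim_rep x).norm_le_integral t).trans ?_
  have h1 : ∫ y in t..(t + 1), ‖rep x y‖ = ∫ y in t..(t + 1), ‖J0 x y‖ := by
    refine intervalIntegral.integral_congr_ae ?_
    filter_upwards [rep_ae x] with y hy _
    rw [hy]
  rw [h1]
  linarith [integral_norm_le_norm (J0 x) t, integral_norm_le_norm (J1 x) t, norm_J0_le x,
    norm_J1_le x]

end CubicQuintic

namespace CubicQuintic

open scoped ComplexConjugate InnerProductSpace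

/-! ### Smooth functions on bounded sets -/

theorem exists_lipschitz_bound {P : ℂ → ℂ} (hP : ContDiff ℝ ∞ P) (R : ℝ) :
    ∃ K : ℝ, 0 ≤ K ∧ (∀ z, ‖z‖ ≤ R → ‖fderiv ℝ P z‖ ≤ K) ∧
      (∀ z w, ‖z‖ ≤ R → ‖w‖ ≤ R → ‖P z - P w‖ ≤ K * ‖z - w‖) ∧
      (∀ z w, ‖z‖ ≤ R → ‖w‖ ≤ R → ‖fderiv ℝ P z - fderiv ℝ P w‖ ≤ K * ‖z - w‖) := by
  have hP1 : ContDiff ℝ 1 (fderiv ℝ P) :=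
    (contDiff_infty_iff_fderiv.1 hP).2.of_le (by exact_mod_cast le_top)
  obtain ⟨K1, hK1⟩ := (hP.of_le (by exact_mod_cast le_top) :
    ContDiff ℝ 1 P).contDiffOn.exists_lipschitzOnWith one_ne_zero
      (convex_closedBall (0 : ℂ) R) (isCompact_closedBall 0 R)
  obtain ⟨K2, hK2⟩ := hP1.contDiffOn.exists_lipschitzOnWith one_ne_zero
      (convex_closedBall (0 : ℂ) R) (isCompact_closedBall 0 R)
  obtain ⟨K3, hK3⟩ := (isCompact_closedBall (0 : ℂ) R).exists_bound_of_continuousOn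
    hP1.continuous.continuousOn
  have hb : ∀ z : ℂ, ‖z‖ ≤ R → z ∈ Metric.closedBall (0 : ℂ) R := fun z hz => by simpa using hz
  refine ⟨max K1 (max K2 K3), le_max_of_le_left K1.2, fun z hz => ?_, fun z w hz hw => ?_,
    fun z w hz hw => ?_⟩
  · exact (hK3 z (hb z hz)).trans ((le_max_right _ _).trans (le_max_right _ _))
  · have := hK1.norm_sub_le (hb z hz) (hb w hw)
    exact this.trans (mul_le_mul_of_nonneg_right (le_max_left _ _) (norm_nonneg _))
  · have := hK2.norm_sub_le (hb z hz) (hb w hw)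
    exact this.trans (mul_le_mul_of_nonneg_right ((le_max_left _ _).trans (le_max_right _ _))
      (norm_nonneg _))

/-- Comparison of increments of a smooth function at two points. -/
theorem exists_increment_bound {P : ℂ → ℂ} (hP : ContDiff ℝ ∞ P) (R : ℝ) :
    ∃ K : ℝ, 0 ≤ K ∧ ∀ a b h k, ‖a‖ ≤ R → ‖b‖ ≤ R → ‖h‖ ≤ R → ‖k‖ ≤ R →
      ‖(P (a + h) - P a) - (P (b + k) - P b)‖ ≤ K * ‖a - b‖ * ‖h‖ + K * ‖h - k‖ := by
  obtain ⟨K, hK0, hK1, hK2, hK3⟩ := exists_lipschitz_bound hP (R + R)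
  refine ⟨K, hK0, fun a b h k ha hb hh hk => ?_⟩
  have hR : 0 ≤ R := (norm_nonneg _).trans ha
  have hPd : Differentiable ℝ P := hP.differentiable (by simp)
  have h1 : ‖(P (a + h) - P a) - (P (b + h) - P b)‖ ≤ K * ‖h‖ * ‖a - b‖ := by
    -- The map `z ↦ P (z + h) - P z` has derivative of size `K ‖h‖` since `fderiv ℝ P` is Lipschitz;
    -- points `z + h` explain the radius `R + R`.
    refine (convex_closedBall (0 : ℂ) R).norm_image_sub_le_of_norm_hasFDerivWithin_le
      (𝕜 := ℝ) (f := fun z => P (z + h) - P z)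
      (f' := fun z => fderiv ℝ P (z + h) - fderiv ℝ P z) (fun z _ => ?_) (fun z hz => ?_)
      (by simpa using hb) (by simpa using ha)
    · refine HasFDerivAt.hasFDerivWithinAt (HasFDerivAt.fun_sub ?_ (hPd z).hasFDerivAt)
      have := (hPd (z + h)).hasFDerivAt.comp z ((hasFDerivAt_id z).add_const h)
      simpa using! this
    · have hz : ‖z‖ ≤ R := by simpa using hz
      have := hK3 (z + h) z ((norm_add_le _ _).trans (add_le_add hz hh)) (by linarith)
      simpa using this
  have h2 : ‖P (b + h) - P (b + k)‖ ≤ K * ‖h - k‖ := by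
    have := hK2 (b + h) (b + k) ((norm_add_le _ _).trans (add_le_add hb hh))
      ((norm_add_le _ _).trans (add_le_add hb hk))
    simpa using this
  have e : (P (a + h) - P a) - (P (b + k) - P b)
      = ((P (a + h) - P a) - (P (b + h) - P b)) + (P (b + h) - P (b + k)) := by ring
  rw [e]
  refine (norm_add_le _ _).trans (add_le_add (h1.trans_eq (by ring)) h2)

/-! ### Pointwise estimates for the potential and the nonlinearity -/

/-- The function `z (1 - |z|²)`. -/
def pot (z : ℂ) : ℂ := z * (1 - (‖z‖ : ℂ) ^ 2)

theorem norm_pot_sq (z : ℂ) : ‖pot z‖ ^ 2 = ‖z‖ ^ 2 * (1 - ‖z‖ ^ 2) ^ 2 := by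
  have : (1 - (‖z‖ : ℂ) ^ 2) = ((1 - ‖z‖ ^ 2 : ℝ) : ℂ) := by push_cast; rfl
  rw [pot, norm_mul, mul_pow, this, Complex.norm_real, Real.norm_eq_abs, sq_abs]

/-- The nonlinearity `-z + 4 |z|² z - 3 |z|⁴ z`. -/
def nl (z : ℂ) : ℂ := - pot z * (1 - 3 * (‖z‖ : ℂ) ^ 2)

theorem nl_eq (z : ℂ) : nl z = -z + 4 * (‖z‖ : ℂ) ^ 2 * z - 3 * (‖z‖ : ℂ) ^ 4 * z := by
  rw [nl, pot]; ring

theorem contDiff_norm_sq_complex : ContDiff ℝ ∞ fun z : ℂ => (‖z‖ : ℂ) ^ 2 := by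
  have := Complex.ofRealCLM.contDiff (n := ∞) |>.comp (contDiff_norm_sq ℝ (E := ℂ) (n := ∞))
  simpa [Function.comp_def] using! this

theorem contDiff_pot : ContDiff ℝ ∞ pot :=
  contDiff_id.mul (contDiff_const.sub contDiff_norm_sq_complex)

theorem contDiff_nl : ContDiff ℝ ∞ nl :=
  contDiff_pot.neg.mul (contDiff_const.sub (contDiff_const.mul contDiff_norm_sq_complex))

theorem norm_one_sub_le {M : ℝ} {z : ℂ} (hz : ‖z‖ ≤ M) :
    ‖1 - 3 * (‖z‖ : ℂ) ^ 2‖ ≤ 1 + 3 * M ^ 2 := by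
  refine (norm_sub_le _ _).trans ?_
  simp only [norm_one, norm_mul, norm_pow, Complex.norm_real, norm_norm, Complex.norm_ofNat]
  gcongr

theorem norm_nl_le {M : ℝ} {z : ℂ} (hz : ‖z‖ ≤ M) : ‖nl z‖ ≤ (1 + 3 * M ^ 2) * ‖pot z‖ := by
  rw [nl, norm_mul, norm_neg, mul_comm]
  exact mul_le_mul_of_nonneg_right (norm_one_sub_le hz) (norm_nonneg _)

/-- Every term keeps a `pot` factor that will be measured in `L²`, while `‖z - w‖` is used only in
sup norm. A plain Lipschitz bound would be useless, since differences in the energy space need not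
be in `L²`. -/
theorem norm_nl_sub_le {M : ℝ} {z w : ℂ} (hz : ‖z‖ ≤ M) (hw : ‖w‖ ≤ M) :
    ‖nl z - nl w‖ ≤ (1 + 3 * M ^ 2) * ‖pot z - pot w‖ + 6 * M * ‖z - w‖ * ‖pot w‖ := by
  have e : nl z - nl w = - ((1 - 3 * (‖z‖ : ℂ) ^ 2) * (pot z - pot w))
      + ((3 * ((‖z‖ ^ 2 - ‖w‖ ^ 2 : ℝ)) : ℝ) : ℂ) * pot w := by
    rw [nl, nl]; push_cast; ring
  rw [e]
  refine (norm_add_le _ _).trans (add_le_add ?_ ?_)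
  · rw [norm_neg, norm_mul]
    exact mul_le_mul_of_nonneg_right (norm_one_sub_le hz) (norm_nonneg _)
  · rw [norm_mul, Complex.norm_real, Real.norm_eq_abs]
    refine mul_le_mul_of_nonneg_right ?_ (norm_nonneg _)
    have h1 : |‖z‖ - ‖w‖| ≤ ‖z - w‖ := abs_norm_sub_norm_le z w
    have h2 : 0 ≤ ‖z‖ := norm_nonneg z
    have h3 : 0 ≤ ‖w‖ := norm_nonneg w
    have hM : 0 ≤ M := h2.trans hz
    have e2 : 3 * (‖z‖ ^ 2 - ‖w‖ ^ 2) = 3 * (‖z‖ + ‖w‖) * (‖z‖ - ‖w‖) := by ring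
    rw [e2, abs_mul, abs_of_nonneg (by positivity)]
    calc 3 * (‖z‖ + ‖w‖) * |‖z‖ - ‖w‖| ≤ 3 * (M + M) * ‖z - w‖ := by gcongr
      _ = 6 * M * ‖z - w‖ := by ring

/-- For `‖z‖ ≥ 2` the factor `|1 - ‖z‖²|` is at least one. -/
theorem norm_le_two_add_norm_pot (z : ℂ) : ‖z‖ ≤ 2 + ‖pot z‖ := by
  have e : ‖pot z‖ = ‖z‖ * |1 - ‖z‖ ^ 2| := by
    rw [pot, norm_mul, ← Real.norm_eq_abs, ← Complex.norm_real]
    push_cast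
    rfl
  rcases le_total ‖z‖ 2 with h | h
  · linarith [norm_nonneg (pot z)]
  · rw [e]
    have : 1 ≤ |1 - ‖z‖ ^ 2| := by
      rw [abs_of_nonpos (by nlinarith)]
      nlinarith
    nlinarith

/-! ### Norm estimates in `L²` -/

theorem L2_norm_le {x y z w : L2} {A B C : ℝ}
    (h : ∀ᵐ t, ‖x t‖ ≤ A * ‖y t‖ + B * ‖z t‖ + C * ‖w t‖) (hA : 0 ≤ A) (hB : 0 ≤ B)
    (hC : 0 ≤ C) : ‖x‖ ≤ A * ‖y‖ + B * ‖z‖ + C * ‖w‖ := by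
  have hn : ∀ y : L2, ‖(Lp.memLp y).norm.toLp‖ = ‖y‖ := fun y => by
    rw [Lp.norm_toLp, eLpNorm_norm, Lp.norm_def]
  set y' := (Lp.memLp y).norm.toLp
  set z' := (Lp.memLp z).norm.toLp
  set w' := (Lp.memLp w).norm.toLp
  have h1 : ‖x‖ ≤ ‖A • y' + B • z' + C • w'‖ := by
    refine Lp.norm_le_norm_of_ae_le ?_
    filter_upwards [h, Lp.coeFn_add (A • y' + B • z') (C • w'), Lp.coeFn_add (A • y') (B • z'),
      Lp.coeFn_smul A y', Lp.coeFn_smul B z', Lp.coeFn_smul C w',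
      (Lp.memLp y).norm.coeFn_toLp, (Lp.memLp z).norm.coeFn_toLp, (Lp.memLp w).norm.coeFn_toLp]
      with t h0 h1 h2 h3 h4 h5 h6 h7 h8
    rw [h1, Pi.add_apply, h2, Pi.add_apply, h3, h4, h5, Pi.smul_apply, Pi.smul_apply,
      Pi.smul_apply, h6, h7, h8, smul_eq_mul, smul_eq_mul, smul_eq_mul]
    exact h0.trans (le_abs_self _)
  refine h1.trans ((norm_add_le _ _).trans (add_le_add ((norm_add_le _ _).trans
    (add_le_add ?_ ?_)) ?_))
  · rw [norm_smul, hn, Real.norm_of_nonneg hA]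
  · rw [norm_smul, hn, Real.norm_of_nonneg hB]
  · rw [norm_smul, hn, Real.norm_of_nonneg hC]

/-! ### The energy space -/

theorem MemEnergy.isPrim {ψ : ℝ → ℂ} (h : MemEnergy ψ) : IsPrim (deriv ψ) ψ := by
  refine IsPrim.of_absolutelyContinuous h.absCont (h.deriv_memLp.locallyIntegrable one_le_two) ?_
  filter_upwards [ae_differentiableAt_of_absolutelyContinuous h.absCont] with x hx
  exact hx.hasDerivAt

theorem memEnergy_of_isPrim {u : ℝ → ℂ} {b : L2} (h : IsPrim b u)
    (hp : MemLp (fun t => pot (u t)) 2 volume) : MemEnergy u :=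
  ⟨h.absolutelyContinuous, (Lp.memLp b).ae_eq h.deriv_ae.symm, hp⟩

/-- The derivative of an element of the energy space. -/
def Dcl (ψ : EnergySpace) : L2 := ψ.2.deriv_memLp.toLp

/-- The class of `ψ (1 - |ψ|²)`. -/
def Pot (ψ : EnergySpace) : L2 := ψ.2.potential_memLp.toLp

theorem Dcl_coeFn (ψ : EnergySpace) : Dcl ψ =ᵐ[volume] deriv ψ := ψ.2.deriv_memLp.coeFn_toLp

theorem Pot_coeFn (ψ : EnergySpace) : Pot ψ =ᵐ[volume] fun t => pot (ψ t) :=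
  ψ.2.potential_memLp.coeFn_toLp

theorem isPrim_Dcl (ψ : EnergySpace) : IsPrim (Dcl ψ) ψ :=
  ψ.2.isPrim.congr_left (Dcl_coeFn ψ).symm

theorem Dcl_eq_of_isPrim {ψ : EnergySpace} {b : L2} (h : IsPrim b ψ) : Dcl ψ = b :=
  Lp.ext ((Dcl_coeFn ψ).trans h.deriv_ae)

/-- A value is at most the mean of `‖ψ‖` over a unit interval plus that of `‖ψ_x‖`, and the former
mean is controlled by `pot`. -/
theorem norm_apply_le (ψ : EnergySpace) (t : ℝ) : ‖ψ t‖ ≤ 2 + ‖Pot ψ‖ + ‖Dcl ψ‖ := by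
  refine ((isPrim_Dcl ψ).norm_le_integral t).trans ?_
  have h1 : ∫ y in t..(t + 1), ‖ψ y‖ ≤ ∫ y in t..(t + 1), (2 + ‖Pot ψ y‖) := by
    refine intervalIntegral.integral_mono_ae_restrict (by linarith)
      ((isPrim_Dcl ψ).continuous.norm.intervalIntegrable _ _) ?_ ?_
    · exact intervalIntegrable_const.add
        ((locallyIntegrable_coeFn _).integrableOn_isCompact isCompact_uIcc).intervalIntegrable.norm
    · refine ae_restrict_of_ae ?_
      filter_upwards [Pot_coeFn ψ] with y hy
      rw [hy]
      exact norm_le_two_add_norm_pot _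
  rw [intervalIntegral.integral_add intervalIntegrable_const
    ((locallyIntegrable_coeFn _).integrableOn_isCompact isCompact_uIcc).intervalIntegrable.norm]
    at h1
  simp only [intervalIntegral.integral_const, add_sub_cancel_left, one_smul] at h1
  linarith [integral_norm_le_norm (Pot ψ) t, integral_norm_le_norm (Dcl ψ) t]

theorem energy_eq (ψ : EnergySpace) : ψ.energy = ‖Dcl ψ‖ ^ 2 + ‖Pot ψ‖ ^ 2 := by
  rw [EnergySpace.energy, norm_sq_eq_integral, norm_sq_eq_integral,
    ← integral_add (integrable_norm_sq _) (integrable_norm_sq _)]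
  refine integral_congr_ae ?_
  filter_upwards [Dcl_coeFn ψ, Pot_coeFn ψ] with t h1 h2
  rw [h1, h2, norm_pot_sq]

/-- The three quantities entering the distance of the energy space are at most `d`. -/
structure DistLE (ψ χ : EnergySpace) (d : ℝ) : Prop where
  sup : ∀ t, ‖ψ t - χ t‖ ≤ d
  der : ‖Dcl ψ - Dcl χ‖ ≤ d
  pot : ‖Pot ψ - Pot χ‖ ≤ d

/-- Boundedness in the energy space. -/
structure BddBy (ψ : EnergySpace) (M : ℝ) : Prop where
  sup : ∀ t, ‖ψ t‖ ≤ M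
  der : ‖Dcl ψ‖ ≤ M
  pot : ‖Pot ψ‖ ≤ M

theorem BddBy.nonneg {ψ : EnergySpace} {M : ℝ} (h : BddBy ψ M) : 0 ≤ M :=
  (norm_nonneg _).trans h.der

theorem BddBy.mono {ψ : EnergySpace} {M N : ℝ} (h : BddBy ψ M) (hMN : M ≤ N) : BddBy ψ N :=
  ⟨fun t => (h.sup t).trans hMN, h.der.trans hMN, h.pot.trans hMN⟩

theorem DistLE.mono {ψ χ : EnergySpace} {d e : ℝ} (h : DistLE ψ χ d) (hde : d ≤ e) :
    DistLE ψ χ e :=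
  ⟨fun t => (h.sup t).trans hde, h.der.trans hde, h.pot.trans hde⟩

theorem DistLE.nonneg {ψ χ : EnergySpace} {d : ℝ} (h : DistLE ψ χ d) : 0 ≤ d :=
  (norm_nonneg _).trans h.der

theorem DistLE.refl (ψ : EnergySpace) : DistLE ψ ψ 0 := ⟨by simp, by simp, by simp⟩

theorem BddBy.of_distLE {ψ χ : EnergySpace} {M d : ℝ} (h : BddBy ψ M) (hd : DistLE χ ψ d) :
    BddBy χ (M + d) := by
  refine ⟨fun t => ?_, ?_, ?_⟩
  · have := norm_le_norm_add_norm_sub' (χ t) (ψ t)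
    linarith [h.sup t, hd.sup t]
  · have := norm_le_norm_add_norm_sub' (Dcl χ) (Dcl ψ)
    linarith [h.der, hd.der]
  · have := norm_le_norm_add_norm_sub' (Pot χ) (Pot ψ)
    linarith [h.pot, hd.pot]

/-- Coercivity: the conserved quantity bounds all that the local existence time depends on. -/
theorem bddBy_of_energy_le {ψ : EnergySpace} {R : ℝ} (h : ψ.energy ≤ R) :
    BddBy ψ (2 + 2 * √R) := by
  rw [energy_eq] at h
  have h1 : ‖Dcl ψ‖ ≤ √R := Real.le_sqrt_of_sq_le (by nlinarith [sq_nonneg ‖Pot ψ‖])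
  have h2 : ‖Pot ψ‖ ≤ √R := Real.le_sqrt_of_sq_le (by nlinarith [sq_nonneg ‖Dcl ψ‖])
  have h3 := norm_nonneg (Dcl ψ)
  exact ⟨fun t => (norm_apply_le ψ t).trans (by linarith), by linarith, by linarith⟩

theorem exists_bddBy (ψ : EnergySpace) : ∃ M, BddBy ψ M := ⟨_, bddBy_of_energy_le le_rfl⟩

theorem eLpNorm_sub_eq {f g : ℝ → ℂ} {x y : L2} (hx : x =ᵐ[volume] f) (hy : y =ᵐ[volume] g) :
    eLpNorm (fun t => f t - g t) 2 volume = ENNReal.ofReal ‖x - y‖ := by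
  rw [Lp.norm_def, ENNReal.ofReal_toReal (Lp.eLpNorm_ne_top _)]
  refine eLpNorm_congr_ae ?_
  filter_upwards [hx, hy, Lp.coeFn_sub x y] with t h1 h2 h3
  rw [h3, Pi.sub_apply, h1, h2]

theorem edist_le_of_distLE {ψ χ : EnergySpace} {d : ℝ} (h : DistLE ψ χ d) :
    edist ψ χ ≤ ENNReal.ofReal (3 * d) := by
  have hd := h.nonneg
  rw [EnergySpace.edist_def, eLpNorm_sub_eq (Dcl_coeFn ψ) (Dcl_coeFn χ)]
  have e := eLpNorm_sub_eq (Pot_coeFn ψ) (Pot_coeFn χ)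
  have h3 : 3 * d = d + d + d := by ring
  rw [h3, ENNReal.ofReal_add (by positivity) hd, ENNReal.ofReal_add hd hd]
  refine add_le_add (add_le_add ?_ (ENNReal.ofReal_le_ofReal h.der)) ?_
  · rw [eLpNorm_exponent_top]
    refine eLpNormEssSup_le_of_ae_bound (Eventually.of_forall h.sup)
  · exact (le_of_eq e).trans (ENNReal.ofReal_le_ofReal h.pot)

theorem distLE_of_edist_le {ψ χ : EnergySpace} {d : ℝ} (hd : 0 ≤ d)
    (h : edist ψ χ ≤ ENNReal.ofReal d) : DistLE ψ χ d := by
  rw [EnergySpace.edist_def, eLpNorm_sub_eq (Dcl_coeFn ψ) (Dcl_coeFn χ)] at h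
  have e : eLpNorm (fun x => ψ.potential x - χ.potential x) 2 volume
    = ENNReal.ofReal ‖Pot ψ - Pot χ‖ := eLpNorm_sub_eq (Pot_coeFn ψ) (Pot_coeFn χ)
  rw [e] at h
  refine ⟨?_, ?_, ?_⟩
  · have h1 := (le_self_add.trans le_self_add).trans h
    rw [eLpNorm_exponent_top] at h1
    have h2 : ∀ᵐ t, ‖ψ t - χ t‖ ≤ d := by
      filter_upwards [ae_le_eLpNormEssSup (f := fun t => ψ t - χ t) (μ := volume)] with t ht
      have h3 := ht.trans h1
      rw [← ofReal_norm] at h3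
      exact (ENNReal.ofReal_le_ofReal_iff hd).1 h3
    have hc : Continuous fun t => ‖ψ t - χ t‖ := (ψ.2.continuous.sub χ.2.continuous).norm
    intro t
    by_contra hlt
    rw [not_le] at hlt
    -- An essential bound on a continuous function holds everywhere: the exceptional set is open and
    -- null, hence empty.
    have ho : IsOpen {t | d < ‖ψ t - χ t‖} := isOpen_lt continuous_const hc
    have h0 : volume {t | d < ‖ψ t - χ t‖} = 0 := by
      have := ae_iff.1 h2
      simpa only [not_le] using this
    have hne := ho.measure_pos volume ⟨t, hlt⟩
    exact hne.ne' h0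
  · exact (ENNReal.ofReal_le_ofReal_iff hd).1 ((le_add_self.trans le_self_add).trans h)
  · exact (ENNReal.ofReal_le_ofReal_iff hd).1 (le_add_self.trans h)

theorem edist_lt_top_energySpace (ψ χ : EnergySpace) : edist ψ χ < (⊤ : ℝ≥0∞) := by
  obtain ⟨M, hM⟩ := exists_bddBy ψ
  obtain ⟨N, hN⟩ := exists_bddBy χ
  have : DistLE ψ χ (M + N) :=
    ⟨fun t => (norm_sub_le _ _).trans (add_le_add (hM.sup t) (hN.sup t)),
      (norm_sub_le _ _).trans (add_le_add hM.der hN.der),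
      (norm_sub_le _ _).trans (add_le_add hM.pot hN.pot)⟩
  exact (edist_le_of_distLE this).trans_lt ENNReal.ofReal_lt_top

theorem distLE_toReal (ψ χ : EnergySpace) : DistLE ψ χ (edist ψ χ).toReal :=
  distLE_of_edist_le ENNReal.toReal_nonneg
    (by rw [ENNReal.ofReal_toReal (edist_lt_top_energySpace ψ χ).ne])

/-! ### Translates of an element of the energy space by `H¹` functions -/

theorem norm_rep_coe_eq (x : L2) : ∀ᵐ t, ‖rep x t‖ = ‖J0 x t‖ := by
  filter_upwards [rep_ae x] with t ht
  rw [ht]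

theorem memLp_pot_add (ψ : EnergySpace) (x : L2) :
    MemLp (fun t => pot (ψ t + rep x t)) 2 volume := by
  obtain ⟨M, hM⟩ := exists_bddBy ψ
  obtain ⟨K, hK0, -, hK, -⟩ := exists_lipschitz_bound contDiff_pot (M + 2 * ‖x‖)
  have hc : Continuous fun t => pot (ψ t + rep x t) :=
    contDiff_pot.continuous.comp (ψ.2.continuous.add (isPrim_rep x).continuous)
  have h1 : MemLp (fun t => pot (ψ t + rep x t) - pot (ψ t)) 2 volume := by
    refine (Lp.memLp (J0 x)).of_le_mul (c := K)
      (hc.sub (contDiff_pot.continuous.comp ψ.2.continuous)).aestronglyMeasurable ?_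
    filter_upwards [norm_rep_coe_eq x] with t ht
    rw [← ht]
    have hx := norm_rep_le x t
    have hp := hM.sup t
    have := hK (ψ t + rep x t) (ψ t) ((norm_add_le _ _).trans (add_le_add hp hx))
      (by linarith [norm_nonneg x])
    simpa using this
  have h2 := h1.add ψ.2.potential_memLp
  refine h2.ae_eq (Eventually.of_forall fun t => ?_)
  simp only [Pi.add_apply, pot]
  ring

/-- The translate of `ψ` by the `H¹` function parametrized by `x`. -/
def shift (ψ : EnergySpace) (x : L2) : EnergySpace :=
  ⟨fun t => ψ t + rep x t, memEnergy_of_isPrim (b := Dcl ψ + J1 x)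
    (((isPrim_Dcl ψ).add (isPrim_rep x)).congr_left (Lp.coeFn_add _ _).symm) (memLp_pot_add ψ x)⟩

theorem shift_apply (ψ : EnergySpace) (x : L2) (t : ℝ) : shift ψ x t = ψ t + rep x t := rfl

theorem Dcl_shift (ψ : EnergySpace) (x : L2) : Dcl (shift ψ x) = Dcl ψ + J1 x :=
  Dcl_eq_of_isPrim
    (((isPrim_Dcl ψ).add (isPrim_rep x)).congr_left (Lp.coeFn_add _ _).symm)

theorem shift_zero (ψ : EnergySpace) : shift ψ 0 = ψ := by
  apply Subtype.ext
  funext t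
  exact (shift_apply ψ 0 t).trans (by rw [rep_zero, add_zero])

/-- Only the potential component is nonlinear. Comparing the increments `pot (ψ + h) - pot ψ`
multiplies `|ψ - χ|` by the `L²` function `h`, so the sup distance of `ψ` and `χ` suffices. -/
theorem exists_distLE_shift (M : ℝ) : ∃ C : ℝ, 0 ≤ C ∧ ∀ ψ χ : EnergySpace, ∀ x y : L2,
    BddBy ψ M → BddBy χ M → ‖x‖ ≤ M → ‖y‖ ≤ M → ∀ d, DistLE ψ χ d →
      DistLE (shift ψ x) (shift χ y) (C * (d + ‖x - y‖)) := by
  -- The factor 2 is the Sobolev constant of `norm_rep_le`.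
  obtain ⟨K, hK0, hK⟩ := exists_increment_bound contDiff_pot (2 * |M|)
  refine ⟨2 + K * |M| + K, by positivity, fun ψ χ x y hψ hχ hx hy d hd => ?_⟩
  have hM := hψ.nonneg
  rw [abs_of_nonneg hM] at hK ⊢
  have hd0 := hd.nonneg
  have hxy := norm_nonneg (x - y)
  have hKM : 0 ≤ K * M := by positivity
  refine ⟨fun t => ?_, ?_, ?_⟩
  · rw [shift_apply, shift_apply, add_sub_add_comm, ← rep_sub]
    refine (norm_add_le _ _).trans ((add_le_add (hd.sup t) (norm_rep_le _ _)).trans ?_)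
    nlinarith [mul_nonneg hKM hd0, mul_nonneg hKM hxy, mul_nonneg hK0 hd0, mul_nonneg hK0 hxy]
  · rw [Dcl_shift, Dcl_shift, add_sub_add_comm, ← map_sub]
    refine (norm_add_le _ _).trans ((add_le_add hd.der (norm_J1_le _)).trans ?_)
    nlinarith [mul_nonneg hKM hd0, mul_nonneg hKM hxy, mul_nonneg hK0 hd0, mul_nonneg hK0 hxy]
  · have h1 : ‖Pot (shift ψ x) - Pot (shift χ y)‖
        ≤ 1 * ‖Pot ψ - Pot χ‖ + K * d * ‖J0 x‖ + K * ‖J0 (x - y)‖ := by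
      refine L2_norm_le ?_ zero_le_one (by positivity) hK0
      filter_upwards [Lp.coeFn_sub (Pot (shift ψ x)) (Pot (shift χ y)), Pot_coeFn (shift ψ x),
        Pot_coeFn (shift χ y), Lp.coeFn_sub (Pot ψ) (Pot χ), Pot_coeFn ψ, Pot_coeFn χ,
        norm_rep_coe_eq x, norm_rep_coe_eq (x - y)] with t h1 h2 h3 h4 h5 h6 h7 h8
      rw [h1, Pi.sub_apply, h2, h3, h4, Pi.sub_apply, h5, h6, ← h7, ← h8, shift_apply,
        shift_apply, rep_sub]
      have hb : ∀ z : L2, ‖z‖ ≤ M → ‖rep z t‖ ≤ 2 * M := fun z hz =>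
        (norm_rep_le z t).trans (by linarith)
      have h9 := hK (ψ t) (χ t) (rep x t) (rep y t) ((hψ.sup t).trans (by linarith))
        ((hχ.sup t).trans (by linarith)) (hb x hx) (hb y hy)
      have e : pot (ψ t + rep x t) - pot (χ t + rep y t) = (pot (ψ t) - pot (χ t))
          + ((pot (ψ t + rep x t) - pot (ψ t)) - (pot (χ t + rep y t) - pot (χ t))) := by ring
      rw [e, one_mul, add_assoc]
      refine (norm_add_le _ _).trans (add_le_add le_rfl (h9.trans (add_le_add ?_ le_rfl)))
      gcongr
      exact hd.sup t
    have h2 : ‖J0 x‖ ≤ M := (norm_J0_le x).trans hx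
    have h3 : ‖J0 (x - y)‖ ≤ ‖x - y‖ := norm_J0_le _
    calc _ ≤ _ := h1
      _ ≤ 1 * d + K * d * M + K * ‖x - y‖ := by gcongr; exact hd.pot
      _ ≤ _ := by
        nlinarith [mul_nonneg hKM hd0, mul_nonneg hKM hxy, mul_nonneg hK0 hd0,
          mul_nonneg hK0 hxy]

/-! ### The nonlinearity on the energy space -/

theorem memLp_nl (ψ : EnergySpace) : MemLp (fun t => nl (ψ t)) 2 volume := by
  obtain ⟨M, hM⟩ := exists_bddBy ψ
  exact ψ.2.potential_memLp.of_le_mul (c := 1 + 3 * M ^ 2)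
    (contDiff_nl.continuous.comp ψ.2.continuous).aestronglyMeasurable
    (Eventually.of_forall fun t => norm_nl_le (hM.sup t))

theorem memLp_fderiv_nl (ψ : EnergySpace) :
    MemLp (fun t => fderiv ℝ nl (ψ t) (Dcl ψ t)) 2 volume := by
  obtain ⟨M, hM⟩ := exists_bddBy ψ
  obtain ⟨K, -, hK, -, -⟩ := exists_lipschitz_bound contDiff_nl M
  refine (Lp.memLp (Dcl ψ)).of_le_mul (c := K) ?_ (Eventually.of_forall fun t => ?_)
  · have hc : Continuous fun t => fderiv ℝ nl (ψ t) :=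
      (contDiff_nl.continuous_fderiv (by simp)).comp ψ.2.continuous
    exact isBoundedBilinearMap_apply.continuous.comp_aestronglyMeasurable
        (hc.aestronglyMeasurable.prodMk (Lp.aestronglyMeasurable (Dcl ψ)))
  · exact (ContinuousLinearMap.le_opNorm _ _).trans
      (mul_le_mul_of_nonneg_right (hK _ (hM.sup t)) (norm_nonneg _))

/-- The class of the nonlinearity. -/
def F0 (ψ : EnergySpace) : L2 := (memLp_nl ψ).toLp

/-- The class of the derivative of the nonlinearity. -/
def F1 (ψ : EnergySpace) : L2 := (memLp_fderiv_nl ψ).toLp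

theorem F0_coeFn (ψ : EnergySpace) : F0 ψ =ᵐ[volume] fun t => nl (ψ t) :=
  (memLp_nl ψ).coeFn_toLp

theorem F1_coeFn (ψ : EnergySpace) : F1 ψ =ᵐ[volume] fun t => fderiv ℝ nl (ψ t) (Dcl ψ t) :=
  (memLp_fderiv_nl ψ).coeFn_toLp

theorem isH1_F (ψ : EnergySpace) : IsH1 (F0 ψ) (F1 ψ) :=
  ⟨fun t => nl (ψ t), ((isPrim_Dcl ψ).comp (contDiff_nl.of_le (by exact_mod_cast le_top))).congr_left
    (F1_coeFn ψ).symm, F0_coeFn ψ⟩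

/-- Each term is a bounded factor times `Pot` or `Dcl`, so differences split into sup norm times
`L²` norm. The constant is a sum dominating all four estimates. -/
theorem exists_F_bound (M : ℝ) : ∃ C : ℝ, 0 ≤ C ∧
    (∀ ψ : EnergySpace, BddBy ψ M → ‖F0 ψ‖ ≤ C ∧ ‖F1 ψ‖ ≤ C) ∧
    (∀ ψ χ : EnergySpace, BddBy ψ M → BddBy χ M → ∀ d, DistLE ψ χ d →
      ‖F0 ψ - F0 χ‖ ≤ C * d ∧ ‖F1 ψ - F1 χ‖ ≤ C * d) := by
  obtain ⟨K, hK0, hK1, -, hK3⟩ := exists_lipschitz_bound contDiff_nl M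
  set A := 1 + 3 * M ^ 2 with hA
  have hA0 : 0 ≤ A := by positivity
  have h6 : 0 ≤ A * |M| + K * |M| + A + 6 * |M| * |M| + K * |M| + K := by positivity
  refine ⟨_, h6, fun ψ hψ => ?_, fun ψ χ hψ hχ d hd => ?_⟩
  · have hM := hψ.nonneg
    rw [abs_of_nonneg hM]
    have hKM : 0 ≤ K * M := by positivity
    have hAM : 0 ≤ A * M := by positivity
    have hMM : 0 ≤ M * M := by positivity
    constructor
    · have : ‖F0 ψ‖ ≤ A * ‖Pot ψ‖ := by
        refine norm_le_of_ae_norm_le ?_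
        filter_upwards [F0_coeFn ψ, Pot_coeFn ψ] with t h1 h2
        rw [h1, h2]
        exact norm_nl_le (hψ.sup t)
      nlinarith [mul_le_mul_of_nonneg_left hψ.pot hA0]
    · have : ‖F1 ψ‖ ≤ K * ‖Dcl ψ‖ := by
        refine norm_le_of_ae_norm_le ?_
        filter_upwards [F1_coeFn ψ] with t h1
        rw [h1]
        exact (ContinuousLinearMap.le_opNorm _ _).trans
          (mul_le_mul_of_nonneg_right (hK1 _ (hψ.sup t)) (norm_nonneg _))
      nlinarith [mul_le_mul_of_nonneg_left hψ.der hK0]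
  · have hM := hψ.nonneg
    rw [abs_of_nonneg hM]
    have hd0 := hd.nonneg
    have hKM : 0 ≤ K * M * d := by positivity
    have hAM : 0 ≤ A * M * d := by positivity
    have hMM : 0 ≤ M * M * d := by positivity
    have hAd : 0 ≤ A * d := by positivity
    have hKd : 0 ≤ K * d := by positivity
    constructor
    · have h1 : ‖F0 ψ - F0 χ‖ ≤ A * ‖Pot ψ - Pot χ‖ + 6 * M * d * ‖Pot χ‖ + 0 * ‖Pot χ‖ := by
        refine L2_norm_le ?_ hA0 (by positivity) le_rfl
        filter_upwards [Lp.coeFn_sub (F0 ψ) (F0 χ), F0_coeFn ψ, F0_coeFn χ,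
          Lp.coeFn_sub (Pot ψ) (Pot χ), Pot_coeFn ψ, Pot_coeFn χ] with t h1 h2 h3 h4 h5 h6
        rw [h1, Pi.sub_apply, h2, h3, h4, Pi.sub_apply, h5, h6, zero_mul, add_zero]
        refine (norm_nl_sub_le (hψ.sup t) (hχ.sup t)).trans (add_le_add le_rfl ?_)
        gcongr
        exact hd.sup t
      calc _ ≤ _ := h1
        _ ≤ A * d + 6 * M * d * M + 0 * ‖Pot χ‖ := by
          gcongr
          · exact hd.pot
          · exact hχ.pot
        _ ≤ _ := by nlinarith
    · have h1 : ‖F1 ψ - F1 χ‖ ≤ K * d * ‖Dcl ψ‖ + K * ‖Dcl ψ - Dcl χ‖ + 0 * ‖Pot χ‖ := by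
        refine L2_norm_le ?_ hKd hK0 le_rfl
        filter_upwards [Lp.coeFn_sub (F1 ψ) (F1 χ), F1_coeFn ψ, F1_coeFn χ,
          Lp.coeFn_sub (Dcl ψ) (Dcl χ)] with t h1 h2 h3 h4
        rw [h1, Pi.sub_apply, h2, h3, h4, Pi.sub_apply, zero_mul, add_zero]
        have e : fderiv ℝ nl (ψ t) (Dcl ψ t) - fderiv ℝ nl (χ t) (Dcl χ t)
            = (fderiv ℝ nl (ψ t) - fderiv ℝ nl (χ t)) (Dcl ψ t)
              + fderiv ℝ nl (χ t) (Dcl ψ t - Dcl χ t) := by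
          rw [sub_apply, map_sub]; ring
        rw [e]
        refine (norm_add_le _ _).trans (add_le_add ?_ ?_)
        · refine (ContinuousLinearMap.le_opNorm _ _).trans
            (mul_le_mul_of_nonneg_right ?_ (norm_nonneg _))
          refine (hK3 _ _ (hψ.sup t) (hχ.sup t)).trans ?_
          gcongr
          exact hd.sup t
        · exact (ContinuousLinearMap.le_opNorm _ _).trans
            (mul_le_mul_of_nonneg_right (hK1 _ (hχ.sup t)) (norm_nonneg _))
      calc _ ≤ _ := h1
        _ ≤ K * d * M + K * d + 0 * ‖Pot χ‖ := by
          gcongr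
          · exact hψ.der
          · exact hd.der
        _ ≤ _ := by nlinarith

end CubicQuintic

namespace CubicQuintic

open scoped ComplexConjugate InnerProductSpace

/-! ### Continuity of the coefficients -/

theorem tendsto_toReal_edist (ψ : EnergySpace) :
    Tendsto (fun χ => (edist χ ψ).toReal) (𝓝 ψ) (𝓝 0) := by
  have h1 : Tendsto (fun χ : EnergySpace => edist χ ψ) (𝓝 ψ) (𝓝 (edist ψ ψ)) :=
    (continuous_id.edist continuous_const).tendsto ψ
  rw [edist_self] at h1
  exact (ENNReal.tendsto_toReal ENNReal.zero_ne_top).comp h1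

theorem eventually_bddBy {ψ : EnergySpace} {M : ℝ} (h : BddBy ψ M) :
    ∀ᶠ χ in 𝓝 ψ, BddBy χ (M + 1) := by
  filter_upwards [(tendsto_toReal_edist ψ).eventually (gt_mem_nhds zero_lt_one)] with χ hχ
  exact (h.of_distLE (distLE_toReal χ ψ)).mono (by linarith)

/-- Points near `ψ` satisfy a common bound, so Lipschitz estimates on bounded sets give continuity.
-/
theorem continuous_of_distLE {G : EnergySpace → L2}
    (hG : ∀ M : ℝ, ∃ C : ℝ, ∀ ψ χ : EnergySpace, BddBy ψ M → BddBy χ M → ∀ d, DistLE ψ χ d →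
      ‖G ψ - G χ‖ ≤ C * d) : Continuous G := by
  rw [continuous_iff_continuousAt]
  intro ψ
  obtain ⟨M, hM⟩ := exists_bddBy ψ
  obtain ⟨C, hC⟩ := hG (M + 1)
  rw [ContinuousAt, tendsto_iff_norm_sub_tendsto_zero]
  have h1 : Tendsto (fun χ => C * (edist χ ψ).toReal) (𝓝 ψ) (𝓝 0) := by
    simpa using (tendsto_toReal_edist ψ).const_mul C
  refine squeeze_zero' (Eventually.of_forall fun _ => norm_nonneg _) ?_ h1
  filter_upwards [eventually_bddBy hM] with χ hχ
  exact hC χ ψ hχ (hM.mono (by linarith)) _ (distLE_toReal χ ψ)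

theorem continuous_Dcl : Continuous Dcl :=
  continuous_of_distLE fun _ => ⟨1, fun _ _ _ _ d h => by simpa using h.der⟩

theorem continuous_Pot : Continuous Pot :=
  continuous_of_distLE fun _ => ⟨1, fun _ _ _ _ d h => by simpa using h.pot⟩

theorem continuous_F0 : Continuous F0 :=
  continuous_of_distLE fun M => by
    obtain ⟨C, -, -, h⟩ := exists_F_bound M
    exact ⟨C, fun ψ χ hψ hχ d hd => (h ψ χ hψ hχ d hd).1⟩

theorem continuous_F1 : Continuous F1 :=
  continuous_of_distLE fun M => by
    obtain ⟨C, -, -, h⟩ := exists_F_bound M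
    exact ⟨C, fun ψ χ hψ hχ d hd => (h ψ χ hψ hχ d hd).2⟩

theorem continuous_energy : Continuous EnergySpace.energy := by
  have : EnergySpace.energy = fun ψ => ‖Dcl ψ‖ ^ 2 + ‖Pot ψ‖ ^ 2 := funext energy_eq
  rw [this]
  exact (continuous_Dcl.norm.pow 2).add (continuous_Pot.norm.pow 2)

theorem exists_bddBy_of_continuousOn {u : ℝ → EnergySpace} {a b : ℝ}
    (hu : ContinuousOn u (Icc a b)) : ∃ M, ∀ t ∈ Icc a b, BddBy (u t) M := by
  obtain ⟨C, hC⟩ := isCompact_Icc.exists_bound_of_continuousOn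
    (continuous_energy.comp_continuousOn hu)
  exact ⟨_, fun t ht => bddBy_of_energy_le ((le_abs_self _).trans (hC t ht))⟩

/-! ### Moving averages -/

/-- The square of the moving average is at most the moving average of the square, which is the
convolution of `‖x‖²` with an indicator function, hence integrable. -/
theorem memLp_integral_norm (x : L2) :
    MemLp (fun y : ℝ => ∫ t in y..(y + 1), ‖x t‖) 2 volume := by
  have hli : ∀ a b : ℝ, IntervalIntegrable (fun t => ‖x t‖) volume a b := fun a b =>
    ((locallyIntegrable_coeFn x).integrableOn_isCompact isCompact_uIcc).intervalIntegrable.norm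
  have hcont : Continuous fun y : ℝ => ∫ t in y..(y + 1), ‖x t‖ := by
    have h0 : Continuous fun y : ℝ => ∫ t in (0 : ℝ)..y, ‖x t‖ :=
      intervalIntegral.continuous_primitive hli 0
    have e : (fun y : ℝ => ∫ t in y..(y + 1), ‖x t‖)
        = fun y => (∫ t in (0 : ℝ)..(y + 1), ‖x t‖) - ∫ t in (0 : ℝ)..y, ‖x t‖ := by
      funext y
      rw [intervalIntegral.integral_interval_sub_left (hli _ _) (hli _ _)]
    rw [e]
    exact (h0.comp (continuous_id.add continuous_const)).sub h0
  rw [memLp_two_iff_integrable_sq hcont.aestronglyMeasurable]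
  have hconv : Integrable fun y : ℝ => ∫ t in y..(y + 1), ‖x t‖ ^ 2 := by
    have h1 : Integrable (indicator (Ioc (-1 : ℝ) 0) fun _ => (1 : ℝ)) volume :=
      (integrable_indicator_iff measurableSet_Ioc).2 (by simp)
    have h2 := h1.integrable_convolution (ContinuousLinearMap.mul ℝ ℝ) (integrable_norm_sq x)
    refine h2.congr (Eventually.of_forall fun y => ?_)
    simp only [convolution, ContinuousLinearMap.mul_apply']
    have e : ∀ t, indicator (Ioc (-1 : ℝ) 0) (fun _ => (1 : ℝ)) t * ‖x (y - t)‖ ^ 2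
        = indicator (Ioc (-1 : ℝ) 0) (fun t => ‖x (y - t)‖ ^ 2) t := fun t => by
      by_cases ht : t ∈ Ioc (-1 : ℝ) 0 <;> simp [ht]
    simp only [e]
    rw [integral_indicator measurableSet_Ioc, ← intervalIntegral.integral_of_le (by norm_num),
      intervalIntegral.integral_comp_sub_left (fun t => ‖x t‖ ^ 2) y]
    simp
  refine hconv.mono' (hcont.pow 2).aestronglyMeasurable (Eventually.of_forall fun y => ?_)
  rw [Real.norm_of_nonneg (by positivity)]
  exact sq_integral_norm_le x y

/-- A function with square integrable derivative which is, weakly, the sum of a square integrable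
function and the derivative of another one, is square integrable. -/
theorem memLp_of_weak {w : ℝ → ℂ} {g A B : L2} (hw : IsPrim g w)
    (h : ∀ φ : ℝ → ℂ, ContDiff ℝ ∞ φ → HasCompactSupport φ →
      ∫ x, w x * φ x = (∫ x, A x * φ x) + ∫ x, B x * deriv φ x) :
    MemLp w 2 volume ∧ ∃ β : ℝ → ℂ, IsPrim (fun x => A x - w x) β ∧ B =ᵐ[volume] β := by
  -- The hypothesis reads `B' = A - w` weakly, so `B` has a continuous representative.
  obtain ⟨β, hβ, hBβ⟩ := exists_isPrim_of_weakDeriv (a := B) (b := fun x => A x - w x)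
    (locallyIntegrable_coeFn B) ((locallyIntegrable_coeFn A).sub hw.continuous.locallyIntegrable)
    fun φ hφ hs => by
      simp only [sub_mul]
      rw [integral_sub
        (integrable_mul_of_hasCompactSupport (locallyIntegrable_coeFn A) hφ.continuous hs)
        (integrable_mul_of_hasCompactSupport hw.continuous.locallyIntegrable hφ.continuous hs),
        h φ hφ hs]
      ring
  refine ⟨?_, β, hβ, hBβ⟩
  have hβL : MemLp β 2 volume := (Lp.memLp B).ae_eq hBβ
  have hβ1 : MemLp (fun y => β (y + 1)) 2 volume :=
    hβL.comp_measurePreserving (measurePreserving_add_right volume (1 : ℝ))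
  -- `w y` is within a moving average of `‖g‖` of its mean over `[y, y + 1]`, and that mean equals
  -- `∫ A + β y - β (y + 1)`. All four dominating terms are in `L²`.
  have hsum := ((memLp_integral_norm g).add (memLp_integral_norm A)).add (hβL.norm.add hβ1.norm)
  refine hsum.mono hw.continuous.aestronglyMeasurable (Eventually.of_forall fun y => ?_)
  simp only [Pi.add_apply]
  refine le_trans ?_ (le_abs_self _)
  have h1 := hw.norm_sub_integral_le y
  have hA : IntervalIntegrable A volume y (y + 1) :=
    ((locallyIntegrable_coeFn A).integrableOn_isCompact isCompact_uIcc).intervalIntegrable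
  have h2 := hβ.sub_eq y (y + 1)
  rw [intervalIntegral.integral_sub hA (hw.continuous.intervalIntegrable _ _)] at h2
  have h3 : ∫ t in y..(y + 1), w t = (∫ t in y..(y + 1), A t) + β y - β (y + 1) := by
    linear_combination h2
  have h4 : ‖∫ t in y..(y + 1), w t‖ ≤ (∫ t in y..(y + 1), ‖A t‖) + ‖β y‖ + ‖β (y + 1)‖ := by
    rw [h3]
    refine (norm_sub_le _ _).trans (add_le_add ((norm_add_le _ _).trans (add_le_add ?_ le_rfl))
      le_rfl)
    exact intervalIntegral.norm_integral_le_integral_norm (by linarith)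
  have h5 : ‖w y‖ ≤ ‖w y - ∫ t in y..(y + 1), w t‖ + ‖∫ t in y..(y + 1), w t‖ :=
    norm_le_norm_sub_add _ _
  linarith

/-! ### The weak formulation -/

/-- One derivative returns to `ψ`, since `ψ_x` and the nonlinearity, unlike `ψ`, are `L²` elements
depending continuously on the state. -/
theorem integral_weak_eq (ψ : EnergySpace) {φ : ℝ → ℂ} (hφ : ContDiff ℝ ∞ φ)
    (hs : HasCompactSupport φ) :
    ∫ x, (ψ x * deriv (deriv φ) x
        + (-ψ x + 4 * (‖ψ x‖ : ℂ) ^ 2 * ψ x - 3 * (‖ψ x‖ : ℂ) ^ 4 * ψ x) * φ x)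
      = - (∫ x, Dcl ψ x * deriv φ x) + ∫ x, F0 ψ x * φ x := by
  have hφ1 : ContDiff ℝ ∞ (deriv φ) := (contDiff_infty_iff_deriv.1 hφ).2
  have hφ2 : ContDiff ℝ ∞ (deriv (deriv φ)) := (contDiff_infty_iff_deriv.1 hφ1).2
  simp only [← nl_eq]
  have hc : Continuous fun x => nl (ψ x) := contDiff_nl.continuous.comp ψ.2.continuous
  rw [integral_add
    (integrable_mul_of_hasCompactSupport ψ.2.continuous.locallyIntegrable hφ2.continuous
      hs.deriv.deriv)
    (integrable_mul_of_hasCompactSupport hc.locallyIntegrable hφ.continuous hs),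
    (isPrim_Dcl ψ).integral_mul_deriv (hφ1.of_le (by exact_mod_cast le_top)) hs.deriv]
  congr 1
  refine integral_congr_ae ?_
  filter_upwards [F0_coeFn ψ] with x hx
  rw [hx]

theorem hasDerivWithinAt_integral {G : ℝ → L2} {a b s t : ℝ} (hG : ContinuousOn G (Icc a b))
    (hs : s ∈ Icc a b) (ht : t ∈ Icc a b) :
    HasDerivWithinAt (fun r => ∫ τ in s..r, G τ) (G t) (Icc a b) t := by
  have : Fact (t ∈ Icc a b) := ⟨ht⟩
  exact intervalIntegral.integral_hasDerivWithinAt_right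
    ((hG.mono (uIcc_subset_Icc hs ht)).intervalIntegrable)
    (hG.stronglyMeasurableAtFilter_nhdsWithin measurableSet_Icc t) (hG t ht)

theorem HasDerivWithinAt.inner_left {x : ℝ → L2} {x' : L2} {s : Set ℝ} {t : ℝ} (p : L2)
    (h : HasDerivWithinAt x x' s t) :
    HasDerivWithinAt (fun r => ⟪p, x r⟫_ℂ) (⟪p, x'⟫_ℂ) s t :=
  ((innerSL ℂ p).restrictScalars ℝ).hasFDerivAt.comp_hasDerivWithinAt t h

theorem eq_of_hasDerivWithinAt_zero {E : Type*} [NormedAddCommGroup E] [NormedSpace ℝ E]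
    {f : ℝ → E} {s : Set ℝ} (hs : Convex ℝ s) (h : ∀ t ∈ s, HasDerivWithinAt f 0 s t) {x y : ℝ}
    (hx : x ∈ s) (hy : y ∈ s) : f x = f y := by
  have := hs.norm_image_sub_le_of_norm_hasDerivWithin_le (C := 0) h (fun t _ => by simp) hy hx
  rw [zero_mul, norm_le_zero_iff] at this
  exact sub_eq_zero.1 this

variable {u v : ℝ → EnergySpace} {a b : ℝ}

theorem IsSolutionOn.mono {I J : Set ℝ} (h : IsSolutionOn I u) (hJ : J ⊆ I) : IsSolutionOn J u :=
  ⟨h.continuousOn.mono hJ, fun φ hφ hs t ht => (h.equation φ hφ hs t (hJ ht)).mono hJ⟩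

/-- The integrated nonlinear term between two times. -/
def intF (u : ℝ → EnergySpace) (s t : ℝ) : L2 := ∫ τ in s..t, (-Complex.I) • F0 (u τ)

/-- The integrated derivative between two times. -/
def intD (u : ℝ → EnergySpace) (s t : ℝ) : L2 := ∫ τ in s..t, Complex.I • Dcl (u τ)

namespace IsSolutionOn

theorem hasDerivWithinAt_intF (h : IsSolutionOn (Icc a b) u) {s t : ℝ} (hs : s ∈ Icc a b)
    (ht : t ∈ Icc a b) :
    HasDerivWithinAt (intF u s) ((-Complex.I) • F0 (u t)) (Icc a b) t :=
  hasDerivWithinAt_integral (G := fun τ => (-Complex.I) • F0 (u τ))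
    ((continuous_F0.const_smul (-Complex.I)).comp_continuousOn h.continuousOn) hs ht

theorem hasDerivWithinAt_intD (h : IsSolutionOn (Icc a b) u) {s t : ℝ} (hs : s ∈ Icc a b)
    (ht : t ∈ Icc a b) :
    HasDerivWithinAt (intD u s) (Complex.I • Dcl (u t)) (Icc a b) t :=
  hasDerivWithinAt_integral (G := fun τ => Complex.I • Dcl (u τ))
    ((continuous_Dcl.const_smul Complex.I).comp_continuousOn h.continuousOn) hs ht

/-- The weak equation integrated in time: both sides have the same derivative in `t` and vanish at
`t = s`. -/
theorem integral_sub_eq (h : IsSolutionOn (Icc a b) u) {s t : ℝ} (hs : s ∈ Icc a b)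
    (ht : t ∈ Icc a b) {φ : ℝ → ℂ} (hφ : ContDiff ℝ ∞ φ) (hφs : HasCompactSupport φ) :
    ∫ x, (u t x - u s x) * φ x
      = (∫ x, intF u s t x * φ x) + ∫ x, intD u s t x * deriv φ x := by
  set Φ := (testConj φ hφ hφs).toLp 2
  set Φ' := (SchwartzMap.derivCLM ℂ ℂ (testConj φ hφ hφs)).toLp 2
  have hd : ∀ r ∈ Icc a b, HasDerivWithinAt
      (fun r => Complex.I * (∫ x, u r x * φ x) - Complex.I * (⟪Φ, intF u s r⟫_ℂ + ⟪Φ', intD u s r⟫_ℂ))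
      0 (Icc a b) r := fun r hr => by
    have h1 := h.equation φ hφ hφs r hr
    rw [integral_weak_eq (u r) hφ hφs, ← inner_deriv_testConj hφ hφs (ae_eq_refl _),
      ← inner_testConj hφ hφs (ae_eq_refl _)] at h1
    have h2 := HasDerivWithinAt.inner_left Φ (h.hasDerivWithinAt_intF hs hr)
    have h3 := HasDerivWithinAt.inner_left Φ' (h.hasDerivWithinAt_intD hs hr)
    convert! h1.sub ((h2.add h3).const_mul Complex.I) using 1
    rw [inner_smul_right, inner_smul_right]
    linear_combination (⟪Φ', Dcl (u r)⟫_ℂ - ⟪Φ, F0 (u r)⟫_ℂ) * Complex.I_sq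
  have h1 := eq_of_hasDerivWithinAt_zero (convex_Icc a b) hd ht hs
  have e1 : intF u s s = 0 := intervalIntegral.integral_same
  have e2 : intD u s s = 0 := intervalIntegral.integral_same
  simp only [e1, e2, inner_zero_right, add_zero, mul_zero, sub_zero] at h1
  rw [← mul_sub] at h1
  have h2 := mul_left_cancel₀ Complex.I_ne_zero h1
  rw [← inner_testConj hφ hφs (ae_eq_refl _), ← inner_deriv_testConj hφ hφs (ae_eq_refl _)]
  simp only [sub_mul]
  rw [integral_sub
    (integrable_mul_of_hasCompactSupport (u t).2.continuous.locallyIntegrable hφ.continuous hφs)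
    (integrable_mul_of_hasCompactSupport (u s).2.continuous.locallyIntegrable hφ.continuous hφs)]
  linear_combination h2

/-- Increments of solutions belong to `H¹`, and satisfy the equation in the sense of the duality
between `H¹` and `H⁻¹`. -/
theorem exists_increment (h : IsSolutionOn (Icc a b) u) {s t : ℝ} (hs : s ∈ Icc a b)
    (ht : t ∈ Icc a b) : ∃ w : L2, w =ᵐ[volume] (fun x => u t x - u s x) ∧
      IsH1 w (Dcl (u t) - Dcl (u s)) ∧
      ∀ p q : L2, IsH1 p q → ⟪p, w⟫_ℂ = ⟪p, intF u s t⟫_ℂ + ⟪q, intD u s t⟫_ℂ := by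
  have hw : IsPrim (Dcl (u t) - Dcl (u s) : L2) (fun x => u t x - u s x) :=
    ((isPrim_Dcl (u t)).sub (isPrim_Dcl (u s))).congr_left (Lp.coeFn_sub _ _).symm
  obtain ⟨hL, β, hβ, hBβ⟩ := memLp_of_weak hw fun φ hφ hφs => h.integral_sub_eq hs ht hφ hφs
  refine ⟨hL.toLp, hL.coeFn_toLp, ⟨_, hw, hL.coeFn_toLp⟩, fun p q hpq => ?_⟩
  -- The integrated equation says `∂ intD = intF - w`, so `intD` is itself in `H¹` and can be paired
  -- with any `H¹` function.
  have hB : IsH1 (intD u s t) (intF u s t - hL.toLp) := by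
    refine ⟨β, hβ.congr_left ?_, hBβ⟩
    filter_upwards [Lp.coeFn_sub (intF u s t) hL.toLp, hL.coeFn_toLp] with x h1 h2
    rw [h1, Pi.sub_apply, h2]
  have := hpq.inner_eq_neg hB
  rw [inner_sub_right] at this
  linear_combination -this

/-- The increments of a solution from a fixed time, as elements of `L²`. -/
structure Increments (u : ℝ → EnergySpace) (a b s : ℝ) (W : ℝ → L2) : Prop where
  coeFn : ∀ t ∈ Icc a b, W t =ᵐ[volume] fun x => u t x - u s x
  isH1 : ∀ t ∈ Icc a b, IsH1 (W t) (Dcl (u t) - Dcl (u s))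
  inner_sub : ∀ t ∈ Icc a b, ∀ t' ∈ Icc a b, ∀ p q : L2, IsH1 p q →
    ⟪p, W t' - W t⟫_ℂ = ⟪p, intF u t t'⟫_ℂ + ⟪q, intD u t t'⟫_ℂ

theorem exists_increments (h : IsSolutionOn (Icc a b) u) {s : ℝ} (hs : s ∈ Icc a b) :
    ∃ W, Increments u a b s W := by
  choose! W hW1 hW2 _ using fun (t : ℝ) (ht : t ∈ Icc a b) => h.exists_increment hs ht
  refine ⟨W, hW1, hW2, fun t ht t' ht' p q hpq => ?_⟩
  obtain ⟨w, hw1, -, hw3⟩ := h.exists_increment ht ht'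
  have : W t' - W t = w := by
    apply Lp.ext
    filter_upwards [Lp.coeFn_sub (W t') (W t), hW1 t ht, hW1 t' ht', hw1] with x h1 h2 h3 h4
    rw [h1, Pi.sub_apply, h2, h3, h4]
    ring
  rw [this]
  exact hw3 p q hpq

theorem hasDerivWithinAt_inner (h : IsSolutionOn (Icc a b) u) {s t : ℝ} {W : ℝ → L2}
    (hW : Increments u a b s W) (ht : t ∈ Icc a b) {p q : L2} (hpq : IsH1 p q) :
    HasDerivWithinAt (fun r => ⟪p, W r⟫_ℂ)
      (⟪p, (-Complex.I) • F0 (u t)⟫_ℂ + ⟪q, Complex.I • Dcl (u t)⟫_ℂ) (Icc a b) t := by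
  have h2 := HasDerivWithinAt.inner_left p (h.hasDerivWithinAt_intF ht ht)
  have h3 := HasDerivWithinAt.inner_left q (h.hasDerivWithinAt_intD ht ht)
  refine ((h2.add h3).const_add (⟪p, W t⟫_ℂ)).congr_of_mem (fun r hr => ?_) ht
  have := hW.inner_sub t ht r hr p q hpq
  rw [inner_sub_right] at this
  change ⟪p, W r⟫_ℂ = ⟪p, W t⟫_ℂ + (⟪p, intF u t r⟫_ℂ + ⟪q, intD u t r⟫_ℂ)
  linear_combination this

/-- The square of the increments is of higher order. -/
theorem hasDerivWithinAt_norm_sq (h : IsSolutionOn (Icc a b) u) {s t : ℝ} {W : ℝ → L2}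
    (hW : Increments u a b s W) (ht : t ∈ Icc a b) :
    HasDerivWithinAt (fun r => ‖W r - W t‖ ^ 2) 0 (Icc a b) t := by
  have e1 : intF u t t = 0 := intervalIntegral.integral_same
  have e2 : intD u t t = 0 := intervalIntegral.integral_same
  have hO1 : intF u t =O[𝓝[Icc a b] t] fun r => r - t := by
    have := (h.hasDerivWithinAt_intF ht ht).hasFDerivWithinAt.isBigO_sub
    simpa only [e1, sub_zero] using this
  have hO2 : intD u t =O[𝓝[Icc a b] t] fun r => r - t := by
    have := (h.hasDerivWithinAt_intD ht ht).hasFDerivWithinAt.isBigO_sub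
    simpa only [e2, sub_zero] using this
  have hD : Tendsto (fun r => ‖Dcl (u r) - Dcl (u t)‖) (𝓝[Icc a b] t) (𝓝 0) :=
    tendsto_iff_norm_sub_tendsto_zero.1 ((continuous_Dcl.comp_continuousOn h.continuousOn) t ht)
  have hmem : ∀ᶠ r in 𝓝[Icc a b] t, r ∈ Icc a b := self_mem_nhdsWithin
  -- The integrated equation is tested with the increment itself. The integrals are `O(r - t)`, and
  -- the other factor of `intD`, the increment of `Dcl`, tends to zero; the total is `o(r - t)`.
  have hle : ∀ᶠ r in 𝓝[Icc a b] t, ‖‖W r - W t‖ ^ 2‖ ≤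
      ‖‖intF u t r‖ * ‖intF u t r‖ + 2 * (‖Dcl (u r) - Dcl (u t)‖ * ‖intD u t r‖)‖ := by
    filter_upwards [hmem] with r hr
    have hp : IsH1 (W r - W t) (Dcl (u r) - Dcl (u t)) := by
      have := (hW.isH1 r hr).sub (hW.isH1 t ht)
      rwa [sub_sub_sub_cancel_right] at this
    have h1 := hW.inner_sub t ht r hr _ _ hp
    have h2 : ‖W r - W t‖ ^ 2 ≤ ‖W r - W t‖ * ‖intF u t r‖
        + ‖Dcl (u r) - Dcl (u t)‖ * ‖intD u t r‖ := by
      have h0 : ‖W r - W t‖ ^ 2 = ‖⟪W r - W t, W r - W t⟫_ℂ‖ := by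
        rw [inner_self_eq_norm_sq_to_K]
        simp
      rw [h0, h1]
      exact (norm_add_le _ _).trans (add_le_add (norm_inner_le_norm _ _) (norm_inner_le_norm _ _))
    rw [Real.norm_of_nonneg (by positivity), Real.norm_of_nonneg (by positivity)]
    nlinarith [sq_nonneg (‖W r - W t‖ - ‖intF u t r‖)]
  have ho1 : (fun r => ‖intF u t r‖ * ‖intF u t r‖) =o[𝓝[Icc a b] t] fun r => r - t := by
    have hz : Tendsto (fun r => r - t) (𝓝[Icc a b] t) (𝓝 0) := by
      have : Tendsto (fun r : ℝ => r - t) (𝓝 t) (𝓝 (t - t)) :=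
        (continuous_id.sub continuous_const).tendsto t
      rw [sub_self] at this
      exact this.mono_left nhdsWithin_le_nhds
    have h2 : (fun r => ‖intF u t r‖) =o[𝓝[Icc a b] t] fun _ => (1 : ℝ) :=
      hO1.norm_left.trans_isLittleO ((Asymptotics.isLittleO_one_iff ℝ).2 hz)
    simpa using h2.mul_isBigO hO1.norm_left
  have ho2 : (fun r => ‖Dcl (u r) - Dcl (u t)‖ * ‖intD u t r‖) =o[𝓝[Icc a b] t] fun r => r - t := by
    simpa using ((Asymptotics.isLittleO_one_iff ℝ).2 hD).mul_isBigO hO2.norm_left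
  have ho := (Asymptotics.IsBigO.of_bound' hle).trans_isLittleO (ho1.add (ho2.const_mul_left 2))
  rw [hasDerivWithinAt_iff_isLittleO]
  simpa using ho

end IsSolutionOn

/-! ### Uniqueness by an `L²` estimate -/

/-- A function which agrees up to second order terms with a differentiable one is
differentiable. -/
theorem hasDerivWithinAt_of_norm_le {f g e : ℝ → ℝ} {g' t : ℝ} {s : Set ℝ}
    (hg : HasDerivWithinAt g g' s t) (he : HasDerivWithinAt e 0 s t) (he0 : e t = 0)
    (h : ∀ r ∈ s, |f r - f t - (g r - g t)| ≤ e r) : HasDerivWithinAt f g' s t := by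
  rw [hasDerivWithinAt_iff_isLittleO] at hg he ⊢
  simp only [he0, sub_zero, smul_zero] at he
  have h1 : (fun r => f r - f t - (g r - g t)) =o[𝓝[s] t] fun r => r - t := by
    refine (Asymptotics.IsBigO.of_bound' ?_).trans_isLittleO he
    filter_upwards [self_mem_nhdsWithin] with r hr
    exact (h r hr).trans (le_abs_self _)
  refine (h1.add hg).congr_left fun r => ?_
  ring

/-- Gronwall in both time directions: `exp (K t) f` increases and `exp (-K t) f` decreases. -/
theorem eq_zero_of_abs_deriv_le {f f' : ℝ → ℝ} {K s : ℝ} (hs : s ∈ Icc a b)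
    (hf : ∀ t ∈ Icc a b, HasDerivWithinAt f (f' t) (Icc a b) t) (hf0 : ∀ t ∈ Icc a b, 0 ≤ f t)
    (h : ∀ t ∈ Icc a b, |f' t| ≤ K * f t) (h0 : f s = 0) {t : ℝ} (ht : t ∈ Icc a b) :
    f t = 0 := by
  have hexp : ∀ c r : ℝ, HasDerivAt (fun r => Real.exp (c * r)) (Real.exp (c * r) * c) r :=
    fun c r => by simpa using ((hasDerivAt_id r).const_mul c).exp
  have hprod : ∀ c : ℝ, ∀ r ∈ Icc a b, HasDerivWithinAt (fun r => Real.exp (c * r) * f r)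
      (Real.exp (c * r) * c * f r + Real.exp (c * r) * f' r) (Icc a b) r := fun c r hr =>
    (hexp c r).hasDerivWithinAt.mul (hf r hr)
  have hint : ∀ c : ℝ, ∀ r ∈ interior (Icc a b), HasDerivAt (fun r => Real.exp (c * r) * f r)
      (Real.exp (c * r) * c * f r + Real.exp (c * r) * f' r) r := fun c r hr =>
    (hprod c r (interior_subset hr)).hasDerivAt (mem_interior_iff_mem_nhds.1 hr)
  have hmono : MonotoneOn (fun r => Real.exp (K * r) * f r) (Icc a b) := by
    refine monotoneOn_of_deriv_nonneg (convex_Icc a b) (fun r hr => (hprod K r hr).continuousWithinAt)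
      (fun r hr => (hint K r hr).differentiableAt.differentiableWithinAt) fun r hr => ?_
    rw [(hint K r hr).deriv]
    have h1 := (abs_le.1 (h r (interior_subset hr))).1
    nlinarith [Real.exp_pos (K * r)]
  have hanti : AntitoneOn (fun r => Real.exp (-K * r) * f r) (Icc a b) := by
    refine antitoneOn_of_deriv_nonpos (convex_Icc a b)
      (fun r hr => (hprod (-K) r hr).continuousWithinAt)
      (fun r hr => (hint (-K) r hr).differentiableAt.differentiableWithinAt) fun r hr => ?_
    rw [(hint (-K) r hr).deriv]
    have h1 := (abs_le.1 (h r (interior_subset hr))).2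
    nlinarith [Real.exp_pos (-K * r)]
  refine le_antisymm ?_ (hf0 t ht)
  rcases le_total s t with hst | hst
  · have := hanti hs ht hst
    simp only [h0, mul_zero] at this
    exact nonpos_of_mul_nonpos_right this (Real.exp_pos _)
  · have := hmono ht hs hst
    simp only [h0, mul_zero] at this
    exact nonpos_of_mul_nonpos_right this (Real.exp_pos _)

/-- Uniqueness on compact intervals. -/
theorem IsSolutionOn.eq_of_eq (hu : IsSolutionOn (Icc a b) u) (hv : IsSolutionOn (Icc a b) v)
    {s : ℝ} (hs : s ∈ Icc a b) (hsv : u s = v s) {t : ℝ} (ht : t ∈ Icc a b) : u t = v t := by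
  obtain ⟨U, hU⟩ := hu.exists_increments hs
  obtain ⟨V, hV⟩ := hv.exists_increments hs
  obtain ⟨M, hM⟩ := exists_bddBy_of_continuousOn hu.continuousOn
  obtain ⟨N, hN⟩ := exists_bddBy_of_continuousOn hv.continuousOn
  obtain ⟨K, hK0, -, hK, -⟩ := exists_lipschitz_bound contDiff_nl (max M N)
  have hcoe : ∀ r ∈ Icc a b, (U r - V r : L2) =ᵐ[volume] fun x => u r x - v r x := fun r hr => by
    filter_upwards [Lp.coeFn_sub (U r) (V r), hU.coeFn r hr, hV.coeFn r hr] with x h1 h2 h3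
    rw [h1, Pi.sub_apply, h2, h3, hsv]
    ring
  have hH1 : ∀ r ∈ Icc a b, IsH1 (U r - V r) (Dcl (u r) - Dcl (v r)) := fun r hr => by
    have := (hU.isH1 r hr).sub (hV.isH1 r hr)
    rwa [hsv, sub_sub_sub_cancel_right] at this
  have hF : ∀ r ∈ Icc a b, ‖F0 (u r) - F0 (v r)‖ ≤ K * ‖U r - V r‖ := fun r hr => by
    refine norm_le_of_ae_norm_le ?_
    filter_upwards [Lp.coeFn_sub (F0 (u r)) (F0 (v r)), F0_coeFn (u r), F0_coeFn (v r),
      hcoe r hr] with x h1 h2 h3 h4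
    rw [h1, Pi.sub_apply, h2, h3, h4]
    exact hK _ _ (((hM r hr).sup x).trans (le_max_left _ _))
      (((hN r hr).sup x).trans (le_max_right _ _))
  -- Expand the square around the time `r`. The linear term pairs with the fixed `H¹` element `U r -
  -- V r`, so the equation applies; the quadratic remainder is of higher order. The dispersive term
  -- vanishes because `⟪D, i D⟫` is imaginary.
  have hd : ∀ r ∈ Icc a b, HasDerivWithinAt (fun r => ‖U r - V r‖ ^ 2)
      (2 * (⟪U r - V r, (-Complex.I) • (F0 (u r) - F0 (v r))⟫_ℂ).re) (Icc a b) r := fun r hr => by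
    have h1 := (hu.hasDerivWithinAt_inner hU hr (hH1 r hr)).sub
      (hv.hasDerivWithinAt_inner hV hr (hH1 r hr))
    have h2 := (Complex.reCLM.hasFDerivAt.comp_hasDerivWithinAt r h1).const_mul 2
    have h3 := ((hu.hasDerivWithinAt_norm_sq hU hr).add
      (hv.hasDerivWithinAt_norm_sq hV hr)).const_mul 2
    rw [add_zero, mul_zero] at h3
    refine hasDerivWithinAt_of_norm_le (h2.congr_deriv ?_) h3 (by simp) fun r' hr' => ?_
    · simp only [Complex.reCLM_apply]
      congr 1
      rw [add_sub_add_comm, ← inner_sub_right, ← inner_sub_right, ← smul_sub, ← smul_sub,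
        Complex.add_re]
      have h4 : (⟪Dcl (u r) - Dcl (v r), Complex.I • (Dcl (u r) - Dcl (v r))⟫_ℂ).re = 0 := by
        rw [inner_smul_right, inner_self_eq_norm_sq_to_K]
        simp [← Complex.ofReal_pow]
      rw [h4, add_zero]
    · simp only [Function.comp_apply, Pi.sub_apply, Pi.add_apply, Complex.reCLM_apply,
        ← inner_sub_right]
      have e : U r' - V r' = (U r - V r) + ((U r' - U r) - (V r' - V r)) := by abel
      have h4 := norm_add_sq (𝕜 := ℂ) (U r - V r) ((U r' - U r) - (V r' - V r))
      rw [← e] at h4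
      have h5 : (U r' - U r) - (V r' - V r) = (U r' - V r') - (U r - V r) := by abel
      have h6 : (⟪U r - V r, (U r' - U r) - (V r' - V r)⟫_ℂ).re
          = (⟪U r - V r, U r' - V r'⟫_ℂ).re - (⟪U r - V r, U r - V r⟫_ℂ).re := by
        rw [h5, inner_sub_right, Complex.sub_re]
      have h7 : RCLike.re (⟪U r - V r, (U r' - U r) - (V r' - V r)⟫_ℂ)
          = (⟪U r - V r, U r' - V r'⟫_ℂ).re - (⟪U r - V r, U r - V r⟫_ℂ).re := h6
      rw [h7] at h4
      rw [h4]
      have h8 := norm_sub_le (U r' - U r) (V r' - V r)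
      have h9 := norm_nonneg ((U r' - U r) - (V r' - V r))
      rw [abs_le]
      constructor <;> nlinarith [sq_nonneg (‖U r' - U r‖ - ‖V r' - V r‖)]
  have hzero := eq_zero_of_abs_deriv_le (K := 2 * K) hs hd (fun r _ => by positivity)
    (fun r hr => by
      have h1 : |(⟪U r - V r, (-Complex.I) • (F0 (u r) - F0 (v r))⟫_ℂ).re|
          ≤ ‖U r - V r‖ * (K * ‖U r - V r‖) := by
        refine (Complex.abs_re_le_norm _).trans ((norm_inner_le_norm _ _).trans ?_)
        rw [norm_smul, norm_neg, Complex.norm_I, one_mul]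
        gcongr
        exact hF r hr
      rw [abs_mul, abs_two]
      nlinarith) (by
      have : U s - V s = 0 := by
        apply Lp.ext
        filter_upwards [hcoe s hs, Lp.coeFn_zero ℂ 2 (volume : Measure ℝ)] with x h1 h2
        rw [h1, h2, hsv]
        simp
      rw [this]; simp) ht
  have h0 : U t - V t = 0 := by
    rw [← norm_eq_zero]
    exact pow_eq_zero_iff two_ne_zero |>.1 hzero
  apply Subtype.ext
  refine (Continuous.ae_eq_iff_eq volume (u t).2.continuous (v t).2.continuous).1 ?_
  filter_upwards [hcoe t ht, Lp.coeFn_zero ℂ 2 (volume : Measure ℝ)] with x h1 h2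
  rw [h0, h2] at h1
  exact (sub_eq_zero.1 h1.symm)

theorem IsSolutionOn.eqOn {I : Set ℝ} (hI : I.OrdConnected) (hu : IsSolutionOn I u)
    (hv : IsSolutionOn I v) {s : ℝ} (hs : s ∈ I) (hsv : u s = v s) : EqOn u v I := by
  intro t ht
  have hJ : Icc (min s t) (max s t) ⊆ I := hI.uIcc_subset hs ht
  exact (hu.mono hJ).eq_of_eq (hv.mono hJ) ⟨min_le_left _ _, le_max_left _ _⟩ hsv
    ⟨min_le_right _ _, le_max_right _ _⟩

end CubicQuintic

namespace CubicQuintic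

open scoped ComplexConjugate FourierTransform SchwartzMap InnerProductSpace

/-! ### The free propagator -/

/-- The symbol of the propagator of `u_t = - i u_xx`. -/
def msym (t ξ : ℝ) : ℂ := Complex.exp (Complex.I * (((2 * Real.pi * ξ) ^ 2 * t : ℝ) : ℂ))

/-- The symbol of `∂⁻¹ (S(t) - 1)`. -/
def lsym (t ξ : ℝ) : ℂ := (msym t ξ - 1) / dsym ξ

/-- The symbol of `(1 + ∂) ∂⁻¹ (S(t) - 1)`. -/
def ksym (t ξ : ℝ) : ℂ := (msym t ξ - 1) + lsym t ξ

theorem norm_msym (t ξ : ℝ) : ‖msym t ξ‖ = 1 := by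
  rw [msym, mul_comm]; exact Complex.norm_exp_ofReal_mul_I _

theorem msym_zero (ξ : ℝ) : msym 0 ξ = 1 := by simp [msym]

theorem msym_add (s t ξ : ℝ) : msym (s + t) ξ = msym s ξ * msym t ξ := by
  rw [msym, msym, msym, ← Complex.exp_add]
  congr 1
  push_cast
  ring

theorem continuous_msym (t : ℝ) : Continuous (msym t) := by unfold msym; fun_prop

theorem continuous_msym_left (ξ : ℝ) : Continuous fun t => msym t ξ := by unfold msym; fun_prop

theorem dsym_sq (ξ : ℝ) : dsym ξ ^ 2 = - (((2 * Real.pi * ξ) ^ 2 : ℝ) : ℂ) := by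
  rw [dsym]
  push_cast
  linear_combination (4 * (Real.pi : ℂ) ^ 2 * ξ ^ 2) * Complex.I_sq

theorem norm_dsym_sq (ξ : ℝ) : ‖dsym ξ‖ ^ 2 = (2 * Real.pi * ξ) ^ 2 := by
  rw [← norm_pow, dsym_sq, norm_neg, Complex.norm_real, Real.norm_of_nonneg (by positivity)]

theorem hasDerivAt_msym (t ξ : ℝ) :
    HasDerivAt (fun s => msym s ξ) (-Complex.I * dsym ξ ^ 2 * msym t ξ) t := by
  have h1 : HasDerivAt (fun s : ℝ => (((2 * Real.pi * ξ) ^ 2 * s : ℝ) : ℂ))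
      (((2 * Real.pi * ξ) ^ 2 : ℝ) : ℂ) t := by
    have := ((hasDerivAt_id t).const_mul ((2 * Real.pi * ξ) ^ 2)).ofReal_comp
    simpa using this
  have h2 := (h1.const_mul Complex.I).cexp
  refine h2.congr_deriv ?_
  rw [dsym_sq, msym]
  ring

theorem dsym_eq_zero {ξ : ℝ} (h : dsym ξ = 0) : ξ = 0 := by
  simpa [dsym, Real.pi_ne_zero] using h

theorem msym_of_dsym_eq_zero {ξ : ℝ} (h : dsym ξ = 0) (t : ℝ) : msym t ξ = 1 := by
  rw [dsym_eq_zero h]; simp [msym]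

/-- At `dsym ξ = 0` division by zero makes `lsym` vanish, which is consistent with the formula. -/
theorem hasDerivAt_lsym (t ξ : ℝ) :
    HasDerivAt (fun s => lsym s ξ) (-Complex.I * dsym ξ * msym t ξ) t := by
  have h := ((hasDerivAt_msym t ξ).sub_const 1).div_const (dsym ξ)
  refine h.congr_deriv ?_
  rcases eq_or_ne (dsym ξ) 0 with h0 | h0
  · simp [h0]
  · field_simp

/-- At high frequency use `|msym - 1| ≤ 2`; at low frequency `|msym - 1| ≤ |dsym|² |t|` leaves a
power of `dsym` to spare after the division. -/
theorem norm_lsym_le (t ξ : ℝ) : ‖lsym t ξ‖ ≤ 2 + |t| := by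
  have h2 : ‖msym t ξ - 1‖ ≤ 2 := (norm_sub_le _ _).trans (by rw [norm_msym, norm_one]; norm_num)
  have h3 : ‖msym t ξ - 1‖ ≤ ‖dsym ξ‖ ^ 2 * |t| := by
    refine Real.norm_exp_I_mul_ofReal_sub_one_le.trans_eq ?_
    rw [norm_dsym_sq, norm_mul, Real.norm_of_nonneg (by positivity), Real.norm_eq_abs]
  have ht := abs_nonneg t
  rw [lsym, norm_div]
  rcases le_total 1 ‖dsym ξ‖ with h | h
  · rw [div_le_iff₀ (by linarith)]
    nlinarith
  · rcases (norm_nonneg (dsym ξ)).eq_or_lt with h0 | h0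
    · rw [← h0, div_zero]; linarith
    · rw [div_le_iff₀ h0]
      have : ‖dsym ξ‖ ^ 2 * |t| ≤ ‖dsym ξ‖ * |t| := by
        gcongr
        nlinarith
      nlinarith

theorem norm_ksym_le (t ξ : ℝ) : ‖ksym t ξ‖ ≤ 4 + |t| := by
  have h2 : ‖msym t ξ - 1‖ ≤ 2 := (norm_sub_le _ _).trans (by rw [norm_msym, norm_one]; norm_num)
  exact (norm_add_le _ _).trans (by linarith [norm_lsym_le t ξ])

theorem bddSymbol_msym (t : ℝ) : BddSymbol (msym t) :=
  ⟨(continuous_msym t).measurable, 1, fun ξ => (norm_msym t ξ).le⟩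

theorem bddSymbol_lsym (t : ℝ) : BddSymbol (lsym t) :=
  ⟨((continuous_msym t).measurable.sub_const 1).div continuous_dsym.measurable, _, norm_lsym_le t⟩

theorem bddSymbol_ksym (t : ℝ) : BddSymbol (ksym t) :=
  ⟨((continuous_msym t).measurable.sub_const 1).add (bddSymbol_lsym t).measurable, _,
    norm_ksym_le t⟩

theorem jsym_mul_ksym (t ξ : ℝ) : jsym ξ * ksym t ξ = lsym t ξ := by
  rcases eq_or_ne (dsym ξ) 0 with h0 | h0
  · simp [ksym, lsym, h0, msym_of_dsym_eq_zero h0]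
  · have := one_add_dsym_ne_zero ξ
    rw [ksym, lsym, jsym]
    field_simp
    ring

/-- The propagator. -/
def S (t : ℝ) : L2 →L[ℂ] L2 := FM (msym t)

/-- The operator `(1 + ∂) ∂⁻¹ (S(t) - 1)`. -/
def Kop (t : ℝ) : L2 →L[ℂ] L2 := FM (ksym t)

theorem S_zero (x : L2) : S 0 x = x := by
  have : msym 0 = fun _ => 1 := funext msym_zero
  rw [S, this, FM_const, one_smul]

theorem S_S (s t : ℝ) (x : L2) : S s (S t x) = S (s + t) x := by
  rw [S, S, S, FM_FM (bddSymbol_msym s) (bddSymbol_msym t)]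
  congr 2
  funext ξ
  rw [msym_add]

theorem S_S_neg (t : ℝ) (x : L2) : S t (S (-t) x) = x := by
  rw [S_S, add_neg_cancel, S_zero]

theorem S_neg_S (t : ℝ) (x : L2) : S (-t) (S t x) = x := by
  rw [S_S, neg_add_cancel, S_zero]

theorem norm_S (t : ℝ) (x : L2) : ‖S t x‖ = ‖x‖ := by
  have h : ∀ t x, ‖S t x‖ ≤ ‖x‖ := fun t x => by
    have := norm_FM_le (bddSymbol_msym t) (fun ξ => (norm_msym t ξ).le) x
    rwa [one_mul] at this
  refine le_antisymm (h t x) ?_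
  conv_lhs => rw [← S_neg_S t x]
  exact h _ _

theorem continuous_S_apply (x : L2) : Continuous fun t => S t x := by
  rw [continuous_iff_continuousAt]
  intro t
  exact tendsto_FM (C := 1)
    (Eventually.of_forall fun s => ⟨(continuous_msym s).measurable, fun ξ => (norm_msym s ξ).le⟩)
    (bddSymbol_msym t) (fun ξ => (continuous_msym_left ξ).tendsto t) x

theorem continuous_S : Continuous fun p : ℝ × L2 => S p.1 p.2 := by
  rw [continuous_iff_continuousAt]
  rintro ⟨t, x⟩
  have h1 : Tendsto (fun p : ℝ × L2 => S p.1 x) (𝓝 (t, x)) (𝓝 (S t x)) :=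
    ((continuous_S_apply x).comp continuous_fst).tendsto (t, x)
  have h2 : Tendsto (fun p : ℝ × L2 => S p.1 (p.2 - x)) (𝓝 (t, x)) (𝓝 0) := by
    rw [tendsto_zero_iff_norm_tendsto_zero]
    simp only [norm_S]
    have : Continuous fun p : ℝ × L2 => ‖p.2 - x‖ := (continuous_snd.sub continuous_const).norm
    simpa using this.tendsto (t, x)
  have h3 := h1.add h2
  rw [add_zero] at h3
  refine h3.congr fun p => ?_
  rw [map_sub]
  abel

theorem continuous_Kop_apply (x : L2) : Continuous fun t => Kop t x := by
  rw [continuous_iff_continuousAt]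
  intro t
  refine tendsto_FM (C := 4 + (|t| + 1)) ?_ (bddSymbol_ksym t) (fun ξ => ?_) x
  · have : ∀ᶠ s in 𝓝 t, |s| < |t| + 1 := continuous_abs.tendsto t (Iio_mem_nhds (by linarith))
    filter_upwards [this] with s hs
    exact ⟨(bddSymbol_ksym s).measurable, fun ξ => (norm_ksym_le s ξ).trans (by linarith)⟩
  · have : Continuous fun s => ksym s ξ :=
      ((continuous_msym_left ξ).sub continuous_const).add
        (((continuous_msym_left ξ).sub continuous_const).div_const _)
    exact this.tendsto t

theorem norm_Kop_le {t : ℝ} (ht : |t| ≤ 1) (x : L2) : ‖Kop t x‖ ≤ 5 * ‖x‖ :=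
  norm_FM_le (bddSymbol_ksym t) (fun ξ => (norm_ksym_le t ξ).trans (by linarith)) x

theorem Kop_zero (x : L2) : Kop 0 x = 0 := by
  have : ksym 0 = fun _ => 0 := by
    funext ξ
    simp [ksym, lsym, msym_zero]
  rw [Kop, this, FM_const, zero_smul]

theorem J0_Kop (t : ℝ) (x : L2) : J0 (Kop t x) = FM (lsym t) x := by
  rw [J0, Kop, FM_FM bddSymbol_jsym (bddSymbol_ksym t)]
  congr 2
  funext ξ
  exact jsym_mul_ksym t ξ

theorem J1_Kop (t : ℝ) (x : L2) : J1 (Kop t x) = S t x - x := by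
  have h : ksym t = fun ξ => (msym t ξ - 1) + lsym t ξ := rfl
  rw [J1_apply, J0_Kop, Kop, h,
    FM_add ((bddSymbol_msym t).sub (BddSymbol.const 1)) (bddSymbol_lsym t),
    FM_sub (bddSymbol_msym t) (BddSymbol.const 1), FM_const, one_smul, add_sub_cancel_right]
  rfl

theorem FM_comm {m n : ℝ → ℂ} (hm : BddSymbol m) (hn : BddSymbol n) (x : L2) :
    FM m (FM n x) = FM n (FM m x) := by
  rw [FM_FM hm hn, FM_FM hn hm]
  congr 2
  funext ξ
  ring

theorem J0_S (t : ℝ) (x : L2) : J0 (S t x) = S t (J0 x) :=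
  FM_comm bddSymbol_jsym (bddSymbol_msym t) x

theorem J1_S (t : ℝ) (x : L2) : J1 (S t x) = S t (J1 x) := by
  rw [J1_apply, J1_apply, J0_S, map_sub]

/-! ### The equation for the interaction variable -/

/-- The symbol of `(1 - ∂²)⁻¹`. -/
def psym (ξ : ℝ) : ℂ := jsym ξ * conj (jsym ξ)

/-- The symbol of `∂ (1 - ∂²)⁻¹`. -/
def qsym (ξ : ℝ) : ℂ := (1 - jsym ξ) * conj (jsym ξ)

/-- The symbol of `∂² (1 - ∂²)⁻¹`. -/
def rsym (ξ : ℝ) : ℂ := - ((1 - jsym ξ) * conj (1 - jsym ξ))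

theorem bddSymbol_psym : BddSymbol psym := bddSymbol_jsym.mul bddSymbol_jsym.star

theorem bddSymbol_one_sub_jsym : BddSymbol fun ξ => 1 - jsym ξ :=
  (BddSymbol.const 1).sub bddSymbol_jsym

theorem bddSymbol_qsym : BddSymbol qsym := bddSymbol_one_sub_jsym.mul bddSymbol_jsym.star

theorem dsym_mul_psym (ξ : ℝ) : dsym ξ * psym ξ = qsym ξ := by
  rw [psym, qsym, ← mul_assoc, dsym_mul_jsym]

theorem dsym_mul_qsym (ξ : ℝ) : dsym ξ * qsym ξ = rsym ξ := by
  have h : conj (dsym ξ * jsym ξ) = conj (1 - jsym ξ) := congrArg _ (dsym_mul_jsym ξ)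
  rw [map_mul, conj_dsym] at h
  rw [rsym, qsym, ← h]
  ring

theorem psym_sub_rsym (ξ : ℝ) : psym ξ - rsym ξ = 1 := by
  rw [← dsym_mul_qsym, ← dsym_mul_psym, psym]
  have h1 := dsym_mul_jsym ξ
  have h : conj (dsym ξ * jsym ξ) = conj (1 - jsym ξ) := congrArg _ (dsym_mul_jsym ξ)
  rw [map_mul, conj_dsym, map_sub, map_one] at h
  linear_combination (1 - dsym ξ) * conj (jsym ξ) * h1 + h

/-- Take `k = Φ - Φ''`. Writing `Φ = (1 - ∂²)⁻¹ k` provides the two derivatives that `∂_t S(t)`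
costs. -/
theorem exists_testConj_eq {φ : ℝ → ℂ} (hφ : ContDiff ℝ ∞ φ) (hs : HasCompactSupport φ) :
    ∃ k : L2, (testConj φ hφ hs).toLp 2 = FM psym k ∧
      (SchwartzMap.derivCLM ℂ ℂ (testConj φ hφ hs)).toLp 2 = FM qsym k := by
  set Φ := testConj φ hφ hs
  set D : 𝓢(ℝ, ℂ) →L[ℂ] 𝓢(ℝ, ℂ) := SchwartzMap.derivCLM ℂ ℂ
  have hF : ∀ ξ, 𝓕 (Φ + D (D (-Φ))) ξ = (1 - dsym ξ ^ 2) * 𝓕 Φ ξ := fun ξ => by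
    rw [FourierTransform.fourier_add, add_apply, fourier_derivCLM, fourier_derivCLM,
      FourierTransform.fourier_neg, neg_apply]
    ring
  have h1 : ∀ ξ, psym ξ * (1 - dsym ξ ^ 2) = 1 := fun ξ => by
    linear_combination psym_sub_rsym ξ - dsym_mul_qsym ξ - dsym ξ * dsym_mul_psym ξ
  refine ⟨(Φ + D (D (-Φ))).toLp 2, toLp_eq_FM bddSymbol_psym fun ξ => ?_,
    toLp_eq_FM bddSymbol_qsym fun ξ => ?_⟩
  · rw [hF, ← mul_assoc, h1, one_mul]
  · rw [hF, fourier_derivCLM, ← dsym_mul_psym]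
    linear_combination -(dsym ξ * 𝓕 Φ ξ) * h1 ξ

end CubicQuintic

namespace CubicQuintic

open scoped ComplexConjugate InnerProductSpace

/-! ### From the interaction variable to weak solutions -/

theorem inner_FM_right {m : ℝ → ℂ} (hm : BddSymbol m) (x y : L2) :
    ⟪x, FM m y⟫_ℂ = ⟪FM (fun ξ => conj (m ξ)) x, y⟫_ℂ := by
  rw [inner_FM hm.star]
  simp only [Complex.conj_conj]

/-- All multipliers are moved by adjunction onto `k`, where `psym` absorbs the unbounded factors of
the time derivatives (`hA` for the `Kop` part, `hB` for the `S` part). The product rule for inner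
products then handles `y`. -/
theorem hasDerivWithinAt_inner_J0 {y : ℝ → L2} {f : L2} {s : Set ℝ} {t : ℝ}
    (hy : HasDerivWithinAt y (S (-t) f) s t) (k g : L2) :
    HasDerivWithinAt (fun r => ⟪FM psym k, J0 (Kop r g + S r (y r))⟫_ℂ)
      (⟪FM qsym k, Complex.I • S t (g + J1 (y t))⟫_ℂ + ⟪FM psym k, J0 f⟫_ℂ) s t := by
  have hj := bddSymbol_jsym
  have hI := BddSymbol.const Complex.I
  have hA : HasDerivAt (fun r => FM (fun ξ => conj (lsym r ξ) * psym ξ) k)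
      (FM (fun ξ => conj (Complex.I * msym t ξ) * qsym ξ) k) t := by
    obtain ⟨C, hC⟩ := bddSymbol_qsym.bound
    refine hasDerivAt_FM (b' := fun t ξ => conj (Complex.I * msym t ξ) * qsym ξ) (C := C)
      (fun t => (bddSymbol_lsym t).star.mul bddSymbol_psym)
      (fun t => ((hI.mul (bddSymbol_msym t)).star.mul bddSymbol_qsym).measurable)
      (fun t ξ => ?_) (fun t ξ => ?_) k t
    · rw [norm_mul, RCLike.norm_conj, norm_mul, norm_msym, Complex.norm_I, one_mul, one_mul]
      exact hC ξ
    · refine ((hasDerivAt_lsym t ξ).star.mul_const (psym ξ)).congr_deriv ?_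
      change conj (-Complex.I * dsym ξ * msym t ξ) * psym ξ = _
      simp only [map_mul, map_neg, Complex.conj_I, conj_dsym, ← dsym_mul_psym]
      ring
  have hB : HasDerivAt (fun r => FM (fun ξ => conj (jsym ξ * msym r ξ) * psym ξ) k)
      (FM (fun ξ => conj (Complex.I * (msym t ξ * (1 - jsym ξ))) * qsym ξ) k) t := by
    obtain ⟨C, hC⟩ := bddSymbol_qsym.bound
    refine hasDerivAt_FM (b' := fun t ξ => conj (Complex.I * (msym t ξ * (1 - jsym ξ))) * qsym ξ)
      (C := C) (fun t => (hj.mul (bddSymbol_msym t)).star.mul bddSymbol_psym)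
      (fun t => ((hI.mul ((bddSymbol_msym t).mul bddSymbol_one_sub_jsym)).star.mul
        bddSymbol_qsym).measurable)
      (fun t ξ => ?_) (fun t ξ => ?_) k t
    · rw [norm_mul, RCLike.norm_conj, norm_mul, norm_mul, norm_msym, Complex.norm_I, one_mul,
        one_mul]
      exact (mul_le_of_le_one_left (norm_nonneg _) (norm_one_sub_jsym_le ξ)).trans (hC ξ)
    · refine (((hasDerivAt_msym t ξ).const_mul (jsym ξ)).star.mul_const (psym ξ)).congr_deriv ?_
      change conj (jsym ξ * (-Complex.I * dsym ξ ^ 2 * msym t ξ)) * psym ξ = _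
      simp only [← dsym_mul_jsym, map_mul, map_neg, map_pow, Complex.conj_I, conj_dsym,
        ← dsym_mul_psym]
      ring
  have h1 := (hA.hasDerivWithinAt (s := s)).inner ℂ (hasDerivWithinAt_const t s g)
  have h2 := (hB.hasDerivWithinAt (s := s)).inner ℂ hy
  have e : ∀ r (z : L2), ⟪FM (fun ξ => conj (lsym r ξ) * psym ξ) k, g⟫_ℂ
      + ⟪FM (fun ξ => conj (jsym ξ * msym r ξ) * psym ξ) k, z⟫_ℂ
      = ⟪FM psym k, J0 (Kop r g + S r z)⟫_ℂ := fun r z => by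
    rw [map_add, inner_add_right, J0_Kop, inner_FM_right (bddSymbol_lsym r),
      FM_FM (bddSymbol_lsym r).star bddSymbol_psym, J0, S, FM_FM hj (bddSymbol_msym r),
      inner_FM_right (hj.mul (bddSymbol_msym r)),
      FM_FM (hj.mul (bddSymbol_msym r)).star bddSymbol_psym]
  have h3 := h1.add h2
  refine (h3.congr (fun r _ => (e r (y r)).symm) (e t (y t)).symm).congr_deriv ?_
  have e1 : Complex.I • S t (g + J1 (y t))
      = FM (fun ξ => Complex.I * msym t ξ) g
        + FM (fun ξ => Complex.I * (msym t ξ * (1 - jsym ξ))) (y t) := by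
    rw [FM_const_mul (bddSymbol_msym t), FM_const_mul
      ((bddSymbol_msym t).mul bddSymbol_one_sub_jsym),
      ← FM_FM (bddSymbol_msym t) bddSymbol_one_sub_jsym, ← J1_eq, map_add, smul_add]
    rfl
  have e2 : ⟪FM (fun ξ => conj (jsym ξ * msym t ξ) * psym ξ) k, S (-t) f⟫_ℂ
      = ⟪FM psym k, J0 f⟫_ℂ := by
    conv_rhs => rw [← S_S_neg t f]
    have h0 : ∀ z, S t z = FM (msym t) z := fun _ => rfl
    rw [J0, h0, FM_FM hj (bddSymbol_msym t), inner_FM_right (hj.mul (bddSymbol_msym t)),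
      FM_FM (hj.mul (bddSymbol_msym t)).star bddSymbol_psym]
  rw [e1, e2, inner_add_right, inner_FM_right (hI.mul (bddSymbol_msym t)),
    inner_FM_right (hI.mul ((bddSymbol_msym t).mul bddSymbol_one_sub_jsym)),
    FM_FM (hI.mul (bddSymbol_msym t)).star bddSymbol_qsym,
    FM_FM (hI.mul ((bddSymbol_msym t).mul bddSymbol_one_sub_jsym)).star bddSymbol_qsym,
    inner_zero_right]
  ring

/-- The element of the energy space with interaction variable `y` at time `t`, relative to the
initial value `ψ`. -/
def flow (ψ : EnergySpace) (t : ℝ) (y : L2) : EnergySpace := shift ψ (Kop t (Dcl ψ) + S t y)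

theorem flow_zero (ψ : EnergySpace) : flow ψ 0 0 = ψ := by
  rw [flow, Kop_zero, map_zero, add_zero, shift_zero]

/-- After one derivative the `∂⁻¹` disappears and `S t` factors out; as it is isometric, it drops
out of `‖Dcl‖` in the energy computation. -/
theorem Dcl_flow (ψ : EnergySpace) (t : ℝ) (y : L2) :
    Dcl (flow ψ t y) = S t (Dcl ψ + J1 y) := by
  rw [flow, Dcl_shift, map_add, J1_Kop, J1_S, map_add]
  abel

theorem continuous_shift (ψ : EnergySpace) : Continuous (shift ψ) := by
  rw [continuous_iff_continuousAt]
  intro x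
  obtain ⟨M, hM⟩ := exists_bddBy ψ
  obtain ⟨C, -, hC⟩ := exists_distLE_shift (max M (‖x‖ + 1))
  rw [ContinuousAt, tendsto_iff_edist_tendsto_0]
  have h1 : Tendsto (fun z : L2 => ENNReal.ofReal (3 * (C * (0 + ‖z - x‖)))) (𝓝 x)
      (𝓝 (ENNReal.ofReal (3 * (C * (0 + ‖x - x‖))))) :=
    (ENNReal.continuous_ofReal.comp
      (by fun_prop : Continuous fun z : L2 => 3 * (C * (0 + ‖z - x‖)))).tendsto x
  simp only [sub_self, norm_zero, add_zero, mul_zero, ENNReal.ofReal_zero] at h1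
  refine tendsto_of_tendsto_of_tendsto_of_le_of_le' tendsto_const_nhds h1
    (Eventually.of_forall fun _ => zero_le) ?_
  have : ∀ᶠ z : L2 in 𝓝 x, ‖z‖ < ‖x‖ + 1 := continuous_norm.tendsto x (Iio_mem_nhds (by linarith))
  filter_upwards [this] with z hz
  have hb := hM.mono (le_max_left M (‖x‖ + 1))
  exact edist_le_of_distLE (hC ψ ψ z x hb hb (hz.le.trans (le_max_right _ _))
    ((by linarith : ‖x‖ ≤ ‖x‖ + 1).trans (le_max_right _ _)) 0 (DistLE.refl ψ))

theorem continuousOn_flow {s : Set ℝ} {y : ℝ → L2} (hy : ContinuousOn y s) (ψ : EnergySpace) :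
    ContinuousOn (fun t => flow ψ t (y t)) s := by
  have h1 : ContinuousOn (fun t => S t (y t)) s :=
    continuous_S.comp_continuousOn (f := fun t => (t, y t)) (continuousOn_id.prodMk hy)
  have h2 : ContinuousOn (fun t => Kop t (Dcl ψ) + S t (y t)) s :=
    (continuous_Kop_apply (Dcl ψ)).continuousOn.add h1
  exact (continuous_shift ψ).comp_continuousOn h2

/-- The nonlinear term in the parametrization of `H¹` by `L²`. -/
def Nop (u : EnergySpace) : L2 := (-Complex.I) • (F0 u + F1 u)

theorem continuous_Nop : Continuous Nop :=
  (continuous_F0.add continuous_F1).const_smul (-Complex.I)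

theorem J0_Nop (u : EnergySpace) : J0 (Nop u) = (-Complex.I) • F0 u := by
  rw [Nop, map_smul, (isH1_F u).J0_eq]

theorem J1_Nop (u : EnergySpace) : J1 (Nop u) = (-Complex.I) • F1 u := by
  rw [Nop, map_smul, (isH1_F u).J1_eq]

/-- `y` is the interaction variable of a solution on `[-δ, δ]` with initial value `ψ`. -/
structure IsMild (ψ : EnergySpace) (δ : ℝ) (y : ℝ → L2) : Prop where
  zero : y 0 = 0
  norm_le : ∀ t ∈ Icc (-δ) δ, ‖y t‖ ≤ 1
  deriv : ∀ t ∈ Icc (-δ) δ,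
    HasDerivWithinAt y (S (-t) (Nop (flow ψ t (y t)))) (Icc (-δ) δ) t

/-- The test function is put in the form `FM psym k`; the `ψ` part of the pairing is constant in
time, and the rest is `hasDerivWithinAt_inner_J0`. -/
theorem IsMild.isSolutionOn {ψ : EnergySpace} {δ : ℝ} {y : ℝ → L2} (h : IsMild ψ δ y) :
    IsSolutionOn (Icc (-δ) δ) fun t => flow ψ t (y t) := by
  refine ⟨continuousOn_flow (fun t ht => (h.deriv t ht).continuousWithinAt) ψ,
    fun φ hφ hs t ht => ?_⟩
  obtain ⟨k, hk1, hk2⟩ := exists_testConj_eq hφ hs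
  rw [integral_weak_eq _ hφ hs, ← inner_deriv_testConj hφ hs (ae_eq_refl _),
    ← inner_testConj hφ hs (ae_eq_refl (F0 (flow ψ t (y t)))), hk1, hk2, Dcl_flow]
  have h1 := ((hasDerivWithinAt_inner_J0 (h.deriv t ht) k (Dcl ψ)).const_add
    (∫ x, ψ x * φ x)).const_mul Complex.I
  have e : ∀ r : ℝ, Complex.I * ∫ x, flow ψ r (y r) x * φ x = Complex.I * ((∫ x, ψ x * φ x)
      + ⟪FM psym k, J0 (Kop r (Dcl ψ) + S r (y r))⟫_ℂ) := fun r => by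
    rw [← hk1, inner_testConj hφ hs (rep_ae _), ← integral_add
      (integrable_mul_of_hasCompactSupport ψ.2.continuous.locallyIntegrable hφ.continuous hs)
      (integrable_mul_of_hasCompactSupport (isPrim_rep _).continuous.locallyIntegrable
        hφ.continuous hs)]
    congr 2
    funext x
    rw [flow, shift_apply]
    ring
  refine (h1.congr (fun r _ => e r) (e t)).congr_deriv ?_
  rw [J0_Nop, inner_smul_right, inner_smul_right]
  linear_combination (⟪FM qsym k, S t (Dcl ψ + J1 (y t))⟫_ℂ - ⟪FM psym k, F0 (flow ψ t (y t))⟫_ℂ)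
    * Complex.I_sq

end CubicQuintic

namespace CubicQuintic

open scoped ComplexConjugate InnerProductSpace

/-! ### Local existence and Lipschitz dependence -/

theorem exists_flow_bound (M : ℝ) : ∃ C : ℝ, 0 ≤ C ∧
    (∀ ψ : EnergySpace, BddBy ψ M → ∀ t : ℝ, |t| ≤ 1 → ∀ y : L2, ‖y‖ ≤ 1 →
      ‖Nop (flow ψ t y)‖ ≤ C) ∧
    ∀ ψ χ : EnergySpace, BddBy ψ M → BddBy χ M → ∀ t : ℝ, |t| ≤ 1 → ∀ y z : L2, ‖y‖ ≤ 1 →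
      ‖z‖ ≤ 1 → ∀ d, DistLE ψ χ d →
        DistLE (flow ψ t y) (flow χ t z) (C * (d + ‖y - z‖)) ∧
        ‖Nop (flow ψ t y) - Nop (flow χ t z)‖ ≤ C * (d + ‖y - z‖) := by
  -- `M1` bounds the `L²` code of the translation when `|t| ≤ 1` and `‖y‖ ≤ 1` (5 comes from
  -- `norm_Kop_le`); `M2` below bounds the translated state.
  set M1 := 5 * |M| + 1 with hM1
  obtain ⟨C1, hC1, h1⟩ := exists_distLE_shift M1
  set M2 := M1 + C1 * (0 + M1) with hM2
  obtain ⟨C2, hC2, h2, h3⟩ := exists_F_bound M2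
  have hx : ∀ ψ : EnergySpace, BddBy ψ M → ∀ t : ℝ, |t| ≤ 1 → ∀ y : L2, ‖y‖ ≤ 1 →
      ‖Kop t (Dcl ψ) + S t y‖ ≤ M1 := fun ψ hψ t ht y hy => by
    refine (norm_add_le _ _).trans ?_
    rw [norm_S]
    have := (norm_Kop_le ht (Dcl ψ)).trans (mul_le_mul_of_nonneg_left hψ.der (by norm_num))
    linarith [le_abs_self M]
  have hb1 : ∀ ψ : EnergySpace, BddBy ψ M → BddBy ψ M1 := fun ψ hψ =>
    hψ.mono (by rw [hM1]; linarith [le_abs_self M, abs_nonneg M])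
  have hb2 : ∀ ψ : EnergySpace, BddBy ψ M → ∀ t : ℝ, |t| ≤ 1 → ∀ y : L2, ‖y‖ ≤ 1 →
      BddBy (flow ψ t y) M2 := fun ψ hψ t ht y hy => by
    have h4 := h1 ψ ψ (Kop t (Dcl ψ) + S t y) 0 (hb1 ψ hψ) (hb1 ψ hψ) (hx ψ hψ t ht y hy)
      (by rw [norm_zero]; positivity) 0 (DistLE.refl ψ)
    rw [shift_zero, sub_zero] at h4
    exact ((hb1 ψ hψ).of_distLE h4).mono (by
      rw [hM2]
      gcongr
      exact hx ψ hψ t ht y hy)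
  have hN : ∀ u v : EnergySpace, Nop u - Nop v
      = (-Complex.I) • ((F0 u - F0 v) + (F1 u - F1 v)) := fun u v => by
    rw [Nop, Nop, ← smul_sub]
    congr 1
    abel
  have hC : 0 ≤ 6 * C1 + 2 * C2 * (6 * C1) + 2 * C2 := by positivity
  refine ⟨_, hC, fun ψ hψ t ht y hy => ?_, fun ψ χ hψ hχ t ht y z hy hz d hd => ?_⟩
  · obtain ⟨h4, h5⟩ := h2 _ (hb2 ψ hψ t ht y hy)
    rw [Nop, norm_smul, norm_neg, Complex.norm_I, one_mul]
    refine (norm_add_le _ _).trans ?_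
    have : 0 ≤ C2 * C1 := by positivity
    linarith
  · have h4 := h1 ψ χ _ _ (hb1 ψ hψ) (hb1 χ hχ) (hx ψ hψ t ht y hy) (hx χ hχ t ht z hz) d hd
    have h5 : ‖Kop t (Dcl ψ) + S t y - (Kop t (Dcl χ) + S t z)‖ ≤ 5 * d + ‖y - z‖ := by
      rw [add_sub_add_comm, ← map_sub, ← map_sub]
      refine (norm_add_le _ _).trans ?_
      rw [norm_S]
      have := (norm_Kop_le ht (Dcl ψ - Dcl χ)).trans
        (mul_le_mul_of_nonneg_left hd.der (by norm_num))
      linarith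
    have hd0 := hd.nonneg
    have hyz := norm_nonneg (y - z)
    have h6 : DistLE (flow ψ t y) (flow χ t z) (6 * C1 * (d + ‖y - z‖)) := h4.mono (by
      have := mul_le_mul_of_nonneg_left h5 hC1
      nlinarith [mul_nonneg hC1 hyz])
    have hdz : 0 ≤ d + ‖y - z‖ := by positivity
    refine ⟨h6.mono (mul_le_mul_of_nonneg_right ?_ hdz), ?_⟩
    · have : 0 ≤ C2 * C1 := by positivity
      linarith
    · obtain ⟨h7, h8⟩ := h3 _ _ (hb2 ψ hψ t ht y hy) (hb2 χ hχ t ht z hz) _ h6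
      rw [hN, norm_smul, norm_neg, Complex.norm_I, one_mul]
      refine (norm_add_le _ _).trans ?_
      have : 0 ≤ C1 * (d + ‖y - z‖) := by positivity
      have : 0 ≤ C2 * (d + ‖y - z‖) := by positivity
      linarith

/-- The Picard–Lindelöf theorem, with control of the solution. -/
theorem exists_hasDerivWithinAt_of_isPicardLindelof {E : Type*} [NormedAddCommGroup E]
    [NormedSpace ℝ E] [CompleteSpace E] {f : ℝ → E → E} {tmin tmax : ℝ} {t₀ : Icc tmin tmax}
    {x₀ : E} {a L K : ℝ≥0} (hf : IsPicardLindelof f t₀ x₀ a 0 L K) :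
    ∃ y : ℝ → E, y t₀ = x₀ ∧ (∀ t, y t ∈ Metric.closedBall x₀ a) ∧
      ∀ t ∈ Icc tmin tmax, HasDerivWithinAt y (f t (y t)) (Icc tmin tmax) t := by
  -- The Picard fixed point is used directly, with time projected onto the interval, so that the
  -- ball bound comes with the solution.
  obtain ⟨α, hα⟩ := ODE.FunSpace.exists_isFixedPt_next hf (Metric.mem_closedBall_self le_rfl)
  refine ⟨α.compProj, by
    rw [ODE.FunSpace.compProj_val, ← hα, ODE.FunSpace.next_apply₀],
    fun t => α.compProj_mem_closedBall hf.mul_max_le, fun t ht => ?_⟩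
  refine (ODE.hasDerivWithinAt_picard_Icc t₀.2 hf.continuousOn_uncurry
    α.continuous_compProj.continuousOn (fun _ _ => α.compProj_mem_closedBall hf.mul_max_le)
    x₀ ht).congr_of_mem (fun t' ht' => ?_) ht
  nth_rw 1 [← hα]
  rw [ODE.FunSpace.compProj_of_mem ht', ODE.FunSpace.next_apply]

theorem exists_isMild (M : ℝ) : ∃ δ : ℝ, 0 < δ ∧ ∃ C : ℝ, 0 ≤ C ∧
    (∀ ψ : EnergySpace, BddBy ψ M → ∃ y, IsMild ψ δ y) ∧
    ∀ ψ χ : EnergySpace, BddBy ψ M → BddBy χ M → ∀ y z, IsMild ψ δ y → IsMild χ δ z →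
      ∀ d, DistLE ψ χ d → ∀ t ∈ Icc (-δ) δ,
        DistLE (flow ψ t (y t)) (flow χ t (z t)) (C * d) := by
  obtain ⟨C, hC0, hC1, hC2⟩ := exists_flow_bound M
  -- `C δ ≤ 1/2` keeps `y` in the unit ball and also permits the absorption in the Lipschitz
  -- estimate.
  set δ : ℝ := 1 / (2 * (C + 1)) with hδ
  have hδ0 : 0 < δ := by positivity
  have hδC : C * δ ≤ 1 / 2 := by
    rw [hδ, mul_one_div, div_le_div_iff₀ (by positivity) (by norm_num)]
    linarith
  have hδ1 : δ ≤ 1 := by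
    rw [hδ, div_le_one (by positivity)]
    linarith
  have ht1 : ∀ t ∈ Icc (-δ) δ, |t| ≤ 1 := fun t ht => (abs_le.2 ht).trans hδ1
  have hmem0 : (0 : ℝ) ∈ Icc (-δ) δ := ⟨by linarith, hδ0.le⟩
  refine ⟨δ, hδ0, 2 * C, by positivity, fun ψ hψ => ?_, fun ψ χ hψ hχ y z hy hz d hd t ht => ?_⟩
  · have hP : IsPicardLindelof (fun t y => S (-t) (Nop (flow ψ t y))) (tmin := -δ) (tmax := δ)
        ⟨0, hmem0⟩ (0 : L2) 1 0 C.toNNReal C.toNNReal := by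
      refine ⟨fun t ht => ?_, fun y hy => ?_, fun t ht y hy => ?_, ?_⟩
      · refine LipschitzOnWith.of_dist_le_mul fun y hy z hz => ?_
        rw [dist_eq_norm, dist_eq_norm, ← map_sub, norm_S, Real.coe_toNNReal C hC0]
        have := (hC2 ψ ψ hψ hψ t (ht1 t ht) y z (by simpa using hy) (by simpa using hz) 0
          (DistLE.refl ψ)).2
        rwa [zero_add] at this
      · have h1 : ContinuousOn (fun t => Nop (flow ψ t y)) (Icc (-δ) δ) :=
          continuous_Nop.comp_continuousOn (continuousOn_flow continuousOn_const ψ)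
        exact continuous_S.comp_continuousOn (f := fun t => (-t, Nop (flow ψ t y)))
          (continuousOn_neg.prodMk h1)
      · rw [norm_S, Real.coe_toNNReal C hC0]
        exact hC1 ψ hψ t (ht1 t ht) y (by simpa using hy)
      · rw [Real.coe_toNNReal C hC0]
        simp only [sub_zero, zero_sub, neg_neg, max_self, NNReal.coe_one, NNReal.coe_zero]
        linarith
    obtain ⟨y, hy0, hy1, hy2⟩ := exists_hasDerivWithinAt_of_isPicardLindelof hP
    exact ⟨y, hy0, fun t _ => by simpa using hy1 t, hy2⟩
  · have hcont : ContinuousOn (fun t => ‖y t - z t‖) (Icc (-δ) δ) := fun t ht =>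
      ((hy.deriv t ht).continuousWithinAt.sub (hz.deriv t ht).continuousWithinAt).norm
    -- Absorption in place of Gronwall: the maximum satisfies `m ≤ C δ (d + m) ≤ (d + m) / 2`, hence
    -- `m ≤ d`.
    obtain ⟨t₁, ht₁, hmax⟩ := isCompact_Icc.exists_isMaxOn ⟨0, hmem0⟩ hcont
    set m := ‖y t₁ - z t₁‖ with hm
    have hmax' : ∀ t ∈ Icc (-δ) δ, ‖y t - z t‖ ≤ m := fun t ht => hmax ht
    have hd0 := hd.nonneg
    have hm0 : 0 ≤ m := norm_nonneg _
    have hbound : ∀ t ∈ Icc (-δ) δ,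
        ‖S (-t) (Nop (flow ψ t (y t))) - S (-t) (Nop (flow χ t (z t)))‖ ≤ C * (d + m) :=
      fun t ht => by
        rw [← map_sub, norm_S]
        refine (hC2 ψ χ hψ hχ t (ht1 t ht) _ _ (hy.norm_le t ht) (hz.norm_le t ht) d hd).2.trans ?_
        gcongr
        exact hmax' t ht
    have h1 := Convex.norm_image_sub_le_of_norm_hasDerivWithin_le (f := fun t => y t - z t)
      (fun t ht => (hy.deriv t ht).sub (hz.deriv t ht)) hbound (convex_Icc _ _) hmem0 ht₁
    rw [hy.zero, hz.zero, sub_zero, sub_zero, sub_zero, Real.norm_eq_abs] at h1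
    have h2 : m ≤ C * (d + m) * δ :=
      h1.trans (mul_le_mul_of_nonneg_left (abs_le.2 ht₁) (by positivity))
    have h3 : m ≤ d := by nlinarith [mul_le_mul_of_nonneg_right hδC (add_nonneg hd0 hm0)]
    refine (hC2 ψ χ hψ hχ t (ht1 t ht) _ _ (hy.norm_le t ht) (hz.norm_le t ht) d hd).1.mono ?_
    have h4 := (hmax' t ht).trans h3
    have := mul_le_mul_of_nonneg_left h4 hC0
    linarith

end CubicQuintic

namespace CubicQuintic

open scoped ComplexConjugate InnerProductSpace

/-! ### Conservation of the energy -/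

/-- The real gradient of `‖pot‖²` is `-2 nl`, so this is a Taylor remainder. It is computed exactly,
as `‖pot z‖²` is a cubic polynomial in `‖z‖²`. -/
theorem abs_norm_pot_sq_sub_le {R : ℝ} {z w : ℂ} (hz : ‖z‖ ≤ R) (hw : ‖w‖ ≤ R) :
    |‖pot w‖ ^ 2 - ‖pot z‖ ^ 2 + 2 * (conj (nl z) * (w - z)).re|
      ≤ ((1 + R ^ 2) * (1 + 3 * R ^ 2) + 4 * R ^ 2 * (2 + 3 * R ^ 2)) * ‖w - z‖ ^ 2 := by
  have hR : 0 ≤ R := (norm_nonneg z).trans hz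
  set p := (conj z * (w - z)).re with hp
  have h1 : (conj (nl z) * (w - z)).re = -((1 - ‖z‖ ^ 2) * (1 - 3 * ‖z‖ ^ 2) * p) := by
    have : conj (nl z) * (w - z)
        = ((-((1 - ‖z‖ ^ 2) * (1 - 3 * ‖z‖ ^ 2)) : ℝ) : ℂ) * (conj z * (w - z)) := by
      simp only [nl, pot, map_mul, map_neg, map_sub, map_one, map_pow, Complex.conj_ofReal,
        map_ofNat]
      push_cast
      ring
    rw [this, Complex.re_ofReal_mul, hp]
    ring
  have h2 : ‖w‖ ^ 2 = ‖z‖ ^ 2 + 2 * p + ‖w - z‖ ^ 2 := by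
    simp only [hp, ← Complex.normSq_eq_norm_sq, Complex.normSq_apply, Complex.mul_re,
      Complex.conj_re, Complex.conj_im, Complex.sub_re, Complex.sub_im]
    ring
  have h3 : |‖w‖ - ‖z‖| ≤ ‖w - z‖ := abs_norm_sub_norm_le w z
  have hz0 := norm_nonneg z
  have hw0 := norm_nonneg w
  have hzR : ‖z‖ ^ 2 ≤ R ^ 2 := by gcongr
  have hwR : ‖w‖ ^ 2 ≤ R ^ 2 := by gcongr
  have h4 : (‖w‖ ^ 2 - ‖z‖ ^ 2) ^ 2 ≤ 4 * R ^ 2 * ‖w - z‖ ^ 2 := by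
    have e : (‖w‖ ^ 2 - ‖z‖ ^ 2) ^ 2 = (‖w‖ + ‖z‖) ^ 2 * |‖w‖ - ‖z‖| ^ 2 := by
      rw [sq_abs]; ring
    rw [e]
    calc _ ≤ (R + R) ^ 2 * ‖w - z‖ ^ 2 := by gcongr
      _ = _ := by ring
  rw [norm_pot_sq, norm_pot_sq, h1]
  have e : ‖w‖ ^ 2 * (1 - ‖w‖ ^ 2) ^ 2 - ‖z‖ ^ 2 * (1 - ‖z‖ ^ 2) ^ 2
      + 2 * -((1 - ‖z‖ ^ 2) * (1 - 3 * ‖z‖ ^ 2) * p)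
      = (1 - ‖z‖ ^ 2) * (1 - 3 * ‖z‖ ^ 2) * ‖w - z‖ ^ 2
        + (‖w‖ ^ 2 - ‖z‖ ^ 2) ^ 2 * (-2 + 2 * ‖z‖ ^ 2 + ‖w‖ ^ 2) := by
    have : p = (‖w‖ ^ 2 - ‖z‖ ^ 2 - ‖w - z‖ ^ 2) / 2 := by linarith
    rw [this]
    ring
  have hz2 := sq_nonneg ‖z‖
  have hw2 := sq_nonneg ‖w‖
  have h5 : |1 - ‖z‖ ^ 2| ≤ 1 + R ^ 2 := by rw [abs_le]; constructor <;> nlinarith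
  have h6 : |1 - 3 * ‖z‖ ^ 2| ≤ 1 + 3 * R ^ 2 := by rw [abs_le]; constructor <;> nlinarith
  have h7 : |-2 + 2 * ‖z‖ ^ 2 + ‖w‖ ^ 2| ≤ 2 + 3 * R ^ 2 := by rw [abs_le]; constructor <;> nlinarith
  rw [e, add_mul]
  refine (abs_add_le _ _).trans (add_le_add ?_ ?_)
  · rw [abs_mul, abs_mul, abs_of_nonneg (sq_nonneg ‖w - z‖)]
    gcongr
  · rw [abs_mul, abs_of_nonneg (sq_nonneg (‖w‖ ^ 2 - ‖z‖ ^ 2))]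
    calc _ ≤ 4 * R ^ 2 * ‖w - z‖ ^ 2 * (2 + 3 * R ^ 2) := by gcongr
      _ = _ := by ring

theorem abs_norm_Pot_sq_sub_le {R : ℝ} {ψ χ : EnergySpace} (hψ : BddBy ψ R) (hχ : BddBy χ R)
    {w : L2} (hw : w =ᵐ[volume] fun x => χ x - ψ x) :
    |‖Pot χ‖ ^ 2 - ‖Pot ψ‖ ^ 2 + 2 * (⟪F0 ψ, w⟫_ℂ).re|
      ≤ ((1 + R ^ 2) * (1 + 3 * R ^ 2) + 4 * R ^ 2 * (2 + 3 * R ^ 2)) * ‖w‖ ^ 2 := by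
  have hi : Integrable fun x => (conj (F0 ψ x) * w x) :=
    (Lp.memLp (F0 ψ)).star.integrable_mul (Lp.memLp w)
  have hi1 : Integrable fun x => 2 * (conj (F0 ψ x) * w x).re := hi.re.const_mul 2
  have hi2 : Integrable fun x => ‖Pot χ x‖ ^ 2 - ‖Pot ψ x‖ ^ 2 :=
    (integrable_norm_sq _).sub (integrable_norm_sq _)
  have e1 : (⟪F0 ψ, w⟫_ℂ).re = ∫ x, (conj (F0 ψ x) * w x).re := by
    rw [inner_eq_integral (ae_eq_refl _) (ae_eq_refl _)]
    exact (integral_re hi).symm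
  rw [e1, norm_sq_eq_integral (Pot χ), norm_sq_eq_integral (Pot ψ), norm_sq_eq_integral w,
    ← integral_const_mul, ← integral_const_mul,
    ← integral_sub (integrable_norm_sq _) (integrable_norm_sq _),
    ← integral_add hi2 hi1,
    ← Real.norm_eq_abs]
  refine norm_integral_le_of_norm_le ((integrable_norm_sq w).const_mul _) ?_
  filter_upwards [Pot_coeFn χ, Pot_coeFn ψ, F0_coeFn ψ, hw] with x h1 h2 h3 h4
  rw [h1, h2, h3, h4]
  exact abs_norm_pot_sq_sub_le (hψ.sup x) (hχ.sup x)

theorem IsSolutionOn.comp_sub {I : Set ℝ} {u : ℝ → EnergySpace} (h : IsSolutionOn I u) (c : ℝ) :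
    IsSolutionOn ((fun t => t - c) ⁻¹' I) fun t => u (t - c) := by
  refine ⟨h.continuousOn.comp (continuous_id.sub continuous_const).continuousOn fun t ht => ht,
    fun φ hφ hs t ht => ?_⟩
  have h1 := (h.equation φ hφ hs (t - c) ht).scomp t
    ((hasDerivWithinAt_id t ((fun t => t - c) ⁻¹' I)).sub_const c) fun r hr => hr
  rwa [one_smul] at h1

section

variable {a b : ℝ} {u : ℝ → EnergySpace}

/-- The linear Taylor term pairs the increment with `F0 (u t)`, an `H¹` function, so the equation
differentiates it; the remainder is controlled by `hasDerivWithinAt_norm_sq`. -/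
theorem IsSolutionOn.hasDerivWithinAt_norm_Pot (h : IsSolutionOn (Icc a b) u) {t : ℝ}
    (ht : t ∈ Icc a b) : HasDerivWithinAt (fun r => ‖Pot (u r)‖ ^ 2)
      (-2 * (⟪F1 (u t), Complex.I • Dcl (u t)⟫_ℂ).re) (Icc a b) t := by
  obtain ⟨W, hW⟩ := h.exists_increments ht
  obtain ⟨R, hR⟩ := exists_bddBy_of_continuousOn h.continuousOn
  have hWt : W t = 0 := by
    apply Lp.ext
    filter_upwards [hW.coeFn t ht, Lp.coeFn_zero ℂ 2 (volume : Measure ℝ)] with x h1 h2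
    rw [h1, h2, sub_self, Pi.zero_apply]
  have h1 := h.hasDerivWithinAt_inner hW ht (isH1_F (u t))
  have h2 := (Complex.reCLM.hasFDerivAt.comp_hasDerivWithinAt t h1).const_mul (-2)
  have h3 := (h.hasDerivWithinAt_norm_sq hW ht).const_mul
    ((1 + R ^ 2) * (1 + 3 * R ^ 2) + 4 * R ^ 2 * (2 + 3 * R ^ 2))
  rw [mul_zero] at h3
  refine hasDerivWithinAt_of_norm_le (h2.congr_deriv ?_) h3 (by simp) fun r hr => ?_
  · have h4 : (⟪F0 (u t), (-Complex.I) • F0 (u t)⟫_ℂ).re = 0 := by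
      rw [inner_smul_right, inner_self_eq_norm_sq_to_K]
      simp [← Complex.ofReal_pow]
    rw [Complex.reCLM_apply, Complex.add_re, h4, zero_add]
  · simp only [Function.comp_apply, Complex.reCLM_apply, hWt, inner_zero_right, Complex.zero_re,
      mul_zero, sub_zero]
    have := abs_norm_Pot_sq_sub_le (hR t ht) (hR r hr) (hW.coeFn r hr)
    rwa [neg_mul, sub_neg_eq_add]

/-- `Dcl (u r)` is only known to be continuous in time. By uniqueness `u` is mild near `t`, and the
isometry `S` reduces its norm to that of `Dcl (u t) + J1 y`, which is differentiable. -/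
theorem IsSolutionOn.hasDerivWithinAt_norm_Dcl (h : IsSolutionOn (Icc a b) u) {t : ℝ}
    (ht : t ∈ Icc a b) : HasDerivWithinAt (fun r => ‖Dcl (u r)‖ ^ 2)
      (2 * (⟪Dcl (u t), (-Complex.I) • F1 (u t)⟫_ℂ).re) (Icc a b) t := by
  obtain ⟨M, hM⟩ := exists_bddBy (u t)
  obtain ⟨δ, hδ, -, -, hex, -⟩ := exists_isMild M
  obtain ⟨y, hy⟩ := hex (u t) hM
  set P := (fun r => r - t) ⁻¹' Icc (-δ) δ with hP
  have hPI : P = Icc (t - δ) (t + δ) := by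
    rw [hP, preimage_sub_const_Icc]
    congr 1 <;> ring
  have htP : t ∈ P := by simp [hP, hδ.le]
  have hord : (Icc a b ∩ P).OrdConnected := by
    rw [hPI]
    exact ordConnected_Icc.inter ordConnected_Icc
  have heq : EqOn u (fun r => flow (u t) (r - t) (y (r - t))) (Icc a b ∩ P) :=
    (h.mono inter_subset_left).eqOn hord ((hy.isSolutionOn.comp_sub t).mono inter_subset_right)
      ⟨ht, htP⟩ (by rw [sub_self, hy.zero, flow_zero])
  have hnorm : ∀ r ∈ Icc a b ∩ P, ‖Dcl (u r)‖ ^ 2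
      = (⟪Dcl (u t) + J1 (y (r - t)), Dcl (u t) + J1 (y (r - t))⟫_ℂ).re := fun r hr => by
    rw [heq hr, Dcl_flow, norm_S, inner_self_eq_norm_sq_to_K]
    simp [← Complex.ofReal_pow]
  have hmem : (0 : ℝ) ∈ Icc (-δ) δ := by simp [hδ.le]
  have h1 : HasDerivWithinAt (fun r => y (r - t)) (Nop (u t)) P t := by
    have h0 := hy.deriv (t - t) (by rwa [sub_self])
    have h2 := HasDerivWithinAt.scomp (h := fun r => r - t) t h0
      ((hasDerivWithinAt_id t P).sub_const t) fun r hr => hr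
    rwa [one_smul, sub_self, hy.zero, flow_zero, neg_zero, S_zero] at h2
  have h2 : HasDerivWithinAt (fun r => Dcl (u t) + J1 (y (r - t))) (J1 (Nop (u t))) P t :=
    ((J1.restrictScalars ℝ).hasFDerivAt.comp_hasDerivWithinAt t h1).const_add _
  have h3 := Complex.reCLM.hasFDerivAt.comp_hasDerivWithinAt t (h2.inner ℂ h2)
  have h4 := (h3.mono (inter_subset_right (s := Icc a b))).congr_of_mem hnorm ⟨ht, htP⟩
  have hnhds : Icc a b ∩ P ∈ 𝓝[Icc a b] t := by
    refine inter_mem self_mem_nhdsWithin (mem_nhdsWithin_of_mem_nhds ?_)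
    rw [hPI]
    exact Icc_mem_nhds (by linarith) (by linarith)
  refine (h4.mono_of_mem_nhdsWithin hnhds).congr_deriv ?_
  rw [sub_self, hy.zero, map_zero, add_zero, J1_Nop, Complex.reCLM_apply, Complex.add_re,
    ← inner_conj_symm ((-Complex.I) • F1 (u t)), Complex.conj_re]
  ring

/-- The two derivatives are `2 Im ⟪Dcl, F1⟫` and its opposite. -/
theorem IsSolutionOn.energy_eq_of_mem (h : IsSolutionOn (Icc a b) u) {s t : ℝ}
    (hs : s ∈ Icc a b) (ht : t ∈ Icc a b) : (u s).energy = (u t).energy := by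
  have hd : ∀ r ∈ Icc a b, HasDerivWithinAt (fun r => (u r).energy) 0 (Icc a b) r := fun r hr => by
    simp only [energy_eq]
    refine ((h.hasDerivWithinAt_norm_Dcl hr).add (h.hasDerivWithinAt_norm_Pot hr)).congr_deriv ?_
    rw [inner_smul_right, inner_smul_right, ← inner_conj_symm (F1 (u r))]
    simp only [Complex.mul_re, Complex.neg_re, Complex.neg_im, Complex.I_re, Complex.I_im,
      Complex.conj_re, Complex.conj_im]
    ring
  exact eq_of_hasDerivWithinAt_zero (convex_Icc a b) hd hs ht

theorem IsSolutionOn.energy_eq {I : Set ℝ} (hI : I.OrdConnected) (h : IsSolutionOn I u) {s t : ℝ}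
    (hs : s ∈ I) (ht : t ∈ I) : (u s).energy = (u t).energy :=
  (h.mono (hI.uIcc_subset hs ht)).energy_eq_of_mem
    ⟨min_le_left _ _, le_max_left _ _⟩ ⟨min_le_right _ _, le_max_right _ _⟩

end

end CubicQuintic

namespace CubicQuintic

/-! ### Global solutions -/

/-- The step depends only on the energy bound. Uniqueness extends the Lipschitz estimate from mild
to arbitrary solutions. -/
theorem exists_local_solution (R : ℝ) : ∃ δ : ℝ, 0 < δ ∧ ∃ C : ℝ≥0,
    (∀ ψ : EnergySpace, ψ.energy ≤ R → ∃ u, IsSolutionOn (Icc (-δ) δ) u ∧ u 0 = ψ) ∧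
    ∀ u v : ℝ → EnergySpace, IsSolutionOn (Icc (-δ) δ) u → IsSolutionOn (Icc (-δ) δ) v →
      (u 0).energy ≤ R → (v 0).energy ≤ R → ∀ t ∈ Icc (-δ) δ,
        edist (u t) (v t) ≤ C * edist (u 0) (v 0) := by
  obtain ⟨δ, hδ, C, hC, hex, hlip⟩ := exists_isMild (2 + 2 * √R)
  have hmem : (0 : ℝ) ∈ Icc (-δ) δ := by simp [hδ.le]
  have hflow0 : ∀ ψ y, IsMild ψ δ y → flow ψ 0 (y 0) = ψ := fun ψ y hy => by
    rw [hy.zero, flow_zero]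
  refine ⟨δ, hδ, (3 * C).toNNReal, fun ψ hψ => ?_, fun u v hu hv hu0 hv0 t ht => ?_⟩
  · obtain ⟨y, hy⟩ := hex ψ (bddBy_of_energy_le hψ)
    exact ⟨_, hy.isSolutionOn, hflow0 ψ y hy⟩
  · obtain ⟨y, hy⟩ := hex _ (bddBy_of_energy_le hu0)
    obtain ⟨z, hz⟩ := hex _ (bddBy_of_energy_le hv0)
    rw [hu.eq_of_eq hy.isSolutionOn hmem (hflow0 _ y hy).symm ht,
      hv.eq_of_eq hz.isSolutionOn hmem (hflow0 _ z hz).symm ht]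
    have h1 := edist_le_of_distLE (hlip _ _ (bddBy_of_energy_le hu0) (bddBy_of_energy_le hv0) y z
      hy hz _ (distLE_toReal (u 0) (v 0)) t ht)
    rwa [← mul_assoc, ENNReal.ofReal_mul (by positivity),
      ENNReal.ofReal_toReal (edist_lt_top_energySpace _ _).ne] at h1

/-! ### Gluing in time and continuation -/

theorem IsSolutionOn.congr {I : Set ℝ} {u v : ℝ → EnergySpace} (h : IsSolutionOn I u)
    (huv : EqOn v u I) : IsSolutionOn I v := by
  refine ⟨h.continuousOn.congr huv, fun φ hφ hs t ht => ?_⟩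
  rw [huv ht]
  exact (h.equation φ hφ hs t ht).congr_of_mem (fun r hr => by rw [huv hr]) ht

/-- At a common point the two derivatives within `A` and `B` have the same value and combine; at any
other point one set is a neighbourhood within the union because the other is closed. -/
theorem IsSolutionOn.union {A B : Set ℝ} {u : ℝ → EnergySpace} (hA : IsSolutionOn A u)
    (hB : IsSolutionOn B u) (hAc : IsClosed A) (hBc : IsClosed B) : IsSolutionOn (A ∪ B) u := by
  have hmem : ∀ {A B : Set ℝ}, IsClosed B → ∀ t ∉ B, A ∈ 𝓝[A ∪ B] t := fun {A B} hB t ht => by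
    have h1 : Bᶜ ∈ 𝓝[A ∪ B] t := mem_nhdsWithin_of_mem_nhds (hB.isOpen_compl.mem_nhds ht)
    filter_upwards [h1, self_mem_nhdsWithin] with r hr hr'
    exact hr'.resolve_right hr
  refine ⟨hA.continuousOn.union_of_isClosed hB.continuousOn hAc hBc, fun φ hφ hs t ht => ?_⟩
  by_cases htA : t ∈ A
  · by_cases htB : t ∈ B
    · exact (hA.equation φ hφ hs t htA).union (hB.equation φ hφ hs t htB)
    · exact (hA.equation φ hφ hs t htA).mono_of_mem_nhdsWithin (hmem hBc t htB)
  · have htB := ht.resolve_left htA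
    refine (hB.equation φ hφ hs t htB).mono_of_mem_nhdsWithin ?_
    rw [union_comm]
    exact hmem hAc t htA

theorem IsSolutionOn.exists_glue {a b c : ℝ} {u v : ℝ → EnergySpace}
    (hu : IsSolutionOn (Icc a b) u) (hv : IsSolutionOn (Icc b c) v) (huv : u b = v b) (hab : a ≤ b)
    (hbc : b ≤ c) :
    ∃ w, IsSolutionOn (Icc a c) w ∧ EqOn w u (Icc a b) ∧ EqOn w v (Icc b c) := by
  have h1 : EqOn (fun t => if t ≤ b then u t else v t) u (Icc a b) := fun t ht => if_pos ht.2
  have h2 : EqOn (fun t => if t ≤ b then u t else v t) v (Icc b c) := fun t ht => by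
    rcases ht.1.eq_or_lt with rfl | h
    · simp [huv]
    · simp [h.not_ge]
  refine ⟨_, ?_, h1, h2⟩
  rw [← Icc_union_Icc_eq_Icc hab hbc]
  exact (hu.congr h1).union (hv.congr h2) isClosed_Icc isClosed_Icc

/-- Energy conservation makes the same `δ` available at both endpoints at every stage. -/
theorem exists_solution_nsmul (ψ : EnergySpace) : ∃ δ : ℝ, 0 < δ ∧
    ∀ n : ℕ, ∃ u, IsSolutionOn (Icc (-(n * δ)) (n * δ)) u ∧ u 0 = ψ := by
  obtain ⟨δ, hδ, -, hex, -⟩ := exists_local_solution ψ.energy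
  refine ⟨δ, hδ, fun n => ?_⟩
  induction n with
  | zero =>
    obtain ⟨u, hu, hu0⟩ := hex ψ le_rfl
    refine ⟨u, hu.mono (Icc_subset_Icc ?_ ?_), hu0⟩ <;> simp [hδ.le]
  | succ n ih =>
    obtain ⟨u, hu, hu0⟩ := ih
    set T : ℝ := n * δ with hT
    have hT0 : 0 ≤ T := by positivity
    have e : ((n + 1 : ℕ) : ℝ) * δ = T + δ := by rw [hT]; push_cast; ring
    have hmem : (0 : ℝ) ∈ Icc (-T) T := by simp [hT0]
    have henergy : ∀ t ∈ Icc (-T) T, (u t).energy ≤ ψ.energy := fun t ht => by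
      rw [hu.energy_eq_of_mem ht hmem, hu0]
    have hTm : T ∈ Icc (-T) T := ⟨by linarith, le_rfl⟩
    have hTm' : -T ∈ Icc (-T) T := ⟨le_rfl, by linarith⟩
    obtain ⟨v, hv, hv0⟩ := hex (u T) (henergy T hTm)
    obtain ⟨w, hw, hw0⟩ := hex (u (-T)) (henergy (-T) hTm')
    have hv1 : IsSolutionOn (Icc T (T + δ)) fun t => v (t - T) :=
      (hv.comp_sub T).mono fun t ht => ⟨by linarith [ht.1], by linarith [ht.2]⟩
    have hw1 : IsSolutionOn (Icc (-T - δ) (-T)) fun t => w (t - (-T)) :=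
      (hw.comp_sub (-T)).mono fun t ht => ⟨by linarith [ht.1], by linarith [ht.2]⟩
    obtain ⟨x, hx, hxu, -⟩ := hu.exists_glue hv1 (by simp [hv0]) (by linarith) (by linarith)
    obtain ⟨z, hz, -, hzx⟩ := hw1.exists_glue hx (by rw [hxu hTm', sub_self, hw0]) (by linarith)
      (by linarith)
    refine ⟨z, ?_, ?_⟩
    · rw [e, neg_add']
      exact hz
    · rw [hzx ⟨by linarith, by linarith⟩, hxu hmem, hu0]

theorem exists_global_solution (ψ : EnergySpace) : ∃ u, IsSolutionOn univ u ∧ u 0 = ψ := by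
  obtain ⟨δ, hδ, hex⟩ := exists_solution_nsmul ψ
  have hex' : ∀ n : ℕ, ∃ u, IsSolutionOn (Icc (-(n : ℝ)) n) u ∧ u 0 = ψ := fun n => by
    obtain ⟨m, hm⟩ := exists_nat_ge ((n : ℝ) / δ)
    rw [div_le_iff₀ hδ] at hm
    obtain ⟨u, hu, hu0⟩ := hex m
    exact ⟨u, hu.mono (Icc_subset_Icc (by linarith) hm), hu0⟩
  choose u hu hu0 using hex'
  have hmem : ∀ n : ℕ, (0 : ℝ) ∈ Icc (-(n : ℝ)) n := fun n => by simp
  have hle : ∀ m n : ℕ, m ≤ n → EqOn (u m) (u n) (Icc (-(m : ℝ)) m) := fun m n hmn => by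
    have hmn' : (m : ℝ) ≤ n := by exact_mod_cast hmn
    exact (hu m).eqOn ordConnected_Icc
      ((hu n).mono (Icc_subset_Icc (by linarith) hmn')) (hmem m) ((hu0 m).trans (hu0 n).symm)
  -- At time `t` use the first solution whose interval contains `t`; by uniqueness any later one
  -- gives the same value.
  have heq : ∀ n : ℕ, EqOn (fun t => u ⌈|t|⌉₊ t) (u n) (Icc (-(n : ℝ)) n) := fun n t ht =>
    hle _ n (Nat.ceil_le.2 (abs_le.2 ht)) (abs_le.1 (Nat.le_ceil _))
  have hsol : ∀ n : ℕ, IsSolutionOn (Icc (-(n : ℝ)) n) fun t => u ⌈|t|⌉₊ t := fun n =>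
    (hu n).congr (heq n)
  have hloc : ∀ t : ℝ, ∃ n : ℕ, Icc (-(n : ℝ)) n ∈ 𝓝 t := fun t => by
    obtain ⟨n, hn⟩ := exists_nat_gt |t|
    exact ⟨n, Icc_mem_nhds (abs_lt.1 hn).1 (abs_lt.1 hn).2⟩
  refine ⟨fun t => u ⌈|t|⌉₊ t, ⟨fun t _ => ?_, fun φ hφ hs t _ => ?_⟩, ?_⟩
  · obtain ⟨n, hn⟩ := hloc t
    exact ((hsol n).continuousOn.continuousAt hn).continuousWithinAt
  · obtain ⟨n, hn⟩ := hloc t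
    exact (((hsol n).equation φ hφ hs t (mem_of_mem_nhds hn)).hasDerivAt hn).hasDerivWithinAt
  · exact hu0 _

/-! ### Continuous dependence on bounded time intervals -/

theorem exists_edist_le (R T : ℝ) : ∃ C : ℝ≥0, ∀ u v : ℝ → EnergySpace,
    IsSolutionOn univ u → IsSolutionOn univ v → (u 0).energy ≤ R → (v 0).energy ≤ R →
      ∀ t, |t| ≤ T → edist (u t) (v t) ≤ C * edist (u 0) (v 0) := by
  obtain ⟨δ, hδ, C, -, hlip⟩ := exists_local_solution R
  have key : ∀ n : ℕ, ∀ u v : ℝ → EnergySpace,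
      IsSolutionOn univ u → IsSolutionOn univ v → (u 0).energy ≤ R → (v 0).energy ≤ R →
      ∀ t, |t| ≤ (n + 1) * δ → edist (u t) (v t) ≤ (C ^ (n + 1) : ℝ≥0) * edist (u 0) (v 0) := by
    intro n
    induction n with
    | zero =>
      intro u v hu hv hu0 hv0 t ht
      rw [zero_add, pow_one]
      refine hlip u v (hu.mono (subset_univ _)) (hv.mono (subset_univ _)) hu0 hv0 t (abs_le.1 ?_)
      simpa using ht
    | succ n ih =>
      intro u v hu hv hu0 hv0 t ht
      -- Scaling `t` handles both signs at once: `s` is within reach of the induction hypothesis,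
      -- and `t - s` is at most one local step.
      set s : ℝ := t * ((n + 1) / (n + 2)) with hs
      have hn : (0 : ℝ) < n + 2 := by positivity
      push_cast at ht
      have hs1 : |s| ≤ (n + 1) * δ := by
        rw [hs, abs_mul, abs_of_nonneg (by positivity : (0 : ℝ) ≤ (n + 1) / (n + 2)), mul_div_assoc',
          div_le_iff₀ hn]
        nlinarith
      have hs2 : |t - s| ≤ δ := by
        have e : t - s = t / (n + 2) := by rw [hs]; field_simp; ring
        rw [e, abs_div, abs_of_pos hn, div_le_iff₀ hn]
        linarith
      have hshift : ∀ w : ℝ → EnergySpace, IsSolutionOn univ w →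
          IsSolutionOn (Icc (-δ) δ) fun r => w (r - (-s)) := fun w hw =>
        (hw.comp_sub (-s)).mono fun r _ => mem_univ _
      have henergy : ∀ w : ℝ → EnergySpace, IsSolutionOn univ w → (w 0).energy ≤ R →
          (w (0 - (-s))).energy ≤ R := fun w hw hw0 => by
        rwa [hw.energy_eq ordConnected_univ (mem_univ (0 - (-s))) (mem_univ 0)]
      have h1 := hlip _ _ (hshift u hu) (hshift v hv) (henergy u hu hu0) (henergy v hv hv0)
        (t - s) (abs_le.1 hs2)
      have h2 := ih u v hu hv hu0 hv0 s hs1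
      simp only [sub_neg_eq_add, sub_add_cancel, zero_add] at h1
      refine h1.trans ((mul_le_mul_right h2 _).trans_eq ?_)
      rw [pow_succ' C (n + 1), ENNReal.coe_mul, mul_assoc]
  obtain ⟨n, hn⟩ := exists_nat_ge (T / δ)
  rw [div_le_iff₀ hδ] at hn
  exact ⟨C ^ (n + 1), fun u v hu hv hu0 hv0 t ht =>
    key n u v hu hv hu0 hv0 t (ht.trans (by linarith))⟩

/-- Energy is continuous, so data near `ψ` have energy at most `ψ.energy + 1` and share one
Lipschitz constant. -/
theorem tendstoUniformlyOn_of_isSolutionOn {Φ : EnergySpace → ℝ → EnergySpace}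
    (hΦ : ∀ ψ, IsSolutionOn univ (Φ ψ) ∧ Φ ψ 0 = ψ) (ψ : EnergySpace) (T : ℝ) :
    TendstoUniformlyOn Φ (Φ ψ) (𝓝 ψ) (Icc (-T) T) := by
  obtain ⟨C, hC⟩ := exists_edist_le (ψ.energy + 1) T
  rw [EMetric.tendstoUniformlyOn_iff]
  intro ε hε
  have h1 : ∀ᶠ χ in 𝓝 ψ, χ.energy < ψ.energy + 1 :=
    continuous_energy.tendsto ψ (Iio_mem_nhds (by linarith))
  have h2 : Tendsto (fun χ => C * edist ψ χ) (𝓝 ψ) (𝓝 (C * edist ψ ψ)) :=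
    ENNReal.Tendsto.const_mul ((continuous_const.edist continuous_id).tendsto ψ)
      (Or.inr ENNReal.coe_ne_top)
  rw [edist_self, mul_zero] at h2
  filter_upwards [h1, h2 (Iio_mem_nhds hε)] with χ hχ hχ' t ht
  have h3 := hC (Φ ψ) (Φ χ) (hΦ ψ).1 (hΦ χ).1 (by rw [(hΦ ψ).2]; linarith)
    (by rw [(hΦ χ).2]; exact hχ.le) t (abs_le.2 ht)
  rw [(hΦ ψ).2, (hΦ χ).2] at h3
  exact h3.trans_lt hχ'

theorem memLp_top (ψ : EnergySpace) : MemLp ψ ∞ volume := by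
  obtain ⟨M, hM⟩ := exists_bddBy ψ
  exact memLp_top_of_bound ψ.2.continuous.aestronglyMeasurable M (Eventually.of_forall hM.sup)

end CubicQuintic

end

/-! ### Assembly of the well-posedness theorem -/

theorem mainTheorem3 :
    -- the energy space consists of bounded functions
    (∀ ψ : EnergySpace, MemLp ψ ∞ volume) ∧
    -- uniqueness on every time interval
    (∀ I : Set ℝ, I.OrdConnected → ∀ u v : ℝ → EnergySpace,
      IsSolutionOn I u → IsSolutionOn I v → ∀ t₀ ∈ I, u t₀ = v t₀ → EqOn u v I) ∧
    -- conservation of energy on every time interval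
    (∀ I : Set ℝ, I.OrdConnected → ∀ u : ℝ → EnergySpace, IsSolutionOn I u →
      ∀ s ∈ I, ∀ t ∈ I, (u s).energy = (u t).energy) ∧
    -- local existence and continuous dependence, on a time interval that depends only on the
    -- size of the initial data in the Zhidkov space
    (∀ M : ℝ≥0, ∃ T : ℝ, 0 < T ∧ ∃ Φ : EnergySpace → ℝ → EnergySpace,
      ∀ ψ₀ : EnergySpace, ψ₀.zhidkovNorm ≤ M →
        IsSolutionOn (Icc (-T) T) (Φ ψ₀) ∧ Φ ψ₀ 0 = ψ₀ ∧
        TendstoUniformlyOn Φ (Φ ψ₀) (𝓝[{χ | χ.zhidkovNorm ≤ M}] ψ₀) (Icc (-T) T)) ∧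
    -- global existence and continuous dependence, locally uniformly in time
    (∃ Φ : EnergySpace → C(ℝ, EnergySpace), Continuous Φ ∧
      ∀ ψ₀ : EnergySpace, IsSolutionOn univ (Φ ψ₀) ∧ Φ ψ₀ 0 = ψ₀) := by
  choose U hU using exists_global_solution
  have hunif := tendstoUniformlyOn_of_isSolutionOn hU
  refine ⟨memLp_top, fun I hI u v hu hv t₀ ht₀ huv => hu.eqOn hI hv ht₀ huv,
    -- As solutions are global, the local statement holds with `T = 1` for every `M`.
    fun I hI u hu s hs t ht => hu.energy_eq hI hs ht, fun M => ⟨1, one_pos, U, fun ψ _ =>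
      ⟨(hU ψ).1.mono (subset_univ _), (hU ψ).2, fun V hV => ?_⟩⟩,
    fun ψ => ⟨U ψ, continuousOn_univ.1 (hU ψ).1.continuousOn⟩, ?_, hU⟩
  · exact nhdsWithin_le_nhds (hunif ψ 1 V hV)
  · rw [continuous_iff_continuousAt]
    intro ψ
    -- The topology of `C(ℝ, EnergySpace)` is that of uniform convergence on compact sets, and each
    -- compact set lies in some `[-r, r]`.
    rw [ContinuousAt, ContinuousMap.tendsto_iff_forall_isCompact_tendstoUniformlyOn]
    intro K hK
    obtain ⟨r, hr⟩ := hK.isBounded.subset_closedBall 0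
    rw [Real.closedBall_eq_Icc, zero_sub, zero_add] at hr
    exact (hunif ψ r).mono hr
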